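/- Let $M$ be a complete smooth $n$-dimensional Riemannian manifold (without boundary, second countable) with Riemannian volume measure $\mu$, and let $\alpha$ be a smooth harmonic 1-form on $M$, i.e. $\Delta\alpha=(d\delta+\delta d)\alpha=0$, such that $|\alpha|\in L^2(M,\mu)\cap L^4(M,\mu)$. Let $v=\alpha^\sharp$ be the dual vector field, $v^\flat=\alpha$. Then $v$ is a (smooth) steady solution of the Euler equations: there is a smooth function $p$ on $M$ such that the time-independent pair $(v,p)$ satisfies $$\partial_t v+\nabla_v v=-\operatorname{grad}p,\qquad \operatorname{div}v=0 .$$ Moreover, $L_v\alpha=d(\iota_v\alpha)$, where $\iota_v\alpha=\alpha(v)$ is a smooth function in $L^2(M,\mu)$; thus $L_v\alpha$ lies in $d\Omega^0_{L^2}$, the differentials of smooth $L^2$ functions. Consequently $L_v\alpha$ vanishes in the dual space $\Omega^1_{L^2}/\overline{d\Omega^0_{L^2}}$, where $\Omega^1_{L^2}$ is the space of square-integrable 1-forms and the closure is that of $d\Omega^0_{L^2}\cap\Omega^1_{L^2}$ in $L^2$, in the following sense: $\alpha\in\Omega^1_{L^2}$; if $L_v\alpha\in\Omega^1_{L^2}$,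 then its coset in $\Omega^1_{L^2}/\overline{d\Omega^0_{L^2}}$ is zero; and, without that assumption, its pairing with divergence-free fields is zero, that is $\int_M \iota_w(L_v\alpha)\,d\mu=0$ for every smooth divergence-free vector field $w$ with $|w|\in L^2(M,\mu)$ for which $\iota_w(L_v\alpha)$ is integrable. -/

import Mathlib

open Bundle Manifold MeasureTheory Set
open scoped ContDiff ENNReal

noncomputable section

namespace Riem

/-- The model space `ℝⁿ`. -/
abbrev Euc (n : ℕ) : Type := EuclideanSpace ℝ (Fin n)

section Charts

variable {n : ℕ} {M : Type*} [TopologicalSpace M] [ChartedSpace (Euc n) M]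
  [IsManifold (𝓡 n) ∞ M]

/-- The coordinate vector field `∂ᵢ` of the preferred chart at `x₀`, at the point `y`
(meaningful for `y` in the domain of that chart). -/
def frame (x₀ : M) (i : Fin n) (y : M) : TangentSpace (𝓡 n) y :=
  (trivializationAt (Euc n) (TangentSpace (𝓡 n)) x₀).symmL ℝ y (EuclideanSpace.single i 1)

/-- The coordinate 1-form `dxⁱ` of the preferred chart at `x₀`, at the point `y`. -/
def coframe (x₀ : M) (i : Fin n) (y : M) : TangentSpace (𝓡 n) y →L[ℝ] ℝ :=
  (EuclideanSpace.proj i : Euc n →L[ℝ] ℝ) ∘L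
    (trivializationAt (Euc n) (TangentSpace (𝓡 n)) x₀).continuousLinearMapAt ℝ y

/-- The partial derivative `∂ᵢ f` at `y`, in the preferred chart at `x₀`. -/
def pd (x₀ : M) (i : Fin n) (f : M → ℝ) (y : M) : ℝ :=
  mvfderiv (𝓡 n) f y (frame x₀ i y)

variable (n M) in
/-- The vector space of all (not necessarily continuous) 1-forms on `M`. -/
def OneForm : Type _ := (x : M) → TangentSpace (𝓡 n) x →L[ℝ] ℝ

instance : AddCommGroup (OneForm n M) :=
  inferInstanceAs (AddCommGroup ((x : M) → TangentSpace (𝓡 n) x →L[ℝ] ℝ))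

instance : Module ℝ (OneForm n M) :=
  inferInstanceAs (Module ℝ ((x : M) → TangentSpace (𝓡 n) x →L[ℝ] ℝ))

/-- `α` is a smooth (`C^∞`) differential 1-form on `M`. -/
def IsSmoothForm (α : OneForm n M) : Prop :=
  ContMDiff (𝓡 n) ((𝓡 n).prod 𝓘(ℝ, Euc n →L[ℝ] ℝ)) ∞
    (fun x ↦ TotalSpace.mk' (Euc n →L[ℝ] ℝ)
      (E := fun x : M ↦ TangentSpace (𝓡 n) x →L[ℝ] Bundle.Trivial M ℝ x) x (α x))

/-- `v` is a smooth (`C^∞`) vector field on `M`. -/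
def IsSmoothField (v : (x : M) → TangentSpace (𝓡 n) x) : Prop :=
  ContMDiff (𝓡 n) (𝓡 n).tangent ∞ (fun x ↦ (⟨x, v x⟩ : TangentBundle (𝓡 n) M))

/-- The exterior derivative of a 1-form, `dα = ∑ (∂ᵢ αⱼ - ∂ⱼ αᵢ) dxⁱ ⊗ dxʲ` (sum over all
`i, j`), evaluated on two tangent vectors. -/
def extD (α : OneForm n M) (x : M)
    (u w : TangentSpace (𝓡 n) x) : ℝ :=
  ∑ i, ∑ j, (pd x i (fun y ↦ α y (frame x j y)) x - pd x j (fun y ↦ α y (frame x i y)) x)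
    * coframe x i x u * coframe x j x w

/-- The Lie derivative of a 1-form along a vector field,
`(L_v α)ⱼ = ∑ᵢ (vⁱ ∂ᵢ αⱼ + αᵢ ∂ⱼ vⁱ)`. -/
def lieD (v : (x : M) → TangentSpace (𝓡 n) x)
    (α : OneForm n M) : OneForm n M := fun x ↦
  ∑ j, (∑ i, (coframe x i x (v x) * pd x i (fun y ↦ α y (frame x j y)) x
    + α x (frame x i x) * pd x j (fun y ↦ coframe x i y (v y)) x)) • coframe x j x

/-- The contraction `ι_v α`. -/
def contract (v : (x : M) → TangentSpace (𝓡 n) x)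
    (α : OneForm n M) (x : M) : ℝ := α x (v x)

end Charts

section Fiber

variable {n : ℕ} {M : Type*} [TopologicalSpace M] [ChartedSpace (Euc n) M]
  [RiemannianBundle (fun x : M ↦ TangentSpace (𝓡 n) x)]

theorem norm_smul_form (x : M) (β : TangentSpace (𝓡 n) x →L[ℝ] ℝ) (c : ℝ) :
    ‖c • β‖ ≤ |c| * ‖β‖ := by
  refine ContinuousLinearMap.opNorm_le_bound _ (by positivity) fun w ↦ ?_
  have h : (c • β) w = c * β w := rfl
  rw [h, norm_mul, mul_assoc]
  exact mul_le_mul_of_nonneg_left (β.le_opNorm w) (abs_nonneg c)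

end Fiber

section Metric

variable {n : ℕ} {M : Type*} [TopologicalSpace M] [ChartedSpace (Euc n) M]
  [IsManifold (𝓡 n) ∞ M] [RiemannianBundle (fun x : M ↦ TangentSpace (𝓡 n) x)]

/-- The matrix `(g_ij)` of the metric in the preferred chart at `x₀`, at the point `y`. -/
def gram (x₀ y : M) : Matrix (Fin n) (Fin n) ℝ :=
  Matrix.of fun i j ↦ inner ℝ (frame x₀ i y) (frame x₀ j y)

variable (n) in
/-- The volume density `√det (g_ij)` in the preferred chart at `x₀`. -/
def dens (x₀ y : M) : ℝ := √(gram (n := n) x₀ y).det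

/-- `v = α^♯`, the vector field that is dual to the 1-form `α`: `⟪v x, w⟫ = α x w`. -/
def sharp (α : OneForm n M) (x : M) : TangentSpace (𝓡 n) x :=
  haveI : FiniteDimensional ℝ (TangentSpace (𝓡 n) x) :=
    inferInstanceAs (FiniteDimensional ℝ (Euc n))
  haveI : CompleteSpace (TangentSpace (𝓡 n) x) := FiniteDimensional.complete ℝ _
  (InnerProductSpace.toDual ℝ (TangentSpace (𝓡 n) x)).symm (α x)

/-- The gradient of a function. -/
def grad (p : M → ℝ) (x : M) : TangentSpace (𝓡 n) x :=
  sharp (mvfderiv (𝓡 n) p) x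

/-- The Riemannian divergence, `div v = (det g)^(-1/2) ∑ᵢ ∂ᵢ ((det g)^(1/2) vⁱ)`. -/
def dvg (v : (x : M) → TangentSpace (𝓡 n) x) (x : M) : ℝ :=
  (dens n x x)⁻¹ * ∑ i, pd x i (fun y ↦ dens n x y * coframe x i y (v y)) x

/-- The codifferential of a 1-form, `δ α = - div α^♯`. -/
def codiff₁ (α : OneForm n M) (x : M) : ℝ := - dvg (sharp α) x

/-- The components `η^ij = ∑ g^ia g^jb η_ab` of a 2-form in the preferred chart at `x₀`. -/
def raised (η : (x : M) → TangentSpace (𝓡 n) x → TangentSpace (𝓡 n) x → ℝ)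
    (x₀ : M) (i j : Fin n) (y : M) : ℝ :=
  ∑ a, ∑ b, (gram x₀ y)⁻¹ i a * (gram x₀ y)⁻¹ j b * η y (frame x₀ a y) (frame x₀ b y)

/-- The codifferential of a 2-form,
`(δ η)_k = - ∑ g_kj (det g)^(-1/2) ∂ᵢ ((det g)^(1/2) η^ij)`, that is `(δ η)_k = - ∇^i η_ik`. -/
def codiff₂ (η : (x : M) → TangentSpace (𝓡 n) x → TangentSpace (𝓡 n) x → ℝ) :
    OneForm n M := fun x ↦
  ∑ k, (- ∑ j, gram x x k j * ((dens n x x)⁻¹ *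
    ∑ i, pd x i (fun y ↦ dens n x y * raised η x i j y) x)) • coframe x k x

/-- The Laplace-de Rham operator `Δ = dδ + δd` on 1-forms. -/
def hodgeLaplacian (α : OneForm n M) : OneForm n M := fun x ↦
  mvfderiv (𝓡 n) (codiff₁ α) x + codiff₂ (extD α) x

/-- `α` is a harmonic 1-form: it is smooth and `Δ α = 0`. -/
def IsHarmonicForm (α : OneForm n M) : Prop :=
  IsSmoothForm α ∧ ∀ x, hodgeLaplacian α x = 0

/-- The Christoffel symbol `Γ^k_ij` of the Levi-Civita connection in the preferred chart
at `x`, at the point `x`. -/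
def christoffel (x : M) (k i j : Fin n) : ℝ :=
  (1 / 2) * ∑ l, (gram x x)⁻¹ k l *
    (pd x i (fun y ↦ gram x y j l) x + pd x j (fun y ↦ gram x y i l) x
      - pd x l (fun y ↦ gram x y i j) x)

/-- The Levi-Civita covariant derivative `∇_u v`,
`(∇_u v)^k = ∑ uⁱ ∂ᵢ v^k + ∑ Γ^k_ij uⁱ vʲ`. -/
def covD (u v : (x : M) → TangentSpace (𝓡 n) x) (x : M) : TangentSpace (𝓡 n) x :=
  ∑ k, (∑ i, coframe x i x (u x) * pd x i (fun y ↦ coframe x k y (v y)) x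
    + ∑ i, ∑ j, christoffel x k i j * coframe x i x (u x) * coframe x j x (v x)) • frame x k x

/-- The time-dependent vector field `v` and the pressure `p` satisfy the Euler equations
`∂ₜ v + ∇_v v = - grad p`, `div v = 0` at all times. -/
def IsEulerSolution (v : ℝ → (x : M) → TangentSpace (𝓡 n) x) (p : ℝ → M → ℝ) : Prop :=
  ∀ t x, DifferentiableAt ℝ (fun s ↦ v s x) t ∧
    deriv (fun s ↦ v s x) t + covD (v t) (v t) x = - grad (p t) x ∧ dvg (v t) x = 0

/-- The smooth vector field `v` is a steady solution of the Euler equations. -/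
def IsSteadyEulerSolution (v : (x : M) → TangentSpace (𝓡 n) x) : Prop :=
  IsSmoothField v ∧
    ∃ p : M → ℝ, ContMDiff (𝓡 n) 𝓘(ℝ, ℝ) ∞ p ∧ IsEulerSolution (fun _ ↦ v) (fun _ ↦ p)

section Volume

variable [MeasurableSpace M]

variable (n) in
/-- The Riemannian volume of the domain of the preferred chart at `x₀`, as a measure on `M`:
the image of `√det (g_ij) dx¹ … dxⁿ`. -/
def chartVol (x₀ : M) : Measure M :=
  (((volume : Measure (Euc n)).restrict (extChartAt (𝓡 n) x₀).target).withDensity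
    (fun z ↦ ENNReal.ofReal (dens n x₀ ((extChartAt (𝓡 n) x₀).symm z)))).map
      (extChartAt (𝓡 n) x₀).symm

variable (n M) in
/-- The Riemannian volume measure `μ`: the least measure that dominates the chart measures
`chartVol x₀`. As these agree on overlaps, `μ` coincides with `chartVol x₀` on the domain of the
chart at `x₀` (on a second countable manifold). -/
def vol : Measure M := ⨆ x₀ : M, chartVol n x₀

/-- `‖β‖_{L²} ≤ r` for a 1-form `β`: the pointwise norm is bounded almost everywhere by a
(measurable) function of `L²` norm at most `r`. -/
def L2Bound (β : OneForm n M) (r : ℝ) : Prop :=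
  ∃ g : M → ℝ, MemLp g 2 (vol n M) ∧ eLpNorm g 2 (vol n M) ≤ ENNReal.ofReal r ∧
    ∀ᵐ x ∂(vol n M), ‖β x‖ ≤ g x

theorem L2Bound.add {β γ : OneForm n M} {r s : ℝ}
    (hr : 0 ≤ r) (hs : 0 ≤ s) (hβ : L2Bound β r) (hγ : L2Bound γ s) :
    L2Bound (β + γ) (r + s) := by
  obtain ⟨f, hf, hfr, hfb⟩ := hβ
  obtain ⟨g, hg, hgs, hgb⟩ := hγ
  refine ⟨f + g, hf.add hg, ?_, ?_⟩
  · rw [ENNReal.ofReal_add hr hs]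
    exact (eLpNorm_add_le hf.1 hg.1 (by norm_num)).trans (add_le_add hfr hgs)
  · filter_upwards [hfb, hgb] with x h1 h2
    exact (norm_add_le (β x) (γ x)).trans (add_le_add h1 h2)

theorem L2Bound.smul {β : OneForm n M} {r : ℝ}
    (c : ℝ) (hβ : L2Bound β r) : L2Bound (c • β) (|c| * r) := by
  obtain ⟨f, hf, hfr, hfb⟩ := hβ
  refine ⟨|c| • f, hf.const_smul |c|, ?_, ?_⟩
  · rw [eLpNorm_const_smul, ENNReal.ofReal_mul (abs_nonneg c)]
    gcongr
    rw [Real.enorm_eq_ofReal_abs, abs_abs]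
  · filter_upwards [hfb] with x h1
    exact (norm_smul_form x (β x) c).trans (mul_le_mul_of_nonneg_left h1 (abs_nonneg c))

theorem L2Bound.zero {r : ℝ} :
    L2Bound (0 : OneForm n M) r :=
  ⟨0, MemLp.zero, by simp, Filter.Eventually.of_forall fun _ ↦
    ContinuousLinearMap.opNorm_zero.le⟩

variable (n M) in
/-- `Ω¹_{L²}`: the measurable square-integrable 1-forms. Measurability means that the components
in each chart are measurable functions. Forms are not identified almost everywhere here; forms
that vanish almost everywhere are zero in the quotient `EulerDual` below. -/
def L2Form : Submodule ℝ (OneForm n M) where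
  carrier := {β | (∀ (x₀ : M) (i : Fin n), AEMeasurable (fun y ↦ β y (frame x₀ i y))
    ((vol n M).restrict (chartAt (Euc n) x₀).source)) ∧ ∃ r, 0 ≤ r ∧ L2Bound β r}
  add_mem' := by
    rintro β γ ⟨h1, r, hr, h2⟩ ⟨h3, s, hs, h4⟩
    exact ⟨fun x₀ i ↦ (h1 x₀ i).add (h3 x₀ i), r + s, add_nonneg hr hs, h2.add hr hs h4⟩
  zero_mem' := ⟨fun _ _ ↦ aemeasurable_const, 0, le_rfl, L2Bound.zero⟩
  smul_mem' := by
    rintro c β ⟨h1, r, hr, h2⟩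
    exact ⟨fun x₀ i ↦ (h1 x₀ i).const_smul c, |c| * r, mul_nonneg (abs_nonneg c) hr, h2.smul c⟩

/-- `β ∈ dΩ⁰_{L²}`: `β` is the differential of a smooth function in `L²`. -/
def IsL2Exact (β : OneForm n M) : Prop :=
  ∃ f : M → ℝ, ContMDiff (𝓡 n) 𝓘(ℝ, ℝ) ∞ f ∧ MemLp f 2 (vol n M) ∧
    ∀ x, β x = mvfderiv (𝓡 n) f x

theorem IsL2Exact.add {β γ : OneForm n M}
    (hβ : IsL2Exact β) (hγ : IsL2Exact γ) : IsL2Exact (β + γ) := by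
  obtain ⟨f, hf, hf2, hfd⟩ := hβ
  obtain ⟨g, hg, hg2, hgd⟩ := hγ
  refine ⟨f + g, hf.add hg, hf2.add hg2, fun x ↦ ?_⟩
  have h1 : (β + γ) x = β x + γ x := rfl
  rw [mvfderiv_add (hf.mdifferentiable (by simp) x) (hg.mdifferentiable (by simp) x)]
  exact h1.trans (by rw [hfd, hgd])

theorem IsL2Exact.smul {β : OneForm n M} (c : ℝ)
    (hβ : IsL2Exact β) : IsL2Exact (c • β) := by
  obtain ⟨f, hf, hf2, hfd⟩ := hβ
  refine ⟨(fun _ : M ↦ c) • f, ContMDiff.smul (contMDiff_const (I' := 𝓘(ℝ, ℝ))) hf,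
    hf2.const_smul c, fun x ↦ ?_⟩
  have h1 : (c • β) x = c • β x := rfl
  rw [mvfderiv_smul mdifferentiableAt_const (hf.mdifferentiable (by simp) x)]
  refine h1.trans ?_
  rw [hfd]
  simp [mvfderiv, mfderiv_const]

theorem IsL2Exact.zero : IsL2Exact (0 : OneForm n M) :=
  ⟨0, contMDiff_const, MemLp.zero, fun _ ↦ mvfderiv_zero.symm⟩

variable (n M) in
/-- The closure of `dΩ⁰_{L²}` in `Ω¹_{L²}` for the `L²` norm. -/
def closureExact : Submodule ℝ (L2Form n M) where
  carrier := {β | ∀ ε : ℝ, 0 < ε → ∃ γ : L2Form n M, IsL2Exact γ.1 ∧ L2Bound (β.1 - γ.1) ε}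
  add_mem' := by
    intro β β' h h' ε hε
    obtain ⟨γ, hγ, hb⟩ := h (ε / 2) (half_pos hε)
    obtain ⟨γ', hγ', hb'⟩ := h' (ε / 2) (half_pos hε)
    refine ⟨γ + γ', hγ.add hγ', ?_⟩
    have h3 := L2Bound.add (half_pos hε).le (half_pos hε).le hb hb'
    have h4 : β.1 - γ.1 + (β'.1 - γ'.1) = (β + β').1 - (γ + γ').1 :=
      (add_sub_add_comm β.1 β'.1 γ.1 γ'.1).symm
    rw [add_halves, h4] at h3
    exact h3
  zero_mem' := by
    intro ε hε
    have h3 : L2Bound (0 - 0 : OneForm n M) ε := by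
      rw [sub_zero]
      exact L2Bound.zero
    exact ⟨0, IsL2Exact.zero, h3⟩
  smul_mem' := by
    intro c β h ε hε
    have hc : 0 < |c| + 1 := by positivity
    obtain ⟨γ, hγ, g, hg, hgε, hgb⟩ := h (ε / (|c| + 1)) (div_pos hε hc)
    have hb : L2Bound (β.1 - γ.1) (ε / (|c| + 1)) := ⟨g, hg, hgε, hgb⟩
    obtain ⟨k, hk, hkε, hkb⟩ := hb.smul c
    refine ⟨c • γ, hγ.smul c, k, hk, hkε.trans (ENNReal.ofReal_le_ofReal ?_), ?_⟩
    · rw [← mul_div_assoc, div_le_iff₀ hc]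
      nlinarith [abs_nonneg c]
    · have h3 : (c • β : L2Form n M).1 - (c • γ : L2Form n M).1 = c • (β.1 - γ.1) :=
        (smul_sub c β.1 γ.1).symm
      rw [h3]
      exact hkb

variable (n M) in
/-- The space `Ω¹_{L²} / closure (dΩ⁰_{L²})`, in which the Euler equation reads
`d/dt [v^♭] = - L_v [v^♭]`. -/
abbrev EulerDual := L2Form n M ⧸ closureExact n M

end Volume

end Metric

end Riem

end

/-! The core is the classical fact that on a complete manifold an L² harmonic 1-form is closed and
coclosed. For `v = α^♯` let X = `hodgeField α`, the sum of `(div v) v` and the field dual to `u ↦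
dα(u, v)`. The product rule together with `Δα = 0` gives `div X = E`, where E = `hodgeEnergy α` is
the sum of `(div v)²` and the squared norm of `dα` (`dvg_hodgeField`), while Cauchy-Schwarz gives
`|X|² ≤ 4 |α|² E` (`norm_hodgeField_sq_le`). Testing `div X` against `φ²`, for a compactly supported
cutoff φ with Lipschitz constant K, and absorbing half of the left side yields `∫ φ² E ≤ 16 K² ∫
|α|²` (`integral_cutoff_sq_mul_hodgeEnergy_le`). Letting φ tend to 1 and K to 0 forces `E = 0`
(`hodgeEnergy_eq_zero`).

Completeness enters through the cutoffs: they are truncated distance functions, compactly supported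
because closed balls are compact (`isCompact_closedEBall`, the Hopf-Rinow argument for length
spaces). They are merely Lipschitz, so the divergence theorem is needed for Lipschitz test functions
(`integral_mul_dvg`), together with a bound of the differential by the Lipschitz constant
(`abs_mvfderiv_le`).

Once `dα = 0` and `div v = 0`, the remaining identities are pointwise: Cartan's formula reduces to
`L_v α = d(α(v))`, and lowering an index in `∇_v v` gives `½ d|α|²`, so the pressure is `-½ |α|²`.
The L⁴ hypothesis says that `α(v) = |α|²` is in L². The pairing with a divergence-free L² field
vanishes by the same cutoffs (`integral_mvfderiv_eq_zero`).

Since `extD` and `dvg` use at each point the chart centred there, they can be differentiated or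
integrated only after a proof that the chart does not matter (`extD_eq_chartExtD`,
`chartDvg_eq_chartDvg`). -/

noncomputable section

set_option linter.unusedSectionVars false

namespace Riem

/-! ### Calculus in a fixed chart: frames, partial derivatives, Leibniz rules. -/

section ChartFrames

variable {n : ℕ} {M : Type*} [TopologicalSpace M] [ChartedSpace (Euc n) M]
  [IsManifold (𝓡 n) ∞ M]

/-- The smooth real-valued functions near a point. -/
abbrev SmoothAt (n : ℕ) {M : Type*} [TopologicalSpace M] [ChartedSpace (Euc n) M]
    (f : M → ℝ) (y : M) : Prop := ContMDiffAt (𝓡 n) 𝓘(ℝ, ℝ) ∞ f y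

theorem coframe_frame {x₀ y : M} (hy : y ∈ (chartAt (Euc n) x₀).source) (i j : Fin n) :
    coframe x₀ i y (frame x₀ j y) = if i = j then 1 else 0 := by
  have h := (trivializationAt (Euc n) (TangentSpace (𝓡 n)) x₀).continuousLinearMapAt_symmL
    (R := ℝ) (b := y) hy (EuclideanSpace.single j 1)
  change ((trivializationAt (Euc n) (TangentSpace (𝓡 n)) x₀).continuousLinearMapAt ℝ y
    ((trivializationAt (Euc n) (TangentSpace (𝓡 n)) x₀).symmL ℝ y
      (EuclideanSpace.single j 1))) i = _
  rw [h]
  simp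

theorem sum_coframe_smul_frame {x₀ y : M} (hy : y ∈ (chartAt (Euc n) x₀).source)
    (w : TangentSpace (𝓡 n) y) : ∑ i, coframe x₀ i y w • frame x₀ i y = w := by
  have h := (trivializationAt (Euc n) (TangentSpace (𝓡 n)) x₀).symmL_continuousLinearMapAt
    (R := ℝ) (b := y) hy w
  conv_rhs => rw [← h]
  have h2 : (trivializationAt (Euc n) (TangentSpace (𝓡 n)) x₀).continuousLinearMapAt ℝ y w
      = ∑ i, coframe x₀ i y w • EuclideanSpace.single i (1 : ℝ) := by
    ext i
    simp only [WithLp.ofLp_sum, Finset.sum_apply, PiLp.smul_apply, PiLp.single_apply,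
      smul_eq_mul, mul_ite, mul_one, mul_zero, Finset.sum_ite_eq, Finset.mem_univ, if_true]
    rfl
  rw [h2, map_sum]
  exact Finset.sum_congr rfl fun i _ ↦ (map_smul _ _ _).symm

theorem clm_apply_eq_sum {x₀ y : M} (hy : y ∈ (chartAt (Euc n) x₀).source)
    (β : TangentSpace (𝓡 n) y →L[ℝ] ℝ) (w : TangentSpace (𝓡 n) y) :
    β w = ∑ i, coframe x₀ i y w * β (frame x₀ i y) := by
  conv_lhs => rw [← sum_coframe_smul_frame hy w, map_sum]
  exact Finset.sum_congr rfl fun i _ ↦ map_smul _ _ _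

theorem clm_ext_frame {x₀ y : M} (hy : y ∈ (chartAt (Euc n) x₀).source)
    {β γ : TangentSpace (𝓡 n) y →L[ℝ] ℝ} (h : ∀ i, β (frame x₀ i y) = γ (frame x₀ i y)) :
    β = γ := by
  ext w
  rw [clm_apply_eq_sum hy β, clm_apply_eq_sum hy γ]
  simp only [h]

/-- Chain rule through the chart: the trivialization of the tangent bundle acts on the fibre at `y`
as the derivative of the chart. -/
theorem mvfderiv_eq_fderiv_chart {x₀ y : M} (hy : y ∈ (chartAt (Euc n) x₀).source) {f : M → ℝ}
    (hf : MDifferentiableAt (𝓡 n) 𝓘(ℝ, ℝ) f y) (w : TangentSpace (𝓡 n) y) :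
    mvfderiv (𝓡 n) f y w = fderiv ℝ (f ∘ (extChartAt (𝓡 n) x₀).symm) (extChartAt (𝓡 n) x₀ y)
      ((trivializationAt (Euc n) (TangentSpace (𝓡 n)) x₀).continuousLinearMapAt ℝ y w) := by
  have hy' : y ∈ (extChartAt (𝓡 n) x₀).source := by rwa [extChartAt_source]
  have hfc : MDifferentiableAt 𝓘(ℝ, Euc n) 𝓘(ℝ, ℝ) (f ∘ (extChartAt (𝓡 n) x₀).symm)
      (extChartAt (𝓡 n) x₀ y) := by
    have := (mdifferentiableAt_iff_source_of_mem_source (I := 𝓡 n) (I' := 𝓘(ℝ, ℝ)) hy).1 hf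
    simpa [mdifferentiableWithinAt_univ] using this
  have hev : f =ᶠ[nhds y] (f ∘ (extChartAt (𝓡 n) x₀).symm) ∘ extChartAt (𝓡 n) x₀ := by
    filter_upwards [(isOpen_extChartAt_source x₀).mem_nhds hy'] with z hz
    exact (congrArg f ((extChartAt (𝓡 n) x₀).left_inv hz)).symm
  have h1 : mfderiv (𝓡 n) 𝓘(ℝ, ℝ) f y = mfderiv (𝓡 n) 𝓘(ℝ, ℝ)
      ((f ∘ (extChartAt (𝓡 n) x₀).symm) ∘ extChartAt (𝓡 n) x₀) y := hev.mfderiv_eq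
  have h2 := mfderiv_comp_apply y hfc (mdifferentiableAt_extChartAt (I := 𝓡 n) hy) w
  have h3 : mvfderiv (𝓡 n) f y w = mfderiv (𝓡 n) 𝓘(ℝ, ℝ) f y w := rfl
  rw [h3, h1]
  refine h2.trans ?_
  rw [mfderiv_eq_fderiv, TangentBundle.continuousLinearMapAt_trivializationAt hy]
  rfl

theorem pd_eq_fderiv {x₀ y : M} (hy : y ∈ (chartAt (Euc n) x₀).source) {f : M → ℝ}
    (hf : MDifferentiableAt (𝓡 n) 𝓘(ℝ, ℝ) f y) (i : Fin n) :
    pd x₀ i f y = fderiv ℝ (f ∘ (extChartAt (𝓡 n) x₀).symm) (extChartAt (𝓡 n) x₀ y)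
      (EuclideanSpace.single i 1) := by
  rw [pd, mvfderiv_eq_fderiv_chart hy hf, frame,
    (trivializationAt (Euc n) (TangentSpace (𝓡 n)) x₀).continuousLinearMapAt_symmL
    (R := ℝ) (b := y) hy]

theorem mvfderiv_eq_sum_pd {x₀ y : M} (hy : y ∈ (chartAt (Euc n) x₀).source) (f : M → ℝ)
    (w : TangentSpace (𝓡 n) y) :
    mvfderiv (𝓡 n) f y w = ∑ i, coframe x₀ i y w * pd x₀ i f y :=
  clm_apply_eq_sum hy _ w

theorem SmoothAt.mdiff {f : M → ℝ} {y : M} (hf : SmoothAt n f y) :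
    MDifferentiableAt (𝓡 n) 𝓘(ℝ, ℝ) f y :=
  hf.mdifferentiableAt (by simp)

theorem SmoothAt.chart {f : M → ℝ} {x₀ y : M} (hy : y ∈ (chartAt (Euc n) x₀).source)
    (hf : SmoothAt n f y) :
    ContDiffAt ℝ ∞ (f ∘ (extChartAt (𝓡 n) x₀).symm) (extChartAt (𝓡 n) x₀ y) := by
  have := (contMDiffAt_iff_source_of_mem_source (I := 𝓡 n) (I' := 𝓘(ℝ, ℝ)) hy).1 hf
  rw [← contMDiffAt_iff_contDiffAt]
  simpa [contMDiffWithinAt_univ] using this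

theorem smoothAt_of_chart {f : M → ℝ} {x₀ y : M} (hy : y ∈ (chartAt (Euc n) x₀).source)
    (hf : ContDiffAt ℝ ∞ (f ∘ (extChartAt (𝓡 n) x₀).symm) (extChartAt (𝓡 n) x₀ y)) :
    SmoothAt n f y := by
  refine (contMDiffAt_iff_source_of_mem_source (I := 𝓡 n) (I' := 𝓘(ℝ, ℝ)) hy).2 ?_
  rw [← contMDiffAt_iff_contDiffAt] at hf
  simpa [contMDiffWithinAt_univ] using hf

/-- An identity of germs rather than of values, so that it can be differentiated once more; hence
the smoothness on a whole open set. -/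
theorem pd_comp_symm_eventuallyEq {x₀ y : M} {U : Set M} (hU : IsOpen U)
    (hUS : U ⊆ (chartAt (Euc n) x₀).source) {f : M → ℝ} (hf : ∀ y ∈ U, SmoothAt n f y)
    (hy : y ∈ U) (i : Fin n) :
    pd x₀ i f ∘ (extChartAt (𝓡 n) x₀).symm =ᶠ[nhds (extChartAt (𝓡 n) x₀ y)]
      fun z ↦ fderiv ℝ (f ∘ (extChartAt (𝓡 n) x₀).symm) z (EuclideanSpace.single i 1) := by
  have hy' : y ∈ (extChartAt (𝓡 n) x₀).source := by rw [extChartAt_source]; exact hUS hy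
  have hc : ContinuousAt (extChartAt (𝓡 n) x₀).symm (extChartAt (𝓡 n) x₀ y) :=
    continuousAt_extChartAt_symm' hy'
  have h1 : (extChartAt (𝓡 n) x₀).symm ⁻¹' U ∈ nhds (extChartAt (𝓡 n) x₀ y) := by
    apply hc.preimage_mem_nhds
    rw [(extChartAt (𝓡 n) x₀).left_inv hy']
    exact hU.mem_nhds hy
  have h2 : (extChartAt (𝓡 n) x₀).target ∈ nhds (extChartAt (𝓡 n) x₀ y) :=
    (isOpen_extChartAt_target x₀).mem_nhds ((extChartAt (𝓡 n) x₀).map_source hy')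
  filter_upwards [h1, h2] with z hz1 hz2
  have := pd_eq_fderiv (hUS hz1) (hf _ hz1).mdiff i
  rw [(extChartAt (𝓡 n) x₀).right_inv hz2] at this
  exact this

theorem SmoothAt.pd {x₀ y : M} {U : Set M} (hU : IsOpen U)
    (hUS : U ⊆ (chartAt (Euc n) x₀).source) {f : M → ℝ} (hf : ∀ y ∈ U, SmoothAt n f y)
    (hy : y ∈ U) (i : Fin n) : SmoothAt n (pd x₀ i f) y := by
  refine smoothAt_of_chart (hUS hy) ?_
  refine ContDiffAt.congr_of_eventuallyEq ?_ (pd_comp_symm_eventuallyEq hU hUS hf hy i)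
  exact (((hf y hy).chart (hUS hy)).fderiv_right (m := ∞) (by simp)).clm_apply contDiffAt_const

/-- Coordinate fields of one chart commute: both sides are values of the second derivative of the
same function on `ℝⁿ`, which is symmetric. -/
theorem pd_pd_comm {x₀ y : M} {U : Set M} (hU : IsOpen U)
    (hUS : U ⊆ (chartAt (Euc n) x₀).source) {f : M → ℝ} (hf : ∀ y ∈ U, SmoothAt n f y)
    (hy : y ∈ U) (i j : Fin n) : pd x₀ i (pd x₀ j f) y = pd x₀ j (pd x₀ i f) y := by
  have hsm := (hf y hy).chart (hUS hy)
  have key : ∀ a b : Fin n, Riem.pd x₀ a (Riem.pd x₀ b f) y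
      = fderiv ℝ (fderiv ℝ (f ∘ (extChartAt (𝓡 n) x₀).symm)) (extChartAt (𝓡 n) x₀ y)
        (EuclideanSpace.single a 1) (EuclideanSpace.single b 1) := by
    intro a b
    rw [pd_eq_fderiv (hUS hy) (SmoothAt.pd hU hUS hf hy b).mdiff,
      (pd_comp_symm_eventuallyEq hU hUS hf hy b).fderiv_eq,
      fderiv_clm_apply ((hsm.fderiv_right (m := ∞) (by simp)).differentiableAt (by simp))
        (differentiableAt_const _)]
    simp
  rw [key, key]
  exact (hsm.isSymmSndFDerivAt (by simpa using ENat.LEInfty.out)) _ _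

theorem pd_add {x₀ y : M} {f g : M → ℝ} (hf : SmoothAt n f y) (hg : SmoothAt n g y) (i : Fin n) :
    pd x₀ i (fun z ↦ f z + g z) y = pd x₀ i f y + pd x₀ i g y := by
  change mvfderiv (𝓡 n) (f + g) y _ = _
  rw [mvfderiv_add hf.mdiff hg.mdiff]
  rfl

theorem pd_mul {x₀ y : M} {f g : M → ℝ} (hf : SmoothAt n f y) (hg : SmoothAt n g y) (i : Fin n) :
    pd x₀ i (fun z ↦ f z * g z) y = f y * pd x₀ i g y + g y * pd x₀ i f y := by
  change mvfderiv (𝓡 n) (f * g) y _ = _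
  rw [mvfderiv_mul hf.mdiff hg.mdiff]
  rfl

theorem pd_congr {x₀ y : M} {f g : M → ℝ} (h : f =ᶠ[nhds y] g) (i : Fin n) :
    pd x₀ i f y = pd x₀ i g y := by
  have h1 : mfderiv (𝓡 n) 𝓘(ℝ, ℝ) f y = mfderiv (𝓡 n) 𝓘(ℝ, ℝ) g y := h.mfderiv_eq
  change mfderiv (𝓡 n) 𝓘(ℝ, ℝ) f y _ = mfderiv (𝓡 n) 𝓘(ℝ, ℝ) g y _
  rw [h1]
  rfl

theorem mvfderiv_congr {y : M} {f g : M → ℝ} (h : f =ᶠ[nhds y] g)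
    (w : TangentSpace (𝓡 n) y) : mvfderiv (𝓡 n) f y w = mvfderiv (𝓡 n) g y w := by
  have h1 : mfderiv (𝓡 n) 𝓘(ℝ, ℝ) f y = mfderiv (𝓡 n) 𝓘(ℝ, ℝ) g y := h.mfderiv_eq
  change mfderiv (𝓡 n) 𝓘(ℝ, ℝ) f y _ = mfderiv (𝓡 n) 𝓘(ℝ, ℝ) g y _
  rw [h1]
  rfl

theorem pd_const (x₀ y : M) (c : ℝ) (i : Fin n) : pd x₀ i (fun _ ↦ c) y = 0 := by
  rw [pd, mvfderiv_const]
  rfl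

theorem SmoothAt.sum {ι : Type*} {s : Finset ι} {f : ι → M → ℝ} {y : M}
    (h : ∀ i ∈ s, SmoothAt n (f i) y) : SmoothAt n (fun z ↦ ∑ i ∈ s, f i z) y :=
  contMDiffAt_finsetSum h

theorem SmoothAt.mul {f g : M → ℝ} {y : M} (hf : SmoothAt n f y) (hg : SmoothAt n g y) :
    SmoothAt n (fun z ↦ f z * g z) y :=
  ContMDiffAt.mul hf hg

theorem SmoothAt.sub {f g : M → ℝ} {y : M} (hf : SmoothAt n f y) (hg : SmoothAt n g y) :
    SmoothAt n (fun z ↦ f z - g z) y :=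
  ContMDiffAt.sub hf hg

theorem SmoothAt.comp_contDiffAt {f : M → ℝ} {g : ℝ → ℝ} {y : M} (hf : SmoothAt n f y)
    (hg : ContDiffAt ℝ ∞ g (f y)) : SmoothAt n (fun z ↦ g (f z)) y :=
  ContMDiffAt.comp y hg.contMDiffAt hf

theorem pd_sum {ι : Type*} (s : Finset ι) {f : ι → M → ℝ} {x₀ y : M}
    (h : ∀ i ∈ s, SmoothAt n (f i) y) (j : Fin n) :
    pd x₀ j (fun z ↦ ∑ i ∈ s, f i z) y = ∑ i ∈ s, pd x₀ j (f i) y := by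
  classical
  induction s using Finset.induction_on with
  | empty => simp [pd_const]
  | insert a s ha ih =>
    simp only [Finset.sum_insert ha]
    rw [pd_add (h a (Finset.mem_insert_self a s))
      (SmoothAt.sum fun i hi ↦ h i (Finset.mem_insert_of_mem hi)),
      ih fun i hi ↦ h i (Finset.mem_insert_of_mem hi)]

end ChartFrames

/-! ### Smoothness of fields and forms through their components. -/

section SmoothSections

variable {n : ℕ} {M : Type*} [TopologicalSpace M] [ChartedSpace (Euc n) M]
  [IsManifold (𝓡 n) ∞ M]

theorem contMDiffAt_frame {x₀ y : M} (hy : y ∈ (chartAt (Euc n) x₀).source) (i : Fin n) :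
    ContMDiffAt (𝓡 n) (𝓡 n).tangent ∞
      (fun z ↦ (⟨z, frame x₀ i z⟩ : TangentBundle (𝓡 n) M)) y := by
  refine ((trivializationAt (Euc n) (TangentSpace (𝓡 n)) x₀).contMDiffAt_section_iff
    (IB := 𝓡 n) hy).2 ?_
  refine (contMDiffAt_const (c := EuclideanSpace.single i (1 : ℝ))).congr_of_eventuallyEq ?_
  filter_upwards [(chartAt (Euc n) x₀).open_source.mem_nhds hy] with z hz
  have h := (trivializationAt (Euc n) (TangentSpace (𝓡 n)) x₀).continuousLinearMapAt_symmL
    (R := ℝ) (b := z) hz (EuclideanSpace.single i 1)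
  rw [Trivialization.continuousLinearMapAt_apply_of_mem (R := ℝ) _ hz] at h
  exact h

theorem contMDiffAt_field_iff {x₀ y : M} (hy : y ∈ (chartAt (Euc n) x₀).source)
    (v : (x : M) → TangentSpace (𝓡 n) x) :
    ContMDiffAt (𝓡 n) (𝓡 n).tangent ∞ (fun z ↦ (⟨z, v z⟩ : TangentBundle (𝓡 n) M)) y ↔
      ∀ i, SmoothAt n (fun z ↦ coframe x₀ i z (v z)) y := by
  have h1 := (trivializationAt (Euc n) (TangentSpace (𝓡 n)) x₀).contMDiffAt_section_iff
    (IB := 𝓡 n) (n := ∞) (s := v) hy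
  refine h1.trans ?_
  have h2 : (fun z ↦ (trivializationAt (Euc n) (TangentSpace (𝓡 n)) x₀
        (⟨z, v z⟩ : TangentBundle (𝓡 n) M)).2) =ᶠ[nhds y]
      fun z ↦ (trivializationAt (Euc n) (TangentSpace (𝓡 n)) x₀).continuousLinearMapAt ℝ z
        (v z) := by
    filter_upwards [(chartAt (Euc n) x₀).open_source.mem_nhds hy] with z hz
    exact (Trivialization.continuousLinearMapAt_apply_of_mem (R := ℝ) _ hz _).symm
  rw [h2.contMDiffAt_iff]
  constructor
  · intro h i
    exact ((EuclideanSpace.proj i : Euc n →L[ℝ] ℝ).contMDiff.contMDiffAt).comp y h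
  · intro h
    have h3 : (fun z ↦ (trivializationAt (Euc n) (TangentSpace (𝓡 n)) x₀).continuousLinearMapAt
        ℝ z (v z)) = fun z ↦ ∑ i, coframe x₀ i z (v z) • EuclideanSpace.single i (1 : ℝ) := by
      funext z
      ext i
      simp only [WithLp.ofLp_sum, Finset.sum_apply, PiLp.smul_apply, PiLp.single_apply,
        smul_eq_mul, mul_ite, mul_one, mul_zero, Finset.sum_ite_eq, Finset.mem_univ, if_true]
      rfl
    rw [h3]
    exact contMDiffAt_finsetSum fun i _ ↦ (h i).smul contMDiffAt_const

theorem IsSmoothField.smoothAt_coframe {v : (x : M) → TangentSpace (𝓡 n) x}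
    (hv : IsSmoothField v) {x₀ y : M} (hy : y ∈ (chartAt (Euc n) x₀).source) (i : Fin n) :
    SmoothAt n (fun z ↦ coframe x₀ i z (v z)) y :=
  (contMDiffAt_field_iff hy v).1 (hv y) i

theorem isSmoothField_of_coframe {v : (x : M) → TangentSpace (𝓡 n) x}
    (h : ∀ (x₀ : M), ∀ y ∈ (chartAt (Euc n) x₀).source, ∀ i,
      SmoothAt n (fun z ↦ coframe x₀ i z (v z)) y) : IsSmoothField v := fun y ↦
  (contMDiffAt_field_iff (mem_chart_source _ y) v).2 (h y y (mem_chart_source _ y))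

theorem IsSmoothForm.smoothAt_frame {α : OneForm n M}
    (hα : IsSmoothForm α) {x₀ y : M} (hy : y ∈ (chartAt (Euc n) x₀).source) (i : Fin n) :
    SmoothAt n (fun z ↦ α z (frame x₀ i z)) y := by
  have h := ContMDiffAt.clm_bundle_apply (F₁ := Euc n) (F₂ := ℝ) (IB := 𝓡 n) (IM := 𝓡 n)
    (E₁ := fun x : M ↦ TangentSpace (𝓡 n) x) (E₂ := Bundle.Trivial M ℝ) (b := fun x : M ↦ x)
    (hα y) (contMDiffAt_frame hy i)
  exact (contMDiffAt_section (F := ℝ) (E := Bundle.Trivial M ℝ) _).1 h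

end SmoothSections

/-! ### Chart independence of the exterior derivative. -/

section ExteriorDerivative

variable {n : ℕ} {M : Type*} [TopologicalSpace M] [ChartedSpace (Euc n) M]
  [IsManifold (𝓡 n) ∞ M]

/-- The coordinate functions of the preferred chart at `x₀`. -/
def coord (n : ℕ) {M : Type*} [TopologicalSpace M] [ChartedSpace (Euc n) M]
    (x₀ : M) (k : Fin n) (y : M) : ℝ :=
  extChartAt (𝓡 n) x₀ y k

theorem smoothAt_coord {x₀ y : M} (hy : y ∈ (chartAt (Euc n) x₀).source) (k : Fin n) :
    SmoothAt n (coord n x₀ k) y :=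
  ((EuclideanSpace.proj k : Euc n →L[ℝ] ℝ).contMDiff.contMDiffAt).comp y
    (contMDiffAt_extChartAt' hy)

theorem pd_coord {x₀ y : M} (hy : y ∈ (chartAt (Euc n) x₀).source) (j k : Fin n) :
    pd x₀ j (coord n x₀ k) y = if k = j then 1 else 0 := by
  have hy' : y ∈ (extChartAt (𝓡 n) x₀).source := by rwa [extChartAt_source]
  have h : coord n x₀ k ∘ (extChartAt (𝓡 n) x₀).symm =ᶠ[nhds (extChartAt (𝓡 n) x₀ y)]
      (EuclideanSpace.proj k : Euc n →L[ℝ] ℝ) := by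
    filter_upwards [(isOpen_extChartAt_target x₀).mem_nhds
      ((extChartAt (𝓡 n) x₀).map_source hy')] with z hz
    exact congrArg (fun u : Euc n ↦ u k) ((extChartAt (𝓡 n) x₀).right_inv hz)
  rw [pd_eq_fderiv hy (smoothAt_coord hy k).mdiff, h.fderiv_eq, ContinuousLinearMap.fderiv]
  simp

theorem mvfderiv_coord {x₀ y : M} (hy : y ∈ (chartAt (Euc n) x₀).source) (k : Fin n)
    (w : TangentSpace (𝓡 n) y) : mvfderiv (𝓡 n) (coord n x₀ k) y w = coframe x₀ k y w := by
  rw [mvfderiv_eq_sum_pd hy]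
  simp [pd_coord hy]

/-- The exterior derivative of a 1-form, computed in the preferred chart at `x₀`. -/
def chartExtD (α : OneForm n M) (x₀ y : M) (u w : TangentSpace (𝓡 n) y) : ℝ :=
  ∑ i, ∑ j, (pd x₀ i (fun z ↦ α z (frame x₀ j z)) y - pd x₀ j (fun z ↦ α z (frame x₀ i z)) y)
    * coframe x₀ i y u * coframe x₀ j y w

theorem form_frame_eq_sum_coord (α : OneForm n M) {x₀ x₁ y : M}
    (hy : y ∈ (chartAt (Euc n) x₀).source) (j : Fin n) :
    α y (frame x₁ j y) = ∑ k, α y (frame x₀ k y) * pd x₁ j (coord n x₀ k) y := by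
  rw [clm_apply_eq_sum hy (α y)]
  refine Finset.sum_congr rfl fun k _ ↦ ?_
  rw [pd, mvfderiv_coord hy, mul_comm]

/-- Differentiated transformation law of the components. The term with second derivatives of the
coordinates is symmetric in `i`, `j` and will cancel in `dα`. -/
theorem pd_form_frame {α : OneForm n M} (hα : IsSmoothForm α) {x₀ x₁ y : M}
    (hy : y ∈ (chartAt (Euc n) x₀).source) (hy₁ : y ∈ (chartAt (Euc n) x₁).source)
    (i j : Fin n) :
    pd x₁ i (fun z ↦ α z (frame x₁ j z)) y =
      ∑ k, (α y (frame x₀ k y) * pd x₁ i (pd x₁ j (coord n x₀ k)) y +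
        pd x₁ j (coord n x₀ k) y * pd x₁ i (fun z ↦ α z (frame x₀ k z)) y) := by
  have hU := (chartAt (Euc n) x₀).open_source.inter (chartAt (Euc n) x₁).open_source
  have h1 : (fun z ↦ α z (frame x₁ j z)) =ᶠ[nhds y]
      fun z ↦ ∑ k, α z (frame x₀ k z) * pd x₁ j (coord n x₀ k) z := by
    filter_upwards [(chartAt (Euc n) x₀).open_source.mem_nhds hy] with z hz
    exact form_frame_eq_sum_coord α hz j
  have h2 : ∀ k, SmoothAt n (pd x₁ j (coord n x₀ k)) y := fun k ↦
    SmoothAt.pd hU inter_subset_right (fun z hz ↦ smoothAt_coord hz.1 k) ⟨hy, hy₁⟩ j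
  rw [pd_congr h1, pd_sum _ fun k _ ↦ (hα.smoothAt_frame hy k).mul (h2 k)]
  exact Finset.sum_congr rfl fun k _ ↦ pd_mul (hα.smoothAt_frame hy k) (h2 k) i

/-- The right side is `∑ dα_k ∧ dx^k` for the coordinates at `x₀`. It does not mention `x₁`, so any
two choices of `x₁` give the same form. -/
theorem chartExtD_eq_sum_wedge {α : OneForm n M} (hα : IsSmoothForm α) {x₀ x₁ y : M}
    (hy : y ∈ (chartAt (Euc n) x₀).source) (hy₁ : y ∈ (chartAt (Euc n) x₁).source)
    (u w : TangentSpace (𝓡 n) y) :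
    chartExtD α x₁ y u w = ∑ k,
      (mvfderiv (𝓡 n) (fun z ↦ α z (frame x₀ k z)) y u * mvfderiv (𝓡 n) (coord n x₀ k) y w -
       mvfderiv (𝓡 n) (fun z ↦ α z (frame x₀ k z)) y w * mvfderiv (𝓡 n) (coord n x₀ k) y u) := by
  have hU := (chartAt (Euc n) x₀).open_source.inter (chartAt (Euc n) x₁).open_source
  have hc : ∀ i j k, pd x₁ i (pd x₁ j (coord n x₀ k)) y = pd x₁ j (pd x₁ i (coord n x₀ k)) y :=
    fun i j k ↦ pd_pd_comm hU inter_subset_right (fun z hz ↦ smoothAt_coord hz.1 k) ⟨hy, hy₁⟩ i j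
  have h1 : ∀ i j, pd x₁ i (fun z ↦ α z (frame x₁ j z)) y
      - pd x₁ j (fun z ↦ α z (frame x₁ i z)) y =
      ∑ k, (pd x₁ j (coord n x₀ k) y * pd x₁ i (fun z ↦ α z (frame x₀ k z)) y -
        pd x₁ i (coord n x₀ k) y * pd x₁ j (fun z ↦ α z (frame x₀ k z)) y) := by
    intro i j
    rw [pd_form_frame hα hy hy₁, pd_form_frame hα hy hy₁, ← Finset.sum_sub_distrib]
    refine Finset.sum_congr rfl fun k _ ↦ ?_
    rw [hc i j k]
    ring
  simp only [chartExtD, h1, mvfderiv_eq_sum_pd hy₁, Finset.sum_mul_sum]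
  simp only [Finset.sum_mul]
  rw [Finset.sum_congr rfl fun i _ ↦ Finset.sum_comm, Finset.sum_comm]
  refine Finset.sum_congr rfl fun k _ ↦ ?_
  rw [Finset.sum_comm (f := fun i j ↦ coframe x₁ i y w * _ * _), ← Finset.sum_sub_distrib]
  refine Finset.sum_congr rfl fun i _ ↦ ?_
  rw [← Finset.sum_sub_distrib]
  refine Finset.sum_congr rfl fun j _ ↦ ?_
  ring

/-- Both charts, the one centred at `y` and the one at `x₀`, are compared with the same sum of
wedges. This makes the components of `dα` in one chart differentiable functions. -/
theorem extD_eq_chartExtD {α : OneForm n M} (hα : IsSmoothForm α) {x₀ y : M}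
    (hy : y ∈ (chartAt (Euc n) x₀).source) (u w : TangentSpace (𝓡 n) y) :
    extD α y u w = chartExtD α x₀ y u w :=
  (chartExtD_eq_sum_wedge hα hy (mem_chart_source _ y) u w).trans
    (chartExtD_eq_sum_wedge hα hy hy u w).symm

theorem extD_frame {α : OneForm n M} (hα : IsSmoothForm α) {x₀ y : M}
    (hy : y ∈ (chartAt (Euc n) x₀).source) (a b : Fin n) :
    extD α y (frame x₀ a y) (frame x₀ b y) =
      pd x₀ a (fun z ↦ α z (frame x₀ b z)) y - pd x₀ b (fun z ↦ α z (frame x₀ a z)) y := by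
  rw [extD_eq_chartExtD hα hy, chartExtD]
  simp [coframe_frame hy]

theorem smoothAt_extD_frame {α : OneForm n M} (hα : IsSmoothForm α) {x₀ y : M}
    (hy : y ∈ (chartAt (Euc n) x₀).source) (a b : Fin n) :
    SmoothAt n (fun z ↦ extD α z (frame x₀ a z) (frame x₀ b z)) y := by
  have ho := (chartAt (Euc n) x₀).open_source
  have h : ∀ a b, SmoothAt n (pd x₀ a (fun z ↦ α z (frame x₀ b z))) y := fun a b ↦
    SmoothAt.pd ho Subset.rfl (fun z hz ↦ hα.smoothAt_frame hz b) hy a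
  refine ((h a b).sub (h b a)).congr_of_eventuallyEq ?_
  filter_upwards [ho.mem_nhds hy] with z hz
  exact extD_frame hα hz a b

/-- The exterior derivative as a bilinear map: linearity in the first slot. -/
def extDLeft (α : OneForm n M) (x : M) (w : TangentSpace (𝓡 n) x) :
    TangentSpace (𝓡 n) x →L[ℝ] ℝ :=
  ∑ i, (∑ j, (pd x i (fun y ↦ α y (frame x j y)) x - pd x j (fun y ↦ α y (frame x i y)) x)
    * coframe x j x w) • coframe x i x

theorem extDLeft_apply (α : OneForm n M) (x : M) (u w : TangentSpace (𝓡 n) x) :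
    extDLeft α x w u = extD α x u w := by
  have h : extDLeft α x w u = ∑ i, (∑ j, (pd x i (fun y ↦ α y (frame x j y)) x
      - pd x j (fun y ↦ α y (frame x i y)) x) * coframe x j x w) * coframe x i x u := by
    rw [extDLeft, sum_apply]
    rfl
  rw [h, extD]
  refine Finset.sum_congr rfl fun i _ ↦ ?_
  rw [Finset.sum_mul]
  exact Finset.sum_congr rfl fun j _ ↦ by ring

theorem extD_antisymm (α : OneForm n M) (x : M) (u w : TangentSpace (𝓡 n) x) :
    extD α x u w = - extD α x w u := by
  rw [extD, extD, Finset.sum_comm, ← Finset.sum_neg_distrib]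
  refine Finset.sum_congr rfl fun i _ ↦ ?_
  rw [← Finset.sum_neg_distrib]
  exact Finset.sum_congr rfl fun j _ ↦ by ring

end ExteriorDerivative

/-! ### Smooth dependence of determinants and inverse matrices. -/

section SmoothMatrices

variable {n : ℕ} {M : Type*} [TopologicalSpace M] [ChartedSpace (Euc n) M]
  [IsManifold (𝓡 n) ∞ M]

theorem SmoothAt.matrix_det {m : ℕ} {A : M → Matrix (Fin m) (Fin m) ℝ} {y : M}
    (hA : ∀ i j, SmoothAt n (fun z ↦ A z i j) y) : SmoothAt n (fun z ↦ (A z).det) y := by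
  simp only [Matrix.det_apply']
  exact SmoothAt.sum fun σ _ ↦ SmoothAt.mul contMDiffAt_const
    (contMDiffAt_finsetProd fun i _ ↦ hA (σ i) i)

theorem SmoothAt.matrix_inv {m : ℕ} {A : M → Matrix (Fin m) (Fin m) ℝ} {y : M}
    (hA : ∀ i j, SmoothAt n (fun z ↦ A z i j) y) (hdet : (A y).det ≠ 0) (i j : Fin m) :
    SmoothAt n (fun z ↦ (A z)⁻¹ i j) y := by
  simp only [Matrix.inv_def, Matrix.smul_apply, smul_eq_mul, Ring.inverse_eq_inv',
    Matrix.adjugate_apply]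
  refine SmoothAt.mul ((SmoothAt.matrix_det hA).comp_contDiffAt (contDiffAt_inv ℝ hdet))
    (SmoothAt.matrix_det fun k l ↦ ?_)
  by_cases h : k = j
  · subst h
    simpa only [Matrix.updateRow_self] using contMDiffAt_const
  · simpa only [Matrix.updateRow_ne h] using hA k l

end SmoothMatrices

/-! ### The metric in coordinates, and the norm of `dα`. -/

section MetricComponents

variable {n : ℕ} {M : Type*} [TopologicalSpace M] [ChartedSpace (Euc n) M]
  [IsManifold (𝓡 n) ∞ M] [RiemannianBundle (fun x : M ↦ TangentSpace (𝓡 n) x)]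

instance finiteDimensional_tangentSpace (x : M) : FiniteDimensional ℝ (TangentSpace (𝓡 n) x) :=
  inferInstanceAs (FiniteDimensional ℝ (Euc n))

theorem linearIndependent_frame {x₀ y : M} (hy : y ∈ (chartAt (Euc n) x₀).source) :
    LinearIndependent ℝ (fun i ↦ frame (n := n) x₀ i y) := by
  rw [Fintype.linearIndependent_iff]
  intro g hg i
  have h := congrArg (coframe x₀ i y) hg
  rw [map_sum, map_zero] at h
  simpa [coframe_frame hy] using h

theorem gram_posDef {x₀ y : M} (hy : y ∈ (chartAt (Euc n) x₀).source) :
    (gram (n := n) x₀ y).PosDef :=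
  Matrix.posDef_gram_iff_linearIndependent.2 (linearIndependent_frame hy)

theorem gram_det_pos {x₀ y : M} (hy : y ∈ (chartAt (Euc n) x₀).source) :
    0 < (gram (n := n) x₀ y).det :=
  (gram_posDef hy).det_pos

theorem dens_pos {x₀ y : M} (hy : y ∈ (chartAt (Euc n) x₀).source) : 0 < dens n x₀ y :=
  Real.sqrt_pos.2 (gram_det_pos hy)

theorem gram_comm (x₀ y : M) (i j : Fin n) : gram x₀ y i j = gram x₀ y j i :=
  real_inner_comm (frame x₀ j y) (frame x₀ i y)

theorem gram_inv_comm (x₀ y : M) (i j : Fin n) : (gram x₀ y)⁻¹ i j = (gram x₀ y)⁻¹ j i := by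
  have h : (gram (n := n) x₀ y).transpose = gram x₀ y := by
    ext i j
    exact gram_comm x₀ y j i
  conv_lhs => rw [← h, ← Matrix.transpose_nonsing_inv, Matrix.transpose_apply]

theorem sum_gram_mul_inv {x₀ y : M} (hy : y ∈ (chartAt (Euc n) x₀).source) (i k : Fin n) :
    ∑ j, gram x₀ y i j * (gram x₀ y)⁻¹ j k = if i = k then 1 else 0 := by
  have h := Matrix.mul_nonsing_inv (gram (n := n) x₀ y) (gram_det_pos hy).ne'.isUnit
  have h2 := congrFun (congrFun h i) k
  rwa [Matrix.mul_apply, Matrix.one_apply] at h2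

theorem inner_frame {x₀ y : M} (hy : y ∈ (chartAt (Euc n) x₀).source)
    (w : TangentSpace (𝓡 n) y) (j : Fin n) :
    inner ℝ w (frame x₀ j y) = ∑ i, coframe x₀ i y w * gram x₀ y i j := by
  conv_lhs => rw [← sum_coframe_smul_frame hy w, sum_inner]
  exact Finset.sum_congr rfl fun i _ ↦ real_inner_smul_left _ _ _

theorem inner_sharp (α : OneForm n M) (x : M) (w : TangentSpace (𝓡 n) x) :
    inner ℝ (sharp α x) w = α x w :=
  InnerProductSpace.toDual_symm_apply

theorem norm_sharp (α : OneForm n M) (x : M) : ‖sharp α x‖ = ‖α x‖ :=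
  LinearIsometryEquiv.norm_map _ _

theorem contract_sharp (α : OneForm n M) (x : M) : contract (sharp α) α x = ‖α x‖ ^ 2 := by
  rw [contract, ← inner_sharp, real_inner_self_eq_norm_sq, norm_sharp]

theorem form_frame_eq_sum_gram (α : OneForm n M) {x₀ y : M}
    (hy : y ∈ (chartAt (Euc n) x₀).source) (j : Fin n) :
    α y (frame x₀ j y) = ∑ i, gram x₀ y j i * coframe x₀ i y (sharp α y) := by
  rw [← inner_sharp, inner_frame hy]
  exact Finset.sum_congr rfl fun i _ ↦ by rw [gram_comm, mul_comm]

/-- Raising an index: the inverse Gram matrix undoes `form_frame_eq_sum_gram`. -/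
theorem coframe_sharp (α : OneForm n M) {x₀ y : M}
    (hy : y ∈ (chartAt (Euc n) x₀).source) (i : Fin n) :
    coframe x₀ i y (sharp α y) = ∑ j, (gram x₀ y)⁻¹ i j * α y (frame x₀ j y) := by
  simp only [form_frame_eq_sum_gram α hy, Finset.mul_sum]
  rw [Finset.sum_comm]
  have h := Matrix.nonsing_inv_mul (gram (n := n) x₀ y) (gram_det_pos hy).ne'.isUnit
  have h2 : ∀ k, ∑ j, (gram x₀ y)⁻¹ i j * (gram x₀ y j k * coframe x₀ k y (sharp α y))
      = (if i = k then 1 else 0) * coframe x₀ k y (sharp α y) := by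
    intro k
    have h3 := congrFun (congrFun h i) k
    rw [Matrix.mul_apply, Matrix.one_apply] at h3
    rw [← h3, Finset.sum_mul]
    exact Finset.sum_congr rfl fun j _ ↦ by ring
  simp [h2]

section Euclidean

variable {ι : Type*} [Fintype ι]

/-- Both sides are `γ(β^♯)`, expanded once in the coordinate frame and once in an orthonormal basis.
-/
theorem sum_gram_inv_mul_mul {x₀ y : M} (hy : y ∈ (chartAt (Euc n) x₀).source)
    (e : OrthonormalBasis ι ℝ (TangentSpace (𝓡 n) y)) (β γ : TangentSpace (𝓡 n) y →L[ℝ] ℝ) :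
    ∑ i, ∑ a, (gram x₀ y)⁻¹ i a * β (frame x₀ a y) * γ (frame x₀ i y)
      = ∑ k, β (e k) * γ (e k) := by
  classical
  -- `sharp` takes a form on all of `M`, so `β` is extended by zero off the point `y`.
  let β' : OneForm n M := fun z ↦ if h : z = y then h ▸ β else 0
  have hβ : β' y = β := dif_pos rfl
  have h1 : γ (sharp β' y) = ∑ i, ∑ a, (gram x₀ y)⁻¹ i a * β (frame x₀ a y)
      * γ (frame x₀ i y) := by
    rw [clm_apply_eq_sum hy γ]
    refine Finset.sum_congr rfl fun i _ ↦ ?_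
    rw [coframe_sharp β' hy, hβ, Finset.sum_mul]
  rw [← h1]
  conv_lhs => rw [← e.sum_repr (sharp β' y), map_sum]
  refine Finset.sum_congr rfl fun k _ ↦ ?_
  rw [map_smul, e.repr_apply_apply, real_inner_comm, inner_sharp, hβ, smul_eq_mul]

/-- The squared norm of the 2-form `dα`: the sum of the squares of all its components. -/
def extDSq (α : OneForm n M) (x : M) : ℝ :=
  ∑ i, ∑ j, raised (extD α) x i j x * extD α x (frame x i x) (frame x j x)

/-- The 1-form `u ↦ dα(u, v)`. -/
def extDContract (α : OneForm n M) (v : (x : M) → TangentSpace (𝓡 n) x) : OneForm n M :=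
  fun y ↦ extDLeft α y (v y)

theorem extD_apply_right (α : OneForm n M) (x : M) (u w : TangentSpace (𝓡 n) x) :
    extD α x u w = - extDLeft α x u w := by
  rw [extDLeft_apply, extD_antisymm]

/-- Contracting each of the two index pairs with `sum_gram_inv_mul_mul` replaces the frame by `e`.
The sum runs over ordered pairs, so `extDSq` is twice the usual squared norm of a 2-form; this is
why it is halved in the energy. -/
theorem extDSq_eq_sum (α : OneForm n M) (x : M)
    (e : OrthonormalBasis ι ℝ (TangentSpace (𝓡 n) x)) :
    extDSq α x = ∑ l, ∑ k, extD α x (e k) (e l) ^ 2 := by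
  have hx := mem_chart_source (Euc n) x
  have h1 : extDSq α x = ∑ j, ∑ b, (gram x x)⁻¹ j b * ∑ i, ∑ a, (gram x x)⁻¹ i a *
      extDLeft α x (frame x b x) (frame x a x) * extDLeft α x (frame x j x) (frame x i x) := by
    simp only [extDSq, raised, extDLeft_apply, Finset.mul_sum, Finset.sum_mul]
    rw [Finset.sum_comm]
    refine Finset.sum_congr rfl fun j _ ↦ ?_
    rw [Finset.sum_congr rfl fun i _ ↦ Finset.sum_comm, Finset.sum_comm]
    refine Finset.sum_congr rfl fun b _ ↦ Finset.sum_congr rfl fun i _ ↦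
      Finset.sum_congr rfl fun a _ ↦ by ring
  rw [h1]
  simp only [sum_gram_inv_mul_mul hx e]
  have h2 : ∀ k, ∑ j, ∑ b, (gram x x)⁻¹ j b * extDLeft α x (e k) (frame x b x) *
      extDLeft α x (e k) (frame x j x) = ∑ l, extD α x (e k) (e l) ^ 2 := by
    intro k
    rw [sum_gram_inv_mul_mul hx e]
    exact Finset.sum_congr rfl fun l _ ↦ by rw [extD_apply_right]; ring
  rw [Finset.sum_comm (f := fun l k ↦ extD α x (e k) (e l) ^ 2)]
  simp only [← h2, Finset.mul_sum]
  rw [Finset.sum_congr rfl fun j _ ↦ Finset.sum_comm, Finset.sum_comm]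
  refine Finset.sum_congr rfl fun k _ ↦ Finset.sum_congr rfl fun j _ ↦
    Finset.sum_congr rfl fun b _ ↦ ?_
  simp only [extDLeft_apply]
  rw [extD_antisymm α x (e k), extD_antisymm α x (e k)]
  ring

theorem extDSq_nonneg (α : OneForm n M) (x : M) : 0 ≤ extDSq α x := by
  rw [extDSq_eq_sum α x (stdOrthonormalBasis ℝ _)]
  positivity

/-- Cauchy-Schwarz for each component in an orthonormal basis: the Hilbert-Schmidt norm dominates
the operator norm. -/
theorem norm_sharp_extDLeft_sq_le (α : OneForm n M) (v : (x : M) → TangentSpace (𝓡 n) x) (x : M) :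
    ‖sharp (extDContract α v) x‖ ^ 2 ≤ extDSq α x * ‖v x‖ ^ 2 := by
  have e := stdOrthonormalBasis ℝ (TangentSpace (𝓡 n) x)
  rw [extDSq_eq_sum α x e, ← e.sum_sq_norm_inner_right, ← e.sum_sq_norm_inner_right (v x),
    Finset.sum_comm, Finset.sum_mul]
  refine Finset.sum_le_sum fun k _ ↦ ?_
  have h1 : inner ℝ (e k) (sharp (extDContract α v) x)
      = ∑ l, extD α x (e k) (e l) * inner ℝ (e l) (v x) := by
    rw [real_inner_comm, inner_sharp]
    change extDLeft α x (v x) (e k) = _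
    rw [extDLeft_apply, extD_apply_right]
    conv_lhs => rw [← e.sum_repr (v x), map_sum, ← Finset.sum_neg_distrib]
    refine Finset.sum_congr rfl fun l _ ↦ ?_
    rw [map_smul, extD_apply_right, e.repr_apply_apply, smul_eq_mul]
    ring
  rw [h1, Real.norm_eq_abs, sq_abs]
  simpa only [Real.norm_eq_abs, sq_abs] using Finset.sum_mul_sq_le_sq_mul_sq Finset.univ
    (fun l ↦ extD α x (e k) (e l)) (fun l ↦ inner ℝ (e l) (v x))

theorem extD_eq_zero_of_extDSq {α : OneForm n M} {x : M} (h : extDSq α x = 0)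
    (u w : TangentSpace (𝓡 n) x) : extD α x u w = 0 := by
  classical
  -- Any field with value `w` at `x` will do, since the bound is pointwise.
  let v : (z : M) → TangentSpace (𝓡 n) z := fun z ↦ if h : z = x then h ▸ w else 0
  have hv : v x = w := dif_pos rfl
  have h1 := norm_sharp_extDLeft_sq_le α v x
  rw [h, zero_mul] at h1
  have h2 : sharp (extDContract α v) x = 0 := by
    rw [← norm_eq_zero]
    exact pow_eq_zero_iff two_ne_zero |>.1 (le_antisymm h1 (sq_nonneg _))
  have h3 := inner_sharp (extDContract α v) x u
  rw [h2, inner_zero_left] at h3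
  rw [← extDLeft_apply, ← hv]
  exact h3.symm

end Euclidean

end MetricComponents

/-! ### Smoothness of the metric and of the fields derived from it. -/

section SmoothMetric

variable {n : ℕ} {M : Type*} [TopologicalSpace M] [ChartedSpace (Euc n) M]
  [IsManifold (𝓡 n) ∞ M] [RiemannianBundle (fun x : M ↦ TangentSpace (𝓡 n) x)]
  [IsContMDiffRiemannianBundle (𝓡 n) ∞ (Euc n) (fun x : M ↦ TangentSpace (𝓡 n) x)]

theorem smoothAt_gram {x₀ y : M} (hy : y ∈ (chartAt (Euc n) x₀).source) (i j : Fin n) :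
    SmoothAt n (fun z ↦ gram x₀ z i j) y :=
  ContMDiffAt.inner_bundle (contMDiffAt_frame hy i) (contMDiffAt_frame hy j)

theorem smoothAt_gram_inv {x₀ y : M} (hy : y ∈ (chartAt (Euc n) x₀).source) (i j : Fin n) :
    SmoothAt n (fun z ↦ (gram x₀ z)⁻¹ i j) y :=
  SmoothAt.matrix_inv (smoothAt_gram hy) (gram_det_pos hy).ne' i j

theorem smoothAt_dens {x₀ y : M} (hy : y ∈ (chartAt (Euc n) x₀).source) :
    SmoothAt n (dens n x₀) y :=
  (SmoothAt.matrix_det (smoothAt_gram hy)).comp_contDiffAt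
    (Real.contDiffAt_sqrt (gram_det_pos hy).ne')

theorem isSmoothField_sharp_of_frame {β : OneForm n M}
    (hβ : ∀ (x₀ : M), ∀ y ∈ (chartAt (Euc n) x₀).source, ∀ i,
      SmoothAt n (fun z ↦ β z (frame x₀ i z)) y) : IsSmoothField (sharp β) := by
  refine isSmoothField_of_coframe fun x₀ y hy i ↦ ?_
  refine ContMDiffAt.congr_of_eventuallyEq (SmoothAt.sum fun j (_ : j ∈ Finset.univ) ↦
    (smoothAt_gram_inv hy i j).mul (hβ x₀ y hy j)) ?_
  filter_upwards [(chartAt (Euc n) x₀).open_source.mem_nhds hy] with z hz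
  exact coframe_sharp β hz i

theorem IsSmoothForm.sharp {α : OneForm n M} (hα : IsSmoothForm α) : IsSmoothField (sharp α) :=
  isSmoothField_sharp_of_frame fun _ _ hy i ↦ hα.smoothAt_frame hy i

theorem smoothAt_form_field {α : OneForm n M} {v : (x : M) → TangentSpace (𝓡 n) x}
    (hα : IsSmoothForm α) (hv : IsSmoothField v) (y : M) : SmoothAt n (fun z ↦ α z (v z)) y := by
  have hy := mem_chart_source (Euc n) y
  refine ContMDiffAt.congr_of_eventuallyEq (SmoothAt.sum fun i (_ : i ∈ Finset.univ) ↦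
    (hv.smoothAt_coframe hy i).mul (hα.smoothAt_frame hy i)) ?_
  filter_upwards [(chartAt (Euc n) y).open_source.mem_nhds hy] with z hz
  exact clm_apply_eq_sum hz (α z) (v z)

/-- The vector field `(ι_v dα)^♯` up to sign: `⟪·, u⟫ = dα(u, v)`. -/
def extDField (α : OneForm n M) (v : (x : M) → TangentSpace (𝓡 n) x) (x : M) :
    TangentSpace (𝓡 n) x :=
  sharp (extDContract α v) x

theorem extD_frame_apply (α : OneForm n M) {x₀ z : M} (hz : z ∈ (chartAt (Euc n) x₀).source)
    (v : TangentSpace (𝓡 n) z) (i : Fin n) : extDLeft α z v (frame x₀ i z) =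
      ∑ j, coframe x₀ j z v * extD α z (frame x₀ i z) (frame x₀ j z) := by
  rw [extDLeft_apply, extD_apply_right, clm_apply_eq_sum hz, ← Finset.sum_neg_distrib]
  exact Finset.sum_congr rfl fun j _ ↦ by rw [extD_apply_right]; ring

theorem isSmoothField_extDField {α : OneForm n M} {v : (x : M) → TangentSpace (𝓡 n) x}
    (hα : IsSmoothForm α) (hv : IsSmoothField v) : IsSmoothField (extDField α v) := by
  refine isSmoothField_sharp_of_frame fun x₀ y hy i ↦ ?_
  refine ContMDiffAt.congr_of_eventuallyEq (SmoothAt.sum fun j (_ : j ∈ Finset.univ) ↦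
    (hv.smoothAt_coframe hy j).mul (smoothAt_extD_frame hα hy i j)) ?_
  filter_upwards [(chartAt (Euc n) x₀).open_source.mem_nhds hy] with z hz
  exact extD_frame_apply α hz (v z) i

theorem smoothAt_raised {α : OneForm n M} (hα : IsSmoothForm α) {x₀ y : M}
    (hy : y ∈ (chartAt (Euc n) x₀).source) (i j : Fin n) :
    SmoothAt n (raised (extD α) x₀ i j) y :=
  SmoothAt.sum fun a _ ↦ SmoothAt.sum fun b _ ↦ ((smoothAt_gram_inv hy i a).mul
    (smoothAt_gram_inv hy j b)).mul (smoothAt_extD_frame hα hy a b)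

/-- Writes the components as `η^ij α_j` with `η = dα`: the derivative of `η^ij` in the divergence
then produces exactly the expression that defines `codiff₂`. -/
theorem coframe_extDField_sharp (α : OneForm n M) {x₀ z : M}
    (hz : z ∈ (chartAt (Euc n) x₀).source) (i : Fin n) :
    coframe x₀ i z (extDField α (sharp α) z) =
      ∑ j, raised (extD α) x₀ i j z * α z (frame x₀ j z) := by
  rw [extDField, coframe_sharp _ hz]
  have h : ∀ a, extDContract α (sharp α) z (frame x₀ a z) = ∑ j, coframe x₀ j z (sharp α z) *
      extD α z (frame x₀ a z) (frame x₀ j z) := fun a ↦ extD_frame_apply α hz _ a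
  simp only [h, coframe_sharp α hz, raised, Finset.mul_sum, Finset.sum_mul]
  rw [Finset.sum_congr rfl fun a _ ↦ Finset.sum_comm, Finset.sum_comm]
  refine Finset.sum_congr rfl fun j _ ↦ Finset.sum_congr rfl fun a _ ↦
    Finset.sum_congr rfl fun b _ ↦ ?_
  rw [gram_inv_comm x₀ z b j]
  ring

end SmoothMetric

/-! ### Change of chart for the volume density. -/

section TransitionMatrix

variable {n : ℕ} {M : Type*} [TopologicalSpace M] [ChartedSpace (Euc n) M]
  [IsManifold (𝓡 n) ∞ M]

theorem coframe_frame_eq_fderiv {x₀ x₁ y : M} (hy₀ : y ∈ (chartAt (Euc n) x₀).source)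
    (hy₁ : y ∈ (chartAt (Euc n) x₁).source) (k i : Fin n) :
    coframe x₁ k y (frame x₀ i y) =
      fderiv ℝ (extChartAt (𝓡 n) x₁ ∘ (extChartAt (𝓡 n) x₀).symm) (extChartAt (𝓡 n) x₀ y)
        (EuclideanSpace.single i 1) k := by
  have h1 : MDifferentiableAt (𝓡 n) 𝓘(ℝ, Euc n) (extChartAt (𝓡 n) x₁) y :=
    mdifferentiableAt_extChartAt hy₁
  have h2 : DifferentiableAt ℝ (extChartAt (𝓡 n) x₁ ∘ (extChartAt (𝓡 n) x₀).symm)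
      (extChartAt (𝓡 n) x₀ y) := by
    have := (mdifferentiableAt_iff_source_of_mem_source (I := 𝓡 n) (I' := 𝓘(ℝ, Euc n)) hy₀).1 h1
    rw [← mdifferentiableAt_iff_differentiableAt]
    simpa [mdifferentiableWithinAt_univ] using this
  have h3 : coord n x₁ k ∘ (extChartAt (𝓡 n) x₀).symm = fun z ↦
      (EuclideanSpace.proj k : Euc n →L[ℝ] ℝ)
        ((extChartAt (𝓡 n) x₁ ∘ (extChartAt (𝓡 n) x₀).symm) z) := rfl
  rw [← mvfderiv_coord hy₁ k]
  change pd x₀ i (coord n x₁ k) y = _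
  rw [pd_eq_fderiv hy₀ (smoothAt_coord hy₁ k).mdiff, h3, fderiv_fun_comp _
    (ContinuousLinearMap.differentiableAt _) h2, ContinuousLinearMap.fderiv]
  rfl

variable [RiemannianBundle (fun x : M ↦ TangentSpace (𝓡 n) x)]

/-- The Gram matrices satisfy `G₀ = Jᵀ G₁ J` with J the Jacobian matrix of the transition map; take
determinants and square roots. -/
theorem dens_eq_abs_det_mul {x₀ x₁ y : M} (hy₀ : y ∈ (chartAt (Euc n) x₀).source)
    (hy₁ : y ∈ (chartAt (Euc n) x₁).source) :
    dens n x₀ y = |(fderiv ℝ (extChartAt (𝓡 n) x₁ ∘ (extChartAt (𝓡 n) x₀).symm)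
      (extChartAt (𝓡 n) x₀ y)).det| * dens n x₁ y := by
  set D := fderiv ℝ (extChartAt (𝓡 n) x₁ ∘ (extChartAt (𝓡 n) x₀).symm) (extChartAt (𝓡 n) x₀ y)
  let b := (EuclideanSpace.basisFun (Fin n) ℝ).toBasis
  let J : Matrix (Fin n) (Fin n) ℝ := Matrix.of fun k i ↦ coframe x₁ k y (frame x₀ i y)
  have hJ : J = LinearMap.toMatrix b b D.toLinearMap := by
    ext k i
    rw [LinearMap.toMatrix_apply]
    simp only [b, OrthonormalBasis.coe_toBasis, EuclideanSpace.basisFun_apply]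
    exact coframe_frame_eq_fderiv hy₀ hy₁ k i
  have hdet : J.det = D.det := by
    rw [hJ, LinearMap.det_toMatrix]
  have hg : gram x₀ y = J.transpose * gram x₁ y * J := by
    ext i j
    have h1 : gram x₀ y i j = inner ℝ (frame x₀ i y) (frame x₀ j y) := rfl
    rw [h1]
    conv_lhs => rw [← sum_coframe_smul_frame hy₁ (frame x₀ j y), inner_sum]
    rw [Matrix.mul_apply]
    refine Finset.sum_congr rfl fun k _ ↦ ?_
    rw [real_inner_smul_right, inner_frame hy₁, Matrix.mul_apply, mul_comm]
    rfl
  rw [dens, dens, hg, Matrix.det_mul, Matrix.det_mul, Matrix.det_transpose, hdet,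
    ← Real.sqrt_sq_eq_abs, ← Real.sqrt_mul (sq_nonneg _)]
  congr 1
  ring

end TransitionMatrix

/-! ### The Riemannian volume measure and integration in charts. -/

section Volume

variable {n : ℕ} {M : Type*} [TopologicalSpace M] [ChartedSpace (Euc n) M]
  [IsManifold (𝓡 n) ∞ M] [RiemannianBundle (fun x : M ↦ TangentSpace (𝓡 n) x)]
  [IsContMDiffRiemannianBundle (𝓡 n) ∞ (Euc n) (fun x : M ↦ TangentSpace (𝓡 n) x)]
  [MeasurableSpace M] [BorelSpace M]

variable (n) in
/-- The domain in `ℝⁿ` of the inverse of the preferred chart at `x₀`. -/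
abbrev chartTarget (x₀ : M) : Set (Euc n) := (extChartAt (𝓡 n) x₀).target

variable (n) in
/-- The inverse of the preferred chart at `x₀`. -/
abbrev chartSymm (x₀ : M) : Euc n → M := (extChartAt (𝓡 n) x₀).symm

theorem isOpen_chartTarget (x₀ : M) : IsOpen (chartTarget n x₀) := isOpen_extChartAt_target x₀

theorem measurableSet_chartTarget (x₀ : M) : MeasurableSet (chartTarget n x₀) :=
  (isOpen_chartTarget x₀).measurableSet

theorem chartSymm_mem_source {x₀ : M} {z : Euc n} (hz : z ∈ chartTarget n x₀) :
    chartSymm n x₀ z ∈ (chartAt (Euc n) x₀).source := by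
  have := (extChartAt (𝓡 n) x₀).map_target hz
  rwa [extChartAt_source] at this

theorem continuousOn_chartSymm (x₀ : M) : ContinuousOn (chartSymm n x₀) (chartTarget n x₀) :=
  continuousOn_extChartAt_symm x₀

theorem continuousOn_dens_chartSymm (x₀ : M) :
    ContinuousOn (fun z ↦ dens n x₀ (chartSymm n x₀ z)) (chartTarget n x₀) := by
  intro z hz
  exact ((smoothAt_dens (chartSymm_mem_source hz)).continuousAt.comp_continuousWithinAt
    (continuousOn_chartSymm x₀ z hz))

theorem measurableEmbedding_chartSymm (x₀ : M) :
    MeasurableEmbedding ((chartTarget n x₀).domRestrict (chartSymm n x₀)) := by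
  have h := (chartAt (Euc n) x₀).symm.isOpenEmbedding_restrict.measurableEmbedding
  have hT : chartTarget n x₀ = (chartAt (Euc n) x₀).symm.source := by
    simp [chartTarget, mfld_simps]
  rw [hT]
  exact h

/-- Off its target the inverse chart has arbitrary values. Restricted to the target it is a
measurable embedding, for which integrals can be transported without measurability conditions on the
integrand. -/
theorem chartVol_eq_map (x₀ : M) :
    chartVol n x₀ = Measure.map ((chartTarget n x₀).domRestrict (chartSymm n x₀))
      (Measure.comap (↑) ((volume : Measure (Euc n)).withDensity
        (fun z ↦ ENNReal.ofReal (dens n x₀ (chartSymm n x₀ z))))) := by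
  have hT := measurableSet_chartTarget (n := n) x₀
  rw [chartVol, ← restrict_withDensity hT, ← map_comap_subtype_coe hT,
    AEMeasurable.map_map_of_aemeasurable _ measurable_subtype_coe.aemeasurable]
  · rfl
  · rw [map_comap_subtype_coe hT]
    exact (continuousOn_chartSymm x₀).aemeasurable hT

theorem aemeasurable_dens (x₀ : M) :
    AEMeasurable (fun z ↦ dens n x₀ (chartSymm n x₀ z)) (volume.restrict (chartTarget n x₀)) :=
  (continuousOn_dens_chartSymm x₀).aemeasurable (measurableSet_chartTarget x₀)

theorem integral_chartVol (x₀ : M) (f : M → ℝ) :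
    ∫ y, f y ∂(chartVol n x₀) = ∫ z in chartTarget n x₀,
      dens n x₀ (chartSymm n x₀ z) * f (chartSymm n x₀ z) := by
  have hT := measurableSet_chartTarget (n := n) x₀
  rw [chartVol_eq_map, (measurableEmbedding_chartSymm x₀).integral_map]
  simp only [Set.domRestrict_apply]
  rw [← (MeasurableEmbedding.subtype_coe hT).integral_map
    (fun z ↦ f (chartSymm n x₀ z)), map_comap_subtype_coe hT]
  refine (setIntegral_withDensity_eq_setIntegral_smul₀ (aemeasurable_dens x₀).real_toNNReal _
    hT).trans ?_
  refine setIntegral_congr_fun hT fun z hz ↦ ?_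
  simp only [NNReal.smul_def, smul_eq_mul]
  rw [Real.coe_toNNReal _ (dens_pos (chartSymm_mem_source hz)).le]

theorem integrable_chartVol_iff (x₀ : M) (f : M → ℝ) :
    Integrable f (chartVol n x₀) ↔ IntegrableOn (fun z ↦
      dens n x₀ (chartSymm n x₀ z) * f (chartSymm n x₀ z)) (chartTarget n x₀) := by
  have hT := measurableSet_chartTarget (n := n) x₀
  rw [chartVol_eq_map, (measurableEmbedding_chartSymm x₀).integrable_map_iff]
  have h : f ∘ (chartTarget n x₀).domRestrict (chartSymm n x₀) =
    (fun z ↦ f (chartSymm n x₀ z)) ∘ (↑) := rfl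
  rw [h, ← (MeasurableEmbedding.subtype_coe hT).integrable_map_iff, map_comap_subtype_coe hT,
    restrict_withDensity hT]
  refine (integrable_withDensity_iff_integrable_coe_smul₀
    (aemeasurable_dens x₀).real_toNNReal).trans ?_
  refine integrable_congr ?_
  filter_upwards [ae_restrict_mem hT] with z hz
  simp only [smul_eq_mul]
  rw [Real.coe_toNNReal _ (dens_pos (chartSymm_mem_source hz)).le]

theorem chartVol_apply (x₀ : M) {A : Set M} (hA : MeasurableSet A) :
    chartVol n x₀ A = ∫⁻ z in chartTarget n x₀ ∩ chartSymm n x₀ ⁻¹' A,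
      ENNReal.ofReal (dens n x₀ (chartSymm n x₀ z)) := by
  have hT := measurableSet_chartTarget (n := n) x₀
  have hm : MeasurableSet (chartTarget n x₀ ∩ chartSymm n x₀ ⁻¹' A) := by
    have := (MeasurableEmbedding.subtype_coe hT).measurableSet_image.2
      ((measurableEmbedding_chartSymm x₀).measurable hA)
    convert this using 1
    ext z
    simp [and_comm]
  rw [chartVol_eq_map, (measurableEmbedding_chartSymm x₀).map_apply,
    (MeasurableEmbedding.subtype_coe hT).comap_apply, ← withDensity_apply _ hm]
  congr 1
  ext z
  simp [and_comm]

theorem measurableSet_source (x₀ : M) : MeasurableSet (chartAt (Euc n) x₀).source :=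
  (chartAt (Euc n) x₀).open_source.measurableSet

theorem chartVol_compl_source (x₀ : M) : chartVol n x₀ (chartAt (Euc n) x₀).sourceᶜ = 0 := by
  rw [chartVol_apply x₀ (measurableSet_source x₀).compl]
  have : chartTarget n x₀ ∩ chartSymm n x₀ ⁻¹' (chartAt (Euc n) x₀).sourceᶜ = ∅ := by
    ext z
    simp only [mem_inter_iff, mem_preimage, mem_compl_iff, mem_empty_iff_false, iff_false,
      not_and, not_not]
    exact fun hz ↦ chartSymm_mem_source hz
  rw [this]
  simp

/-- Change of variables under the transition map `τ`; the factor `|det Dτ|` is the ratio of the two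
densities. -/
theorem chartVol_apply_eq_of_subset {x₀ x₁ : M} {A : Set M} (hA : MeasurableSet A)
    (h₀ : A ⊆ (chartAt (Euc n) x₀).source) (h₁ : A ⊆ (chartAt (Euc n) x₁).source) :
    chartVol n x₀ A = chartVol n x₁ A := by
  have hm : MeasurableSet (chartTarget n x₀ ∩ chartSymm n x₀ ⁻¹' A) := by
    have := (MeasurableEmbedding.subtype_coe (measurableSet_chartTarget x₀)).measurableSet_image.2
      ((measurableEmbedding_chartSymm (n := n) x₀).measurable hA)
    convert this using 1
    ext z
    simp [and_comm]
  set τ := extChartAt (𝓡 n) x₁ ∘ chartSymm n x₀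
  have hs₀ : ∀ y ∈ A, y ∈ (extChartAt (𝓡 n) x₀).source := fun y hy ↦ by
    rw [extChartAt_source]; exact h₀ hy
  have hs₁ : ∀ y ∈ A, y ∈ (extChartAt (𝓡 n) x₁).source := fun y hy ↦ by
    rw [extChartAt_source]; exact h₁ hy
  have hd : ∀ z ∈ chartTarget n x₀ ∩ chartSymm n x₀ ⁻¹' A,
      HasFDerivWithinAt τ (fderiv ℝ τ z) (chartTarget n x₀ ∩ chartSymm n x₀ ⁻¹' A) z := by
    intro z hz
    have h1 : MDifferentiableAt (𝓡 n) 𝓘(ℝ, Euc n) (extChartAt (𝓡 n) x₁) (chartSymm n x₀ z) :=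
      mdifferentiableAt_extChartAt (h₁ hz.2)
    have h2 := (mdifferentiableAt_iff_source_of_mem_source (I := 𝓡 n) (I' := 𝓘(ℝ, Euc n))
      (chartSymm_mem_source hz.1)).1 h1
    rw [(extChartAt (𝓡 n) x₀).right_inv hz.1] at h2
    have h3 : DifferentiableAt ℝ τ z := by
      rw [← mdifferentiableAt_iff_differentiableAt]
      rw [modelWithCornersSelf_coe, range_id, mdifferentiableWithinAt_univ] at h2
      exact h2
    exact h3.hasFDerivAt.hasFDerivWithinAt
  have hinj : InjOn τ (chartTarget n x₀ ∩ chartSymm n x₀ ⁻¹' A) := by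
    intro z hz w hw h
    exact (extChartAt (𝓡 n) x₀).symm.injOn hz.1 hw.1
      ((extChartAt (𝓡 n) x₁).injOn (hs₁ _ hz.2) (hs₁ _ hw.2) h)
  have himg : τ '' (chartTarget n x₀ ∩ chartSymm n x₀ ⁻¹' A) =
      chartTarget n x₁ ∩ chartSymm n x₁ ⁻¹' A := by
    ext w
    constructor
    · rintro ⟨z, hz, rfl⟩
      refine ⟨(extChartAt (𝓡 n) x₁).map_source (hs₁ _ hz.2), ?_⟩
      have : chartSymm n x₁ (τ z) = chartSymm n x₀ z :=
        (extChartAt (𝓡 n) x₁).left_inv (hs₁ _ hz.2)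
      rw [mem_preimage, this]
      exact hz.2
    · rintro ⟨hw, hwA⟩
      have hl : chartSymm n x₀ (extChartAt (𝓡 n) x₀ (chartSymm n x₁ w)) = chartSymm n x₁ w :=
        (extChartAt (𝓡 n) x₀).left_inv (hs₀ _ hwA)
      refine ⟨extChartAt (𝓡 n) x₀ (chartSymm n x₁ w),
        ⟨(extChartAt (𝓡 n) x₀).map_source (hs₀ _ hwA), ?_⟩, ?_⟩
      · rw [mem_preimage, hl]
        exact hwA
      · change extChartAt (𝓡 n) x₁ (chartSymm n x₀ _) = w
        rw [hl]
        exact (extChartAt (𝓡 n) x₁).right_inv hw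
  rw [chartVol_apply x₀ hA, chartVol_apply x₁ hA, ← himg,
    lintegral_image_eq_lintegral_abs_det_fderiv_mul volume hm hd hinj]
  refine setLIntegral_congr_fun hm fun z hz ↦ ?_
  have hl : chartSymm n x₁ (τ z) = chartSymm n x₀ z :=
    (extChartAt (𝓡 n) x₁).left_inv (hs₁ _ hz.2)
  have hdens := dens_eq_abs_det_mul (h₀ hz.2) (h₁ hz.2)
  rw [(extChartAt (𝓡 n) x₀).right_inv hz.1] at hdens
  change ENNReal.ofReal (dens n x₀ (chartSymm n x₀ z)) =
    ENNReal.ofReal |(fderiv ℝ τ z).det| * ENNReal.ofReal (dens n x₁ (chartSymm n x₁ (τ z)))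
  rw [hl, ← ENNReal.ofReal_mul (abs_nonneg _), hdens]

theorem chartVol_le_vol (x₀ : M) : chartVol n x₀ ≤ vol n M := le_iSup (chartVol n) x₀

theorem chartVol_restrict_source (x₀ : M) :
    (chartVol n x₀).restrict (chartAt (Euc n) x₀).source = chartVol n x₀ := by
  refine Measure.restrict_eq_self_of_ae_mem ?_
  rw [ae_iff]
  exact chartVol_compl_source x₀

/-- Every chart measure is at most `chartVol n x₀` plus the part of the volume outside the source at
`x₀`, hence so is their supremum. Restriction to the source removes the second term. -/
theorem vol_restrict_source (x₀ : M) :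
    (vol n M).restrict (chartAt (Euc n) x₀).source = chartVol n x₀ := by
  refine le_antisymm ?_ ?_
  · have h : vol n M ≤ chartVol n x₀ + (vol n M).restrict (chartAt (Euc n) x₀).sourceᶜ := by
      refine iSup_le fun x₁ ↦ Measure.le_iff.2 fun A hA ↦ ?_
      have hS := measurableSet_source (n := n) x₀
      have hS₁ := measurableSet_source (n := n) x₁
      rw [← measure_inter_add_sdiff A hS, Measure.add_apply]
      refine add_le_add ?_ ?_
      -- The measure `chartVol n x₁` has no mass outside its own source, so only the overlap counts,
      -- and there the two measures agree.
      · rw [← measure_inter_add_sdiff (A ∩ _) hS₁]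
        have h0 : chartVol n x₁ ((A ∩ (chartAt (Euc n) x₀).source) \
            (chartAt (Euc n) x₁).source) = 0 :=
          measure_mono_null (fun y hy ↦ hy.2) (chartVol_compl_source x₁)
        rw [h0, add_zero, ← chartVol_apply_eq_of_subset (x₀ := x₀) ((hA.inter hS).inter hS₁)
          (fun y hy ↦ hy.1.2) (fun y hy ↦ hy.2)]
        exact measure_mono fun y hy ↦ hy.1.1
      · rw [Measure.restrict_apply hA, ← sdiff_eq]
        exact chartVol_le_vol x₁ _
    calc (vol n M).restrict (chartAt (Euc n) x₀).source
        ≤ (chartVol n x₀ + (vol n M).restrict (chartAt (Euc n) x₀).sourceᶜ).restrict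
            (chartAt (Euc n) x₀).source := Measure.restrict_mono Subset.rfl h
      _ = chartVol n x₀ := by
        rw [Measure.restrict_add, chartVol_restrict_source,
          Measure.restrict_restrict (measurableSet_source x₀), inter_compl_self,
          Measure.restrict_empty, add_zero]
  · rw [← chartVol_restrict_source]
    exact Measure.restrict_mono Subset.rfl (chartVol_le_vol x₀)

theorem setIntegral_vol (x₀ : M) (f : M → ℝ) :
    ∫ y in (chartAt (Euc n) x₀).source, f y ∂(vol n M) = ∫ z in chartTarget n x₀,
      dens n x₀ (chartSymm n x₀ z) * f (chartSymm n x₀ z) := by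
  rw [vol_restrict_source, integral_chartVol]

theorem integrableOn_vol_iff (x₀ : M) (f : M → ℝ) :
    IntegrableOn f (chartAt (Euc n) x₀).source (vol n M) ↔ IntegrableOn (fun z ↦
      dens n x₀ (chartSymm n x₀ z) * f (chartSymm n x₀ z)) (chartTarget n x₀) := by
  rw [IntegrableOn, vol_restrict_source, integrable_chartVol_iff]

instance isLocallyFiniteMeasure_vol : IsLocallyFiniteMeasure (vol n M) := by
  refine ⟨fun y ↦ ?_⟩
  have hy : y ∈ (extChartAt (𝓡 n) y).source := mem_extChartAt_source y
  have hT : chartTarget n y ∈ nhds (extChartAt (𝓡 n) y y) := extChartAt_target_mem_nhds y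
  obtain ⟨K, hK, hKT, hKc⟩ := local_compact_nhds hT
  refine ⟨(chartAt (Euc n) y).source ∩ extChartAt (𝓡 n) y ⁻¹' interior K, ?_, ?_⟩
  · exact Filter.inter_mem (chart_source_mem_nhds _ y) ((continuousAt_extChartAt y).preimage_mem_nhds
      (interior_mem_nhds.2 hK))
  · have hopen : IsOpen ((chartAt (Euc n) y).source ∩ extChartAt (𝓡 n) y ⁻¹' interior K) := by
      have := (continuousOn_extChartAt (I := 𝓡 n) y).isOpen_inter_preimage
        (isOpen_extChartAt_source y) (isOpen_interior (s := K))
      rwa [extChartAt_source] at this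
    have h1 : vol n M ((chartAt (Euc n) y).source ∩ extChartAt (𝓡 n) y ⁻¹' interior K) =
        chartVol n y ((chartAt (Euc n) y).source ∩ extChartAt (𝓡 n) y ⁻¹' interior K) := by
      rw [← vol_restrict_source, Measure.restrict_apply hopen.measurableSet]
      congr 1
      ext z
      simp only [mem_inter_iff]
      tauto
    rw [h1, chartVol_apply y hopen.measurableSet]
    have hsub : chartTarget n y ∩ chartSymm n y ⁻¹' ((chartAt (Euc n) y).source ∩
        extChartAt (𝓡 n) y ⁻¹' interior K) ⊆ K := by
      rintro z ⟨hz, -, hz2⟩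
      rw [mem_preimage, (extChartAt (𝓡 n) y).right_inv hz] at hz2
      exact interior_subset hz2
    refine (lintegral_mono_set hsub).trans_lt ?_
    have hint := ((continuousOn_dens_chartSymm (n := n) y).mono hKT).integrableOn_compact
      (μ := volume) hKc
    exact hint.lintegral_lt_top

/-- The density is positive. This later turns almost-everywhere identities between continuous
functions into pointwise ones. -/
instance isOpenPosMeasure_vol : (vol n M).IsOpenPosMeasure := by
  refine ⟨fun U hU ⟨y, hy⟩ h0 ↦ ?_⟩
  have h1 : chartVol n y U = 0 := le_antisymm ((chartVol_le_vol y U).trans h0.le) (zero_le)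
  rw [chartVol_apply y hU.measurableSet] at h1
  have hopen : IsOpen (chartTarget n y ∩ chartSymm n y ⁻¹' U) :=
    (continuousOn_chartSymm y).isOpen_inter_preimage (isOpen_chartTarget y) hU
  have hne : (chartTarget n y ∩ chartSymm n y ⁻¹' U).Nonempty := by
    refine ⟨extChartAt (𝓡 n) y y, (extChartAt (𝓡 n) y).map_source (mem_extChartAt_source y), ?_⟩
    rw [mem_preimage, chartSymm, (extChartAt (𝓡 n) y).left_inv (mem_extChartAt_source y)]
    exact hy
  have hpos := hopen.measure_pos volume hne
  rw [setLIntegral_eq_zero_iff' hopen.measurableSet] at h1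
  · refine hpos.ne' ?_
    have h2 : ∀ᵐ z ∂(volume : Measure (Euc n)), z ∉ chartTarget n y ∩ chartSymm n y ⁻¹' U := by
      filter_upwards [h1] with z hz hzU
      have := ENNReal.ofReal_eq_zero.1 (hz hzU)
      exact absurd (dens_pos (chartSymm_mem_source hzU.1)) (not_lt.2 this)
    rw [ae_iff] at h2
    simp only [not_not] at h2
    exact h2
  · exact ((aemeasurable_dens y).mono_measure
      (Measure.restrict_mono inter_subset_left le_rfl)).ennreal_ofReal

end Volume

/-! ### Integration by parts on `ℝⁿ` against a Lipschitz function. -/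

section EuclideanIntegration

/-- By Rademacher's theorem `ψ` is differentiable almost everywhere, and there its line derivatives
are the values of `fderiv`. The rest is integration by parts for line derivatives of Lipschitz
functions. -/
theorem integral_lipschitz_mul_divergence {n : ℕ} {ψ : Euc n → ℝ} {C : NNReal}
    (hψ : LipschitzWith C ψ) {F : Fin n → Euc n → ℝ} (hF : ∀ i, ContDiff ℝ ∞ (F i))
    (hFc : ∀ i, HasCompactSupport (F i)) :
    Integrable (fun z ↦ ∑ i, F i z * fderiv ℝ ψ z (EuclideanSpace.single i 1)) ∧
    ∫ z, ψ z * ∑ i, fderiv ℝ (F i) z (EuclideanSpace.single i 1) =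
      - ∫ z, ∑ i, F i z * fderiv ℝ ψ z (EuclideanSpace.single i 1) := by
  have hint : ∀ i, Integrable (fun z ↦ F i z * fderiv ℝ ψ z (EuclideanSpace.single i 1)) := by
    intro i
    refine ((hF i).continuous.integrable_of_hasCompactSupport (hFc i)).mul_bdd (c := C)
      (measurable_fderiv_apply_const ℝ ψ _).aestronglyMeasurable
      (Filter.Eventually.of_forall fun z ↦ ?_)
    refine ((fderiv ℝ ψ z).le_opNorm _).trans ?_
    rw [PiLp.norm_single, norm_one, mul_one]
    exact norm_fderiv_le_of_lipschitz ℝ hψ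
  have hint' : ∀ i, Integrable
      (fun z ↦ ψ z * fderiv ℝ (F i) z (EuclideanSpace.single i 1)) := by
    intro i
    have hc : Continuous fun z ↦ fderiv ℝ (F i) z (EuclideanSpace.single i 1) :=
      ((hF i).continuous_fderiv (by simp)).clm_apply continuous_const
    refine (hψ.continuous.mul hc).integrable_of_hasCompactSupport ?_
    exact HasCompactSupport.mul_left ((hFc i).fderiv_apply ℝ (EuclideanSpace.single i 1))
  refine ⟨integrable_finsetSum _ fun i _ ↦ hint i, ?_⟩
  simp only [Finset.mul_sum]
  rw [integral_finsetSum _ fun i _ ↦ hint i, integral_finsetSum _ fun i _ ↦ hint' i,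
    ← Finset.sum_neg_distrib]
  refine Finset.sum_congr rfl fun i _ ↦ ?_
  -- The integration by parts needs both factors Lipschitz, and one of them compactly supported.
  obtain ⟨D, hD⟩ := (hF i).lipschitzWith_of_hasCompactSupport (hFc i) (by simp)
  have h := hψ.integral_lineDeriv_mul_eq (μ := volume) hD (hFc i) (EuclideanSpace.single i 1)
  have h1 : ∫ z, lineDeriv ℝ ψ z (EuclideanSpace.single i 1) * F i z =
      ∫ z, F i z * fderiv ℝ ψ z (EuclideanSpace.single i 1) := by
    refine integral_congr_ae ?_
    filter_upwards [hψ.ae_differentiableAt (μ := volume)] with z hz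
    rw [hz.lineDeriv_eq_fderiv, mul_comm]
  have h2 : ∫ z, lineDeriv ℝ (F i) z (-EuclideanSpace.single i 1) * ψ z =
      - ∫ z, ψ z * fderiv ℝ (F i) z (EuclideanSpace.single i 1) := by
    rw [← integral_neg]
    refine integral_congr_ae (Filter.Eventually.of_forall fun z ↦ ?_)
    simp only
    rw [lineDeriv_neg, ((hF i).differentiable (by simp) z).lineDeriv_eq_fderiv]
    ring
  rw [h1, h2] at h
  rw [h, neg_neg]

end EuclideanIntegration

/-! ### The divergence theorem on the manifold. -/

section ChartDivergence

variable {n : ℕ} {M : Type*} [TopologicalSpace M] [ChartedSpace (Euc n) M]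
  [IsManifold (𝓡 n) ∞ M]

/-- No differentiability is needed: where it fails, it fails on both sides and both derivatives take
the default value 0. So the formula applies to Lipschitz cutoffs. -/
theorem pd_eq_fderiv_of_chart {x₀ y : M} (hy : y ∈ (chartAt (Euc n) x₀).source) (f : M → ℝ)
    (i : Fin n) :
    pd x₀ i f y = fderiv ℝ (f ∘ (extChartAt (𝓡 n) x₀).symm) (extChartAt (𝓡 n) x₀ y)
      (EuclideanSpace.single i 1) := by
  by_cases hf : MDifferentiableAt (𝓡 n) 𝓘(ℝ, ℝ) f y
  · exact pd_eq_fderiv hy hf i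
  · have h1 : ¬ DifferentiableAt ℝ (f ∘ (extChartAt (𝓡 n) x₀).symm)
        (extChartAt (𝓡 n) x₀ y) := by
      intro h
      refine hf ((mdifferentiableAt_iff_source_of_mem_source (I := 𝓡 n) (I' := 𝓘(ℝ, ℝ)) hy).2 ?_)
      rw [← mdifferentiableAt_iff_differentiableAt] at h
      rw [modelWithCornersSelf_coe, range_id, mdifferentiableWithinAt_univ]
      exact h
    rw [fderiv_zero_of_not_differentiableAt h1]
    change mfderiv (𝓡 n) 𝓘(ℝ, ℝ) f y (frame x₀ i y) = 0
    rw [mfderiv_zero_of_not_mdifferentiableAt hf]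
    rfl

variable [RiemannianBundle (fun x : M ↦ TangentSpace (𝓡 n) x)]

/-- The Riemannian divergence of a vector field, computed in the preferred chart at `x₀`. -/
def chartDvg (x₀ : M) (v : (x : M) → TangentSpace (𝓡 n) x) (y : M) : ℝ :=
  (dens n x₀ y)⁻¹ * ∑ i, pd x₀ i (fun z ↦ dens n x₀ z * coframe x₀ i z (v z)) y

variable [IsContMDiffRiemannianBundle (𝓡 n) ∞ (Euc n) (fun x : M ↦ TangentSpace (𝓡 n) x)]

theorem smoothAt_dens_mul_coframe {v : (x : M) → TangentSpace (𝓡 n) x} (hv : IsSmoothField v)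
    {x₀ y : M} (hy : y ∈ (chartAt (Euc n) x₀).source) (i : Fin n) :
    SmoothAt n (fun z ↦ dens n x₀ z * coframe x₀ i z (v z)) y :=
  (smoothAt_dens hy).mul (hv.smoothAt_coframe hy i)

theorem smoothAt_chartDvg {v : (x : M) → TangentSpace (𝓡 n) x} (hv : IsSmoothField v)
    {x₀ y : M} (hy : y ∈ (chartAt (Euc n) x₀).source) : SmoothAt n (chartDvg x₀ v) y :=
  ((smoothAt_dens hy).comp_contDiffAt (contDiffAt_inv ℝ (dens_pos hy).ne')).mul
    (SmoothAt.sum fun i _ ↦ SmoothAt.pd (chartAt (Euc n) x₀).open_source Subset.rfl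
      (fun _ hz ↦ smoothAt_dens_mul_coframe hv hz i) hy i)

theorem chartDvg_smul {v : (x : M) → TangentSpace (𝓡 n) x} (hv : IsSmoothField v)
    {f : M → ℝ} {x₀ y : M} (hy : y ∈ (chartAt (Euc n) x₀).source) (hf : SmoothAt n f y) :
    chartDvg x₀ (fun z ↦ f z • v z) y = f y * chartDvg x₀ v y + mvfderiv (𝓡 n) f y (v y) := by
  have h1 : ∀ i, (fun z ↦ dens n x₀ z * coframe x₀ i z (f z • v z)) =
      fun z ↦ f z * (dens n x₀ z * coframe x₀ i z (v z)) := by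
    intro i
    funext z
    rw [map_smul, smul_eq_mul]
    ring
  simp only [chartDvg, h1, pd_mul hf (smoothAt_dens_mul_coframe hv hy _)]
  rw [Finset.sum_add_distrib, mul_add, mvfderiv_eq_sum_pd hy]
  congr 1
  · rw [← Finset.mul_sum]
    ring
  · rw [Finset.mul_sum]
    refine Finset.sum_congr rfl fun i _ ↦ ?_
    have := (dens_pos (n := n) hy).ne'
    field_simp

theorem IsSmoothField.smul {v : (x : M) → TangentSpace (𝓡 n) x} (hv : IsSmoothField v)
    {f : M → ℝ} (hf : ∀ y, SmoothAt n f y) : IsSmoothField (fun z ↦ f z • v z) := by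
  refine isSmoothField_of_coframe fun x₀ y hy i ↦ ?_
  have h : (fun z ↦ coframe x₀ i z (f z • v z)) = fun z ↦ f z * coframe x₀ i z (v z) := by
    funext z
    rw [map_smul, smul_eq_mul]
  rw [h]
  exact (hf y).mul (hv.smoothAt_coframe hy i)

variable [MeasurableSpace M] [BorelSpace M]

/-- The divergence theorem inside one chart: the volume density cancels the factor `1/√det g` of the
divergence and leaves the Euclidean divergence of the components `√det g vⁱ`. -/
theorem setIntegral_mul_chartDvg {v : (x : M) → TangentSpace (𝓡 n) x} (hv : IsSmoothField v)
    {x₀ : M} {K : Set M} (hK : IsCompact K) (hKS : K ⊆ (chartAt (Euc n) x₀).source)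
    (hvK : ∀ y ∉ K, v y = 0) {ψ : M → ℝ} {V : Set (Euc n)} (hV : IsOpen V)
    (hKV : ∀ y ∈ K, extChartAt (𝓡 n) x₀ y ∈ V) {C : NNReal}
    (hψ : LipschitzOnWith C (ψ ∘ chartSymm n x₀) V) :
    IntegrableOn (fun y ↦ mvfderiv (𝓡 n) ψ y (v y)) (chartAt (Euc n) x₀).source (vol n M) ∧
    ∫ y in (chartAt (Euc n) x₀).source, ψ y * chartDvg x₀ v y ∂(vol n M) =
      - ∫ y in (chartAt (Euc n) x₀).source, mvfderiv (𝓡 n) ψ y (v y) ∂(vol n M) := by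
  classical
  -- A global Lipschitz extension of `ψ` in coordinates. It agrees with `ψ` only on `V`, which
  -- suffices since `v` vanishes outside `K`.
  obtain ⟨ψ', hψ', hψe⟩ := hψ.extend_real
  have hKs : K ⊆ (extChartAt (𝓡 n) x₀).source := by rwa [extChartAt_source]
  set K' := extChartAt (𝓡 n) x₀ '' K with hK'
  have hK'c : IsCompact K' := hK.image_of_continuousOn ((continuousOn_extChartAt x₀).mono hKs)
  have hK'T : K' ⊆ chartTarget n x₀ := by
    rintro _ ⟨y, hy, rfl⟩
    exact (extChartAt (𝓡 n) x₀).map_source (hKs hy)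
  have hK'V : K' ⊆ V := by
    rintro _ ⟨y, hy, rfl⟩
    exact hKV y hy
  have hvz : ∀ z ∈ chartTarget n x₀, z ∉ K' → v (chartSymm n x₀ z) = 0 := by
    intro z hz hzK
    refine hvK _ fun h ↦ hzK ⟨_, h, (extChartAt (𝓡 n) x₀).right_inv hz⟩
  -- Extension by zero stays smooth, because the components already vanish off the compact set `K'`
  -- inside the chart target.
  let F : Fin n → Euc n → ℝ := fun i ↦ (chartTarget n x₀).indicator
    fun z ↦ dens n x₀ (chartSymm n x₀ z) * coframe x₀ i (chartSymm n x₀ z) (v (chartSymm n x₀ z))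
  have hF0 : ∀ i, ∀ z ∉ K', F i z = 0 := by
    intro i z hz
    by_cases hzT : z ∈ chartTarget n x₀
    · simp only [F, indicator_of_mem hzT]
      rw [hvz z hzT hz, map_zero, mul_zero]
    · exact indicator_of_notMem hzT _
  have hFev : ∀ i, ∀ z ∈ chartTarget n x₀, F i =ᶠ[nhds z]
      (fun y ↦ dens n x₀ y * coframe x₀ i y (v y)) ∘ (extChartAt (𝓡 n) x₀).symm := by
    intro i z hz
    filter_upwards [(isOpen_chartTarget x₀).mem_nhds hz] with w hw
    simp only [F, indicator_of_mem hw]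
    rfl
  have hF0ev : ∀ i, ∀ z ∉ K', F i =ᶠ[nhds z] fun _ ↦ 0 := by
    intro i z hz
    filter_upwards [hK'c.isClosed.isOpen_compl.mem_nhds hz] with w hw using hF0 i w hw
  have hFsm : ∀ i, ContDiff ℝ ∞ (F i) := by
    intro i
    rw [contDiff_iff_contDiffAt]
    intro z
    by_cases hz : z ∈ K'
    · refine ContDiffAt.congr_of_eventuallyEq ?_ (hFev i z (hK'T hz))
      have := (smoothAt_dens_mul_coframe hv (chartSymm_mem_source (hK'T hz)) i).chart
        (chartSymm_mem_source (hK'T hz))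
      rwa [(extChartAt (𝓡 n) x₀).right_inv (hK'T hz)] at this
    · exact contDiffAt_const.congr_of_eventuallyEq (hF0ev i z hz)
  have hFc : ∀ i, HasCompactSupport (F i) := fun i ↦
    HasCompactSupport.intro hK'c fun z hz ↦ hF0 i z hz
  obtain ⟨hint, heq⟩ := integral_lipschitz_mul_divergence hψ' hFsm hFc
  have hpdF : ∀ i, ∀ z ∈ chartTarget n x₀,
      pd x₀ i (fun y ↦ dens n x₀ y * coframe x₀ i y (v y)) (chartSymm n x₀ z) =
        fderiv ℝ (F i) z (EuclideanSpace.single i 1) := by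
    intro i z hz
    rw [pd_eq_fderiv_of_chart (chartSymm_mem_source hz), (extChartAt (𝓡 n) x₀).right_inv hz,
      (hFev i z hz).fderiv_eq]
  have hpdψ : ∀ i, ∀ z ∈ K', pd x₀ i ψ (chartSymm n x₀ z) =
      fderiv ℝ ψ' z (EuclideanSpace.single i 1) := by
    intro i z hz
    have hev : ψ ∘ (extChartAt (𝓡 n) x₀).symm =ᶠ[nhds z] ψ' := by
      filter_upwards [hV.mem_nhds (hK'V hz)] with w hw using hψe hw
    rw [pd_eq_fderiv_of_chart (chartSymm_mem_source (hK'T hz)),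
      (extChartAt (𝓡 n) x₀).right_inv (hK'T hz), hev.fderiv_eq]
  have hR : ∀ z ∈ chartTarget n x₀, dens n x₀ (chartSymm n x₀ z) *
      mvfderiv (𝓡 n) ψ (chartSymm n x₀ z) (v (chartSymm n x₀ z)) =
      ∑ i, F i z * fderiv ℝ ψ' z (EuclideanSpace.single i 1) := by
    intro z hz
    by_cases hzK : z ∈ K'
    · rw [mvfderiv_eq_sum_pd (chartSymm_mem_source hz), Finset.mul_sum]
      refine Finset.sum_congr rfl fun i _ ↦ ?_
      simp only [F, indicator_of_mem hz]
      rw [hpdψ i z hzK, mul_assoc]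
    · rw [hvz z hz hzK, map_zero, mul_zero]
      exact (Finset.sum_eq_zero fun i _ ↦ by rw [hF0 i z hzK, zero_mul]).symm
  have hL : ∀ z ∈ chartTarget n x₀, dens n x₀ (chartSymm n x₀ z) *
      (ψ (chartSymm n x₀ z) * chartDvg x₀ v (chartSymm n x₀ z)) =
      ψ' z * ∑ i, fderiv ℝ (F i) z (EuclideanSpace.single i 1) := by
    intro z hz
    have hd := (dens_pos (n := n) (chartSymm_mem_source hz)).ne'
    simp only [chartDvg, hpdF _ z hz]
    by_cases hzK : z ∈ K'
    · rw [← hψe (hK'V hzK)]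
      simp only [Function.comp_apply]
      field_simp
    · have : ∑ i, fderiv ℝ (F i) z (EuclideanSpace.single i 1) = 0 := by
        refine Finset.sum_eq_zero fun i _ ↦ ?_
        rw [(hF0ev i z hzK).fderiv_eq]
        simp
      rw [this]
      ring
  have hT := measurableSet_chartTarget (n := n) x₀
  constructor
  · rw [integrableOn_vol_iff]
    exact hint.integrableOn.congr_fun (fun z hz ↦ (hR z hz).symm) hT
  · rw [setIntegral_vol, setIntegral_vol, setIntegral_congr_fun hT hL,
      setIntegral_congr_fun hT hR, setIntegral_eq_integral_of_forall_compl_eq_zero,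
      setIntegral_eq_integral_of_forall_compl_eq_zero, heq]
    · intro z hz
      exact Finset.sum_eq_zero fun i _ ↦ by rw [hF0 i z fun h ↦ hz (hK'T h), zero_mul]
    · intro z hz
      rw [Finset.sum_eq_zero, mul_zero]
      intro i _
      rw [(hF0ev i z fun h ↦ hz (hK'T h)).fderiv_eq]
      simp

theorem setIntegral_chartDvg_eq_zero {v : (x : M) → TangentSpace (𝓡 n) x} (hv : IsSmoothField v)
    {x₀ : M} {K : Set M} (hK : IsCompact K) (hKS : K ⊆ (chartAt (Euc n) x₀).source)
    (hvK : ∀ y ∉ K, v y = 0) :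
    ∫ y in (chartAt (Euc n) x₀).source, chartDvg x₀ v y ∂(vol n M) = 0 := by
  have h := (setIntegral_mul_chartDvg hv hK hKS hvK isOpen_univ (fun _ _ ↦ mem_univ _)
    (ψ := fun _ ↦ (1 : ℝ)) (LipschitzWith.const' 1).lipschitzOnWith (C := 0)).2
  simpa [mvfderiv_const] using h

theorem continuous_of_eq_zero_off {f : M → ℝ} {K : Set M} (hK : IsClosed K)
    (h0 : ∀ y ∉ K, f y = 0) (hf : ∀ y ∈ K, ContinuousAt f y) : Continuous f := by
  rw [continuous_iff_continuousAt]
  intro y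
  by_cases hy : y ∈ K
  · exact hf y hy
  · refine (continuousAt_const (y := (0 : ℝ))).congr ?_
    filter_upwards [hK.isOpen_compl.mem_nhds hy] with z hz using (h0 z hz).symm

theorem mvfderiv_eq_zero_of_notMem_tsupport {f : M → ℝ} {y : M} (hy : y ∉ tsupport f)
    (w : TangentSpace (𝓡 n) y) : mvfderiv (𝓡 n) f y w = 0 := by
  rw [mvfderiv_congr (g := fun _ ↦ 0) (notMem_tsupport_iff_eventuallyEq.1 hy), mvfderiv_const]
  rfl

variable [T2Space M] [SigmaCompactSpace M]

/-- Integrate the product rule for `div (g v)`, whose integral is zero. The right side contains no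
chart, so this characterises the divergence weakly. -/
theorem integral_mul_chartDvg {v : (x : M) → TangentSpace (𝓡 n) x} (hv : IsSmoothField v)
    {x₀ : M} {g : M → ℝ} (hg : ∀ y, SmoothAt n g y) (hgc : HasCompactSupport g)
    (hgS : tsupport g ⊆ (chartAt (Euc n) x₀).source) :
    Integrable (fun y ↦ g y * chartDvg x₀ v y) (vol n M) ∧
    ∫ y, g y * chartDvg x₀ v y ∂(vol n M) = - ∫ y, mvfderiv (𝓡 n) g y (v y) ∂(vol n M) := by
  have hg0 : ∀ y ∉ tsupport g, g y = 0 := fun y hy ↦ image_eq_zero_of_notMem_tsupport hy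
  have hcont : Continuous fun y ↦ g y * chartDvg x₀ v y := by
    refine continuous_of_eq_zero_off (isClosed_tsupport g) (fun y hy ↦ ?_) fun y hy ↦ ?_
    · rw [hg0 y hy, zero_mul]
    · exact (hg y).continuousAt.mul (smoothAt_chartDvg hv (hgS hy)).continuousAt
  have hint : Integrable (fun y ↦ g y * chartDvg x₀ v y) (vol n M) :=
    hcont.integrable_of_hasCompactSupport (HasCompactSupport.mul_right hgc)
  refine ⟨hint, ?_⟩
  have h1 := setIntegral_chartDvg_eq_zero (hv.smul hg) hgc hgS (fun y hy ↦ by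
    rw [hg0 y hy, zero_smul])
  have h2 : ∀ y ∈ (chartAt (Euc n) x₀).source, chartDvg x₀ (fun z ↦ g z • v z) y =
      g y * chartDvg x₀ v y + mvfderiv (𝓡 n) g y (v y) := fun y hy ↦ chartDvg_smul hv hy (hg y)
  have h3 : Continuous fun y ↦ mvfderiv (𝓡 n) g y (v y) := by
    refine continuous_iff_continuousAt.2 fun y ↦ ?_
    have hy := mem_chart_source (Euc n) y
    have : SmoothAt n (fun z ↦ ∑ i, coframe y i z (v z) * pd y i g z) y :=
      SmoothAt.sum fun i _ ↦ (hv.smoothAt_coframe hy i).mul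
        (SmoothAt.pd (chartAt (Euc n) y).open_source Subset.rfl (fun z _ ↦ hg z) hy i)
    refine this.continuousAt.congr ?_
    filter_upwards [(chartAt (Euc n) y).open_source.mem_nhds hy] with z hz
    exact (mvfderiv_eq_sum_pd hz g (v z)).symm
  have h4 : Integrable (fun y ↦ mvfderiv (𝓡 n) g y (v y)) (vol n M) := by
    refine h3.integrable_of_hasCompactSupport ?_
    exact HasCompactSupport.intro hgc fun y hy ↦ mvfderiv_eq_zero_of_notMem_tsupport hy _
  rw [setIntegral_congr_fun (measurableSet_source x₀) h2,
    integral_add hint.integrableOn h4.integrableOn,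
    setIntegral_eq_integral_of_forall_compl_eq_zero,
    setIntegral_eq_integral_of_forall_compl_eq_zero] at h1
  · linarith
  · exact fun y hy ↦ mvfderiv_eq_zero_of_notMem_tsupport (fun h ↦ hy (hgS h)) _
  · intro y hy
    rw [hg0 y fun h ↦ hy (hgS h), zero_mul]

/-- A weak argument replaces the transformation law: on the overlap both functions have the same
integrals against all test functions, so they agree almost everywhere there, and by continuity
everywhere. -/
theorem chartDvg_eq_chartDvg {v : (x : M) → TangentSpace (𝓡 n) x} (hv : IsSmoothField v)
    {x₀ x₁ y : M} (hy₀ : y ∈ (chartAt (Euc n) x₀).source)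
    (hy₁ : y ∈ (chartAt (Euc n) x₁).source) : chartDvg x₀ v y = chartDvg x₁ v y := by
  have hWo : IsOpen ((chartAt (Euc n) x₀).source ∩ (chartAt (Euc n) x₁).source) :=
    (chartAt (Euc n) x₀).open_source.inter (chartAt (Euc n) x₁).open_source
  have hc : ContinuousOn (fun z ↦ chartDvg x₀ v z - chartDvg x₁ v z)
      ((chartAt (Euc n) x₀).source ∩ (chartAt (Euc n) x₁).source) := fun z hz ↦
    ((smoothAt_chartDvg hv hz.1).continuousAt.sub
      (smoothAt_chartDvg hv hz.2).continuousAt).continuousWithinAt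
  have hae := hWo.ae_eq_zero_of_integral_contMDiff_smul_eq_zero (𝓡 n) (μ := vol n M)
    (hc.locallyIntegrableOn hWo.measurableSet) (fun g hg hgc hgW ↦ by
      obtain ⟨hi₀, he₀⟩ := integral_mul_chartDvg hv (x₀ := x₀) (fun z ↦ hg z) hgc
        (hgW.trans inter_subset_left)
      obtain ⟨hi₁, he₁⟩ := integral_mul_chartDvg hv (x₀ := x₁) (fun z ↦ hg z) hgc
        (hgW.trans inter_subset_right)
      simp only [smul_eq_mul, mul_sub]
      rw [integral_sub hi₀ hi₁, he₀, he₁, sub_self])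
  by_contra hne
  have hopen : IsOpen (((chartAt (Euc n) x₀).source ∩ (chartAt (Euc n) x₁).source) ∩
      (fun z ↦ chartDvg x₀ v z - chartDvg x₁ v z) ⁻¹' {0}ᶜ) :=
    hc.isOpen_inter_preimage hWo isOpen_compl_singleton
  refine (hopen.measure_pos (vol n M) ⟨y, ⟨hy₀, hy₁⟩, sub_ne_zero.2 hne⟩).ne' ?_
  rw [ae_iff] at hae
  refine measure_mono_null (fun z hz ↦ ?_) hae
  simp only [mem_ofPred_eq, Classical.not_imp]
  exact ⟨hz.1, hz.2⟩

theorem dvg_eq_chartDvg {v : (x : M) → TangentSpace (𝓡 n) x} (hv : IsSmoothField v)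
    {x₀ y : M} (hy : y ∈ (chartAt (Euc n) x₀).source) : dvg v y = chartDvg x₀ v y :=
  chartDvg_eq_chartDvg hv (mem_chart_source _ y) hy

theorem smoothAt_dvg {v : (x : M) → TangentSpace (𝓡 n) x} (hv : IsSmoothField v) (y : M) :
    SmoothAt n (dvg v) y := by
  have hy := mem_chart_source (Euc n) y
  refine (smoothAt_chartDvg hv hy).congr_of_eventuallyEq ?_
  filter_upwards [(chartAt (Euc n) y).open_source.mem_nhds hy] with z hz
  exact dvg_eq_chartDvg hv hz

theorem dvg_smul {v : (x : M) → TangentSpace (𝓡 n) x} (hv : IsSmoothField v)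
    {f : M → ℝ} {y : M} (hf : SmoothAt n f y) :
    dvg (fun z ↦ f z • v z) y = f y * dvg v y + mvfderiv (𝓡 n) f y (v y) :=
  chartDvg_smul hv (mem_chart_source _ y) hf

/-- A function on `M` that is locally Lipschitz when read in the preferred charts. -/
def LipschitzInCharts (n : ℕ) {M : Type*} [TopologicalSpace M] [ChartedSpace (Euc n) M]
    (ψ : M → ℝ) : Prop :=
  ∀ x : M, ∃ V : Set (Euc n), IsOpen V ∧ extChartAt (𝓡 n) x x ∈ V ∧
    ∃ C : NNReal, LipschitzOnWith C (ψ ∘ chartSymm n x) V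

theorem exists_isOpen_mem_relatively_compact (x : M) {V : Set (Euc n)} (hV : IsOpen V)
    (hx : extChartAt (𝓡 n) x x ∈ V) : ∃ U : Set M, IsOpen U ∧ x ∈ U ∧ ∃ K, IsCompact K ∧
      U ⊆ K ∧ K ⊆ (chartAt (Euc n) x).source ∧ ∀ y ∈ K, extChartAt (𝓡 n) x y ∈ V := by
  have hT : chartTarget n x ∩ V ∈ nhds (extChartAt (𝓡 n) x x) :=
    Filter.inter_mem (extChartAt_target_mem_nhds x) (hV.mem_nhds hx)
  obtain ⟨L, hL, hLT, hLc⟩ := local_compact_nhds hT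
  refine ⟨(chartAt (Euc n) x).source ∩ extChartAt (𝓡 n) x ⁻¹' interior L, ?_, ?_,
    chartSymm n x '' L, ?_, ?_, ?_, ?_⟩
  · have := (continuousOn_extChartAt (I := 𝓡 n) x).isOpen_inter_preimage
      (isOpen_extChartAt_source x) (isOpen_interior (s := L))
    rwa [extChartAt_source] at this
  · exact ⟨mem_chart_source _ x, mem_interior_iff_mem_nhds.2 hL⟩
  · exact hLc.image_of_continuousOn ((continuousOn_chartSymm x).mono
      (hLT.trans inter_subset_left))
  · rintro y ⟨hy, hyL⟩
    refine ⟨extChartAt (𝓡 n) x y, interior_subset hyL, (extChartAt (𝓡 n) x).left_inv ?_⟩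
    rwa [extChartAt_source]
  · rintro _ ⟨z, hz, rfl⟩
    exact chartSymm_mem_source (hLT hz).1
  · rintro _ ⟨z, hz, rfl⟩
    rw [chartSymm, (extChartAt (𝓡 n) x).right_inv (hLT hz).1]
    exact (hLT hz).2

/-- The vector field, not `ψ`, is cut up by a smooth partition of unity: each piece `ρᵢ v` is smooth
and supported in one chart, so the local theorem applies with the same Lipschitz `ψ`. -/
theorem integral_mul_dvg {v : (x : M) → TangentSpace (𝓡 n) x} (hv : IsSmoothField v)
    {ψ : M → ℝ} (hψc : HasCompactSupport ψ) (hψ : LipschitzInCharts n ψ) (hψcont : Continuous ψ) :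
    Integrable (fun y ↦ mvfderiv (𝓡 n) ψ y (v y)) (vol n M) ∧
    ∫ y, ψ y * dvg v y ∂(vol n M) = - ∫ y, mvfderiv (𝓡 n) ψ y (v y) ∂(vol n M) := by
  choose V hVo hxV C hC using hψ
  choose U hUo hxU K hKc hUK hKS hKV using fun x ↦
    exists_isOpen_mem_relatively_compact x (hVo x) (hxV x)
  obtain ⟨ρ, hρ⟩ := SmoothPartitionOfUnity.exists_isSubordinate (𝓡 n) (isClosed_univ (X := M)) U hUo
    (fun x _ ↦ mem_iUnion.2 ⟨x, hxU x⟩)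
  have hρsm : ∀ i y, SmoothAt n (ρ i) y := fun i y ↦ (ρ i).contMDiff y
  have hρ0 : ∀ i, ∀ y ∉ K i, ρ i y = 0 := fun i y hy ↦
    image_eq_zero_of_notMem_tsupport fun h ↦ hy (hUK i (hρ i h))
  -- Finitely many pieces suffice on the compact support of `ψ`. Their sum is 1 on a neighbourhood
  -- of each point, so its derivative vanishes there.
  obtain ⟨s, hs⟩ : ∃ s : Finset M, ∀ y ∈ tsupport ψ, ∀ᶠ z in nhds y, ∑ i ∈ s, ρ i z = 1 := by
    classical
    obtain ⟨t, -, ht⟩ := hψc.isCompact.elim_nhds_subcover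
      (fun y ↦ interior {z | ρ.finsupport z ⊆ ρ.fintsupport y})
      (fun y _ ↦ interior_mem_nhds.2 (ρ.eventually_finsupport_subset y))
    refine ⟨t.biUnion fun y ↦ ρ.fintsupport y, fun y hy ↦ ?_⟩
    obtain ⟨w, hw, hyw⟩ := mem_iUnion₂.1 (ht hy)
    filter_upwards [isOpen_interior.mem_nhds hyw] with z hz
    exact ρ.sum_finsupport' z (mem_univ z)
      ((interior_subset hz : ρ.finsupport z ⊆ ρ.fintsupport w).trans
        (Finset.subset_biUnion_of_mem (fun y ↦ ρ.fintsupport y) hw))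
  have hvi : ∀ i, IsSmoothField fun y ↦ ρ i y • v y := fun i ↦ hv.smul (hρsm i)
  have hvi0 : ∀ i, ∀ y ∉ K i, ρ i y • v y = 0 := fun i y hy ↦ by rw [hρ0 i y hy, zero_smul]
  have hloc := fun i ↦ setIntegral_mul_chartDvg (hvi i) (hKc i) (hKS i) (hvi0 i) (hVo i) (hKV i)
    (hC i)
  have hdv0 : ∀ i, ∀ y ∉ K i, dvg (fun z ↦ ρ i z • v z) y = 0 := by
    intro i y hy
    have hy' : y ∉ tsupport (ρ i) := fun h ↦ hy (hUK i (hρ i h))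
    rw [dvg_smul hv (hρsm i y), hρ0 i y hy, zero_mul, zero_add,
      mvfderiv_eq_zero_of_notMem_tsupport hy']
  have hI : ∀ i, Integrable (fun y ↦ mvfderiv (𝓡 n) ψ y (ρ i y • v y)) (vol n M) := by
    intro i
    refine (integrableOn_iff_integrable_of_support_subset fun y hy ↦ ?_).1 (hloc i).1
    by_contra h
    refine hy ?_
    change mvfderiv (𝓡 n) ψ y (ρ i y • v y) = 0
    rw [hvi0 i y fun hK ↦ h (hKS i hK), map_zero]
  have hE : ∀ i, ∫ y, ψ y * dvg (fun z ↦ ρ i z • v z) y ∂(vol n M) =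
      - ∫ y, mvfderiv (𝓡 n) ψ y (ρ i y • v y) ∂(vol n M) := by
    intro i
    rw [← setIntegral_eq_integral_of_forall_compl_eq_zero (s := (chartAt (Euc n) i).source),
      ← setIntegral_eq_integral_of_forall_compl_eq_zero (s := (chartAt (Euc n) i).source)
        (f := fun y ↦ mvfderiv (𝓡 n) ψ y (ρ i y • v y)), ← (hloc i).2]
    · refine setIntegral_congr_fun (measurableSet_source i) fun y hy ↦ ?_
      rw [dvg_eq_chartDvg (hvi i) hy]
    · intro y hy
      rw [hvi0 i y fun hK ↦ hy (hKS i hK), map_zero]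
    · intro y hy
      rw [hdv0 i y fun hK ↦ hy (hKS i hK), mul_zero]
  have hψ0 : ∀ y ∉ tsupport ψ, ψ y = 0 := fun y hy ↦ image_eq_zero_of_notMem_tsupport hy
  have hsumR : ∀ y, mvfderiv (𝓡 n) ψ y (v y) = ∑ i ∈ s, mvfderiv (𝓡 n) ψ y (ρ i y • v y) := by
    intro y
    simp only [map_smul, ← Finset.sum_smul]
    by_cases hy : y ∈ tsupport ψ
    · rw [(hs y hy).self_of_nhds, one_smul]
    · rw [mvfderiv_eq_zero_of_notMem_tsupport hy, smul_zero]
  have hsumL : ∀ y, ψ y * dvg v y = ∑ i ∈ s, ψ y * dvg (fun z ↦ ρ i z • v z) y := by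
    intro y
    by_cases hy : y ∈ tsupport ψ
    · rw [← Finset.mul_sum]
      simp only [dvg_smul hv (hρsm _ y)]
      rw [Finset.sum_add_distrib, ← Finset.sum_mul, (hs y hy).self_of_nhds, one_mul]
      have h0 : ∑ i ∈ s, mvfderiv (𝓡 n) (ρ i) y (v y) = 0 := by
        have h1 : mvfderiv (𝓡 n) (fun z ↦ ∑ i ∈ s, ρ i z) y (v y) = 0 := by
          rw [mvfderiv_congr (hs y hy), mvfderiv_const]
          rfl
        have hyS := mem_chart_source (Euc n) y
        rw [mvfderiv_eq_sum_pd hyS] at h1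
        simp only [mvfderiv_eq_sum_pd hyS]
        rw [Finset.sum_comm, ← h1]
        refine Finset.sum_congr rfl fun j _ ↦ ?_
        rw [pd_sum s (fun i _ ↦ hρsm i y), Finset.mul_sum]
      rw [h0, add_zero]
    · simp [hψ0 y hy]
  refine ⟨(integrable_finsetSum s fun i _ ↦ hI i).congr
    (Filter.Eventually.of_forall fun y ↦ (hsumR y).symm), ?_⟩
  simp only [hsumR, hsumL]
  rw [integral_finsetSum s fun i _ ↦ hI i, integral_finsetSum, ← Finset.sum_neg_distrib]
  · exact Finset.sum_congr rfl fun i _ ↦ hE i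
  · intro i _
    have hc : Continuous fun y ↦ ψ y * dvg (fun z ↦ ρ i z • v z) y :=
      hψcont.mul (continuous_iff_continuousAt.2 fun y ↦ (smoothAt_dvg (hvi i) y).continuousAt)
    exact hc.integrable_of_hasCompactSupport (HasCompactSupport.mul_right hψc)

end ChartDivergence

/-! ### Compactness of closed balls in complete, locally compact length spaces. -/

section LengthSpace

/-- An extended metric space in which the distance between two points can be split arbitrarily,
up to an arbitrarily small error. -/
def HasApproxSplitting (X : Type*) [EMetricSpace X] : Prop :=
  ∀ (x y : X) (r : NNReal) (s : ℝ≥0∞), edist x y < r + s → 0 < s →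
    ∃ z, edist x z ≤ r ∧ edist z y < s

variable {X : Type*} [EMetricSpace X]

/-- Every point of the ball of radius `R` is close to a slightly smaller ball, which is compact. A
finite net of the smaller ball is therefore a coarser net of the larger one. -/
theorem HasApproxSplitting.isCompact_closedEBall_of_forall_lt [CompleteSpace X]
    (hX : HasApproxSplitting X) (x : X) {R : NNReal}
    (h : ∀ r < R, IsCompact (Metric.closedEBall x (r : ℝ≥0∞))) :
    IsCompact (Metric.closedEBall x (R : ℝ≥0∞)) := by
  rcases eq_zero_or_pos R with rfl | hR
  · rw [ENNReal.coe_zero, Metric.closedEBall_zero]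
    exact isCompact_singleton
  rw [isCompact_iff_totallyBounded_isComplete]
  refine ⟨EMetric.totallyBounded_iff.2 fun ε hε ↦ ?_, Metric.isClosed_closedEBall.isComplete⟩
  obtain ⟨δ, hδ, hδε⟩ := ENNReal.lt_iff_exists_nnreal_btwn.1 hε
  have hδ0 : 0 < δ := by exact_mod_cast hδ
  -- The net contributes `δ/3` and the splitting `2δ/3`, together `δ < ε`. Truncated subtraction
  -- does no harm if `R < δ/3`, as only `R ≤ (R - δ/3) + δ/3` is used.
  obtain ⟨t, ht, hcov⟩ := EMetric.totallyBounded_iff.1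
    (h (R - δ / 3) (tsub_lt_self hR (by positivity))).totallyBounded ((δ / 3 : NNReal) : ℝ≥0∞)
    (by exact_mod_cast (by positivity : 0 < δ / 3))
  refine ⟨t, ht, fun y hy ↦ ?_⟩
  obtain ⟨z, hxz, hzy⟩ := hX x y (R - δ / 3) ((2 * (δ / 3) : NNReal) : ℝ≥0∞) (by
    rw [edist_comm]
    refine lt_of_le_of_lt hy ?_
    have h1 : R < R - δ / 3 + 2 * (δ / 3) := by
      have h2 : R ≤ R - δ / 3 + δ / 3 := le_tsub_add
      have h3 : 0 < δ / 3 := by positivity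
      calc R ≤ R - δ / 3 + δ / 3 := h2
        _ < R - δ / 3 + δ / 3 + δ / 3 := lt_add_of_pos_right _ h3
        _ = _ := by ring
    exact_mod_cast h1) (by exact_mod_cast (by positivity : 0 < 2 * (δ / 3)))
  obtain ⟨p, hp, hzp⟩ := mem_iUnion₂.1 (hcov (show z ∈ Metric.closedEBall x _ by
    rwa [Metric.mem_closedEBall, edist_comm]))
  refine mem_iUnion₂.2 ⟨p, hp, ?_⟩
  rw [Metric.mem_eball] at hzp ⊢
  refine lt_trans ?_ hδε
  calc edist y p ≤ edist y z + edist z p := edist_triangle _ _ _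
    _ < ((2 * (δ / 3) : NNReal) : ℝ≥0∞) + ((δ / 3 : NNReal) : ℝ≥0∞) := by
        rw [edist_comm y z]
        exact ENNReal.add_lt_add hzy hzp
    _ = δ := by
        rw [← ENNReal.coe_add]
        congr 1
        ring

/-- The ball whose radius is the infimum of the bad radii is compact by the preceding lemma. Local
compactness gives it a compact neighbourhood containing a `δ`-thickening, so all radii below the
infimum plus `δ` are good, a contradiction. -/
theorem HasApproxSplitting.isCompact_closedEBall [CompleteSpace X] [LocallyCompactSpace X]
    (hX : HasApproxSplitting X) (x : X) (r : NNReal) :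
    IsCompact (Metric.closedEBall x (r : ℝ≥0∞)) := by
  by_contra hr
  set S : Set NNReal := {r | ¬ IsCompact (Metric.closedEBall x (r : ℝ≥0∞))} with hS
  have hK := hX.isCompact_closedEBall_of_forall_lt x (R := sInf S) fun r hr ↦
    not_not.1 (notMem_of_lt_csInf hr (OrderBot.bddBelow S))
  obtain ⟨K, hKc, hK'⟩ := exists_compact_superset hK
  obtain ⟨δ, hδ, hth⟩ := hK.exists_thickening_subset_open isOpen_interior hK'
  lift δ to NNReal using hδ.le
  have hδ0 : 0 < δ := hδ
  obtain ⟨s, hs, hsδ⟩ := exists_lt_of_csInf_lt (s := S) ⟨r, hr⟩ (lt_add_of_pos_right (sInf S) hδ0)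
  refine hs (hKc.of_isClosed_subset Metric.isClosed_closedEBall fun y hy ↦ ?_)
  obtain ⟨z, hxz, hzy⟩ := hX x y (sInf S) (δ : ℝ≥0∞) (by
    rw [edist_comm]
    refine lt_of_le_of_lt hy ?_
    exact_mod_cast hsδ) (by exact_mod_cast hδ0)
  refine interior_subset (hth ?_)
  rw [Metric.mem_thickening_iff_infEDist_lt, ENNReal.ofReal_coe_nnreal, Metric.infEDist_lt_iff]
  exact ⟨z, by rwa [Metric.mem_closedEBall, edist_comm], by rwa [edist_comm]⟩

end LengthSpace

/-! ### The Riemannian distance and compact balls. -/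

section Distance

variable {n : ℕ} {M : Type*} [EMetricSpace M] [ChartedSpace (Euc n) M]
  [IsManifold (𝓡 n) ∞ M] [RiemannianBundle (fun x : M ↦ TangentSpace (𝓡 n) x)]
  [IsRiemannianManifold (𝓡 n) M]

theorem edist_le_pathELength {γ : ℝ → M} {a b : ℝ} (hab : a ≤ b)
    (hγ : ContMDiffOn 𝓘(ℝ, ℝ) (𝓡 n) 1 γ (Icc a b)) :
    edist (γ a) (γ b) ≤ pathELength (𝓡 n) γ a b := by
  rw [IsRiemannianManifold.out (I := 𝓡 n) (γ a) (γ b)]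
  exact riemannianEDist_le_pathELength hγ rfl rfl hab

/-- Cut a nearly shortest curve where its distance from `x` equals `r`, by the intermediate value
theorem. The first arc has length at least `r`, which leaves less than `s` for the second. -/
theorem hasApproxSplitting (n : ℕ) (M : Type*) [EMetricSpace M] [ChartedSpace (Euc n) M]
    [IsManifold (𝓡 n) ∞ M] [RiemannianBundle (fun x : M ↦ TangentSpace (𝓡 n) x)]
    [IsRiemannianManifold (𝓡 n) M] : HasApproxSplitting M := by
  intro x y r s h hs
  rcases le_or_gt (edist x y) r with hr | hr
  · exact ⟨y, hr, by rwa [edist_self]⟩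
  rw [IsRiemannianManifold.out (I := 𝓡 n) x y] at h
  obtain ⟨γ, rfl, rfl, hγ, hlen⟩ := exists_lt_of_riemannianEDist_lt h
  have hc : ContinuousOn (fun t ↦ edist (γ 0) (γ t)) (Icc 0 1) :=
    (continuous_const.edist continuous_id).comp_continuousOn hγ.continuousOn
  obtain ⟨t, ht, hrt⟩ := intermediate_value_Icc (zero_le_one' ℝ) hc
    (show (r : ℝ≥0∞) ∈ Icc _ _ from ⟨by simp, hr.le⟩)
  refine ⟨γ t, hrt.le, ?_⟩
  have h1 := edist_le_pathELength ht.1 (hγ.mono (Icc_subset_Icc_right ht.2))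
  have h2 := edist_le_pathELength ht.2 (hγ.mono (Icc_subset_Icc_left ht.1))
  rw [← pathELength_add ht.1 ht.2] at hlen
  have h3 : (r : ℝ≥0∞) + edist (γ t) (γ 1) < r + s :=
    lt_of_le_of_lt (add_le_add (hrt.ge.trans h1) h2) hlen
  exact lt_of_add_lt_add_left h3

theorem isCompact_closedEBall (n : ℕ) {M : Type*} [EMetricSpace M] [ChartedSpace (Euc n) M]
    [IsManifold (𝓡 n) ∞ M] [RiemannianBundle (fun x : M ↦ TangentSpace (𝓡 n) x)]
    [IsRiemannianManifold (𝓡 n) M] [CompleteSpace M] (x : M) (r : NNReal) :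
    IsCompact (Metric.closedEBall x (r : ℝ≥0∞)) :=
  haveI : LocallyCompactSpace M := Manifold.locallyCompact_of_finiteDimensional (𝓡 n)
  (hasApproxSplitting n M).isCompact_closedEBall x r

end Distance

/-! ### Lengths of coordinate segments. -/

section ChartMetric

variable {n : ℕ} {M : Type*} [TopologicalSpace M] [ChartedSpace (Euc n) M]
  [IsManifold (𝓡 n) ∞ M] [RiemannianBundle (fun x : M ↦ TangentSpace (𝓡 n) x)]

/-- The squared length at `y` of the tangent vector with coordinates `u` in the preferred chart
at `x₀`. -/
def gramSq (x₀ y : M) (u : Euc n) : ℝ := ∑ i, ∑ j, u i * u j * gram x₀ y i j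

theorem norm_symmL_sq (x₀ y : M) (u : Euc n) :
    ‖(trivializationAt (Euc n) (TangentSpace (𝓡 n)) x₀).symmL ℝ y u‖ ^ 2 = gramSq x₀ y u := by
  have hu : u = ∑ i, u i • EuclideanSpace.single i (1 : ℝ) := by
    ext i
    simp [WithLp.ofLp_sum, Pi.single_apply]
  have h : (trivializationAt (Euc n) (TangentSpace (𝓡 n)) x₀).symmL ℝ y u
      = ∑ i, u i • frame x₀ i y := by
    conv_lhs => rw [hu]
    rw [map_sum]
    exact Finset.sum_congr rfl fun i _ ↦ map_smul _ _ _
  rw [← real_inner_self_eq_norm_sq, h, sum_inner]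
  refine Finset.sum_congr rfl fun i _ ↦ ?_
  rw [inner_sum]
  refine Finset.sum_congr rfl fun j _ ↦ ?_
  rw [real_inner_smul_left, real_inner_smul_right, mul_assoc]
  rfl

theorem gramSq_smul (x₀ y : M) (t : ℝ) (u : Euc n) :
    gramSq x₀ y (t • u) = t ^ 2 * gramSq x₀ y u := by
  simp only [gramSq, Finset.mul_sum, PiLp.smul_apply, smul_eq_mul]
  exact Finset.sum_congr rfl fun i _ ↦ Finset.sum_congr rfl fun j _ ↦ by ring

theorem norm_mfderivWithin_chartSymm_sq {x₀ : M} {z : Euc n} (hz : z ∈ chartTarget n x₀)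
    (u : Euc n) :
    ‖mfderivWithin 𝓘(ℝ, Euc n) (𝓡 n) (chartSymm n x₀) (range (𝓡 n)) z u‖ ^ 2
      = gramSq x₀ (chartSymm n x₀ z) u := by
  rw [← norm_symmL_sq]
  have h1 := TangentBundle.symmL_trivializationAt (I := 𝓡 n)
    (show chartSymm n x₀ z ∈ (chartAt (Euc n) x₀).source by
      have := (extChartAt (𝓡 n) x₀).map_target hz
      rwa [extChartAt_source] at this)
  have h2 : (trivializationAt (Euc n) (TangentSpace (𝓡 n)) x₀).symmL ℝ (chartSymm n x₀ z) u
      = mfderivWithin 𝓘(ℝ, Euc n) (𝓡 n) (chartSymm n x₀) (range (𝓡 n)) z u := by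
    refine (congrArg (fun L : Euc n →L[ℝ] Euc n ↦ L u) h1).trans ?_
    exact congrArg (fun q ↦ (mfderivWithin 𝓘(ℝ, Euc n) (𝓡 n) (chartSymm n x₀) (range (𝓡 n)) q :
      Euc n →L[ℝ] Euc n) u) ((extChartAt (𝓡 n) x₀).right_inv hz)
  rw [h2]

/-- The image of a coordinate segment has constant coordinate velocity `z' - z`, so its speed is the
square root of `gramSq`. -/
theorem pathELength_chartSymm_lineMap_le {x₀ : M} {z z' : Euc n} {c : ℝ} (hc : 0 ≤ c)
    (hzz' : ∀ t ∈ Icc (0 : ℝ) 1, AffineMap.lineMap z z' t ∈ chartTarget n x₀)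
    (hb : ∀ t ∈ Icc (0 : ℝ) 1,
      gramSq x₀ (chartSymm n x₀ (AffineMap.lineMap z z' t)) (z' - z) ≤ c ^ 2) :
    pathELength (𝓡 n) (chartSymm n x₀ ∘ AffineMap.lineMap z z') 0 1 ≤ ENNReal.ofReal c := by
  let η : ℝ → Euc n := AffineMap.lineMap z z'
  have hη : ∀ t, HasDerivAt η (z' - z) t := fun t ↦ AffineMap.hasDerivAt_lineMap
  rw [pathELength_eq_lintegral_mfderivWithin_Icc]
  have hle : ∀ t ∈ Icc (0 : ℝ) 1, ‖mfderivWithin 𝓘(ℝ, ℝ) (𝓡 n)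
      (chartSymm n x₀ ∘ AffineMap.lineMap z z') (Icc 0 1) t 1‖ₑ ≤ ENNReal.ofReal c := by
    intro t ht
    have h1 : mfderivWithin 𝓘(ℝ, ℝ) (𝓡 n) (chartSymm n x₀ ∘ η) (Icc 0 1) t =
        (mfderivWithin 𝓘(ℝ, Euc n) (𝓡 n) (chartSymm n x₀) (range (𝓡 n)) (η t)) ∘L
          (mfderivWithin 𝓘(ℝ, ℝ) 𝓘(ℝ, Euc n) η (Icc 0 1) t) := by
      apply mfderivWithin_comp
      · exact mdifferentiableWithinAt_extChartAt_symm (hzz' t ht)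
      · exact (hη t).differentiableAt.mdifferentiableAt.mdifferentiableWithinAt
      · intro s _
        simp
      · rw [uniqueMDiffWithinAt_iff_uniqueDiffWithinAt]
        exact uniqueDiffOn_Icc zero_lt_one t ht
    have h2 : mfderivWithin 𝓘(ℝ, ℝ) 𝓘(ℝ, Euc n) η (Icc 0 1) t 1 = z' - z := by
      rw [mfderivWithin_eq_fderivWithin]
      change fderivWithin ℝ η (Icc 0 1) t 1 = z' - z
      rw [(hη t).hasFDerivAt.hasFDerivWithinAt.fderivWithin (uniqueDiffOn_Icc zero_lt_one t ht)]
      simp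
    have h3 : mfderivWithin 𝓘(ℝ, ℝ) (𝓡 n) (chartSymm n x₀ ∘ η) (Icc 0 1) t 1 =
        (mfderivWithin 𝓘(ℝ, Euc n) (𝓡 n) (chartSymm n x₀) (range (𝓡 n)) (η t)) (z' - z) := by
      refine (congr($h1 1)).trans ?_
      exact congrArg (mfderivWithin 𝓘(ℝ, Euc n) (𝓡 n) (chartSymm n x₀) (range (𝓡 n)) (η t)) h2
    have h4 := norm_mfderivWithin_chartSymm_sq (hzz' t ht) (z' - z)
    change ‖mfderivWithin 𝓘(ℝ, ℝ) (𝓡 n) (chartSymm n x₀ ∘ η) (Icc 0 1) t 1‖ₑ ≤ _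
    rw [h3, ← ofReal_norm]
    refine ENNReal.ofReal_le_ofReal (le_of_sq_le_sq ?_ hc)
    exact h4.le.trans (hb t ht)
  refine (setLIntegral_mono' measurableSet_Icc hle).trans ?_
  simp

end ChartMetric

/-! ### Lipschitz functions for the Riemannian distance, seen in charts. -/

section LipschitzFunctions

variable {n : ℕ} {M : Type*} [EMetricSpace M] [ChartedSpace (Euc n) M]
  [IsManifold (𝓡 n) ∞ M] [RiemannianBundle (fun x : M ↦ TangentSpace (𝓡 n) x)]
  [IsContMDiffRiemannianBundle (𝓡 n) ∞ (Euc n) (fun x : M ↦ TangentSpace (𝓡 n) x)]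

theorem continuousOn_gram_chartSymm (x₀ : M) (i j : Fin n) :
    ContinuousOn (fun z ↦ gram x₀ (chartSymm n x₀ z) i j) (chartTarget n x₀) := by
  intro z hz
  have hz' : chartSymm n x₀ z ∈ (chartAt (Euc n) x₀).source := by
    have := (extChartAt (𝓡 n) x₀).map_target hz
    rwa [extChartAt_source] at this
  exact (smoothAt_gram hz' i j).continuousAt.comp_continuousWithinAt
    (continuousOn_extChartAt_symm x₀ z hz)

theorem continuousOn_gramSq_chartSymm (x₀ : M) (u : Euc n) :
    ContinuousOn (fun z ↦ gramSq x₀ (chartSymm n x₀ z) u) (chartTarget n x₀) :=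
  continuousOn_finsetSum _ fun i _ ↦ continuousOn_finsetSum _ fun j _ ↦
    continuousOn_const.mul (continuousOn_gram_chartSymm x₀ i j)

variable [IsRiemannianManifold (𝓡 n) M]

theorem edist_chartSymm_le {x₀ : M} {V : Set (Euc n)} (hV : Convex ℝ V)
    (hVT : V ⊆ chartTarget n x₀) {z z' : Euc n} (hz : z ∈ V) (hz' : z' ∈ V) {c : ℝ} (hc : 0 ≤ c)
    (hb : ∀ p ∈ V, gramSq x₀ (chartSymm n x₀ p) (z' - z) ≤ c ^ 2) :
    edist (chartSymm n x₀ z) (chartSymm n x₀ z') ≤ ENNReal.ofReal c := by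
  have hmem : ∀ t ∈ Icc (0 : ℝ) 1, AffineMap.lineMap z z' t ∈ V := fun t ht ↦
    hV.lineMap_mem hz hz' ht
  refine le_trans ?_ (pathELength_chartSymm_lineMap_le hc (fun t ht ↦ hVT (hmem t ht))
    fun t ht ↦ hb _ (hmem t ht))
  have hγ : ContMDiffOn 𝓘(ℝ, ℝ) (𝓡 n) 1 (chartSymm n x₀ ∘ AffineMap.lineMap z z')
      (Icc (0 : ℝ) 1) := by
    refine (contMDiffOn_extChartAt_symm (n := 1) x₀).comp (t := chartTarget n x₀) ?_
      fun t ht ↦ hVT (hmem t ht)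
    exact (contMDiff_iff_contDiff.2
      (ContinuousAffineMap.lineMap (R := ℝ) z z').contDiff).contMDiffOn
  have := edist_le_pathELength zero_le_one hγ
  simpa using this

/-- Along the coordinate line with velocity `w`, the distance from `x` at time `t` is at most `C
|t|` for any `C > ‖w‖` and small `t`; a pointwise Lipschitz bound thus limits the derivative. Only
behaviour near `x` matters, so the constant may depend on `x`. -/
theorem abs_mvfderiv_le {ψ : M → ℝ} {x : M} {G : ℝ} (hG : 0 ≤ G)
    (h : ∀ c : ℝ, G < c → ∀ᶠ y in nhds x, edist (ψ y) (ψ x) ≤ ENNReal.ofReal c * edist y x)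
    (w : TangentSpace (𝓡 n) x) : |mvfderiv (𝓡 n) ψ x w| ≤ G * ‖w‖ := by
  -- Without differentiability the derivative is 0 by default.
  by_cases hψ : MDifferentiableAt (𝓡 n) 𝓘(ℝ, ℝ) ψ x
  swap
  · have h0 : mvfderiv (𝓡 n) ψ x w = 0 :=
      congrArg (fun L : TangentSpace (𝓡 n) x →L[ℝ] ℝ ↦ L w)
        (mfderiv_zero_of_not_mdifferentiableAt hψ)
    rw [h0, abs_zero]
    positivity
  have hx := mem_chart_source (Euc n) x
  set e := extChartAt (𝓡 n) x with he
  set u : Euc n := (trivializationAt (Euc n) (TangentSpace (𝓡 n)) x).continuousLinearMapAt ℝ x w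
    with hu
  have hux : gramSq x x u = ‖w‖ ^ 2 := by
    rw [← norm_symmL_sq, hu,
      (trivializationAt (Euc n) (TangentSpace (𝓡 n)) x).symmL_continuousLinearMapAt
        (R := ℝ) (b := x) hx w]
  have hex : chartSymm n x (e x) = x := e.left_inv (mem_extChartAt_source x)
  -- The same slack `c - G` serves the Lipschitz constant and the length of `w`; it disappears in
  -- the limit `c → G`.
  have hbound : ∀ c : ℝ, G < c → |mvfderiv (𝓡 n) ψ x w| ≤ c * (‖w‖ + (c - G)) := by
    intro c hc
    have hc0 : 0 < c := hG.trans_lt hc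
    set C := ‖w‖ + (c - G) with hC
    have hwC : ‖w‖ < C := by linarith
    have hC0 : 0 < C := (norm_nonneg w).trans_lt hwC
    have hT : chartTarget n x ∈ nhds (e x) := extChartAt_target_mem_nhds x
    have hcont : ContinuousAt (fun z ↦ gramSq x (chartSymm n x z) u) (e x) :=
      (continuousOn_gramSq_chartSymm x u).continuousAt hT
    have hlt : ∀ᶠ z in nhds (e x), gramSq x (chartSymm n x z) u < C ^ 2 := by
      refine hcont.eventually_lt_const ?_
      change gramSq x (chartSymm n x (e x)) u < C ^ 2
      rw [hex, hux]
      exact pow_lt_pow_left₀ hwC (norm_nonneg w) two_ne_zero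
    obtain ⟨r, hr, hball⟩ := Metric.mem_nhds_iff.1 (Filter.inter_mem hT hlt)
    have hline : HasDerivAt (fun t : ℝ ↦ e x + t • u) u 0 := by
      simpa using ((hasDerivAt_id (0 : ℝ)).smul_const u).const_add (e x)
    have hline0 : Filter.Tendsto (fun t : ℝ ↦ e x + t • u) (nhds 0) (nhds (e x)) := by
      simpa using hline.continuousAt.tendsto
    have hsymm : Filter.Tendsto (fun t : ℝ ↦ chartSymm n x (e x + t • u)) (nhds 0) (nhds x) := by
      have h1 : ContinuousAt (chartSymm n x) (e x) := continuousAt_extChartAt_symm x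
      have h2 := h1.tendsto.comp hline0
      rwa [hex] at h2
    have hfd : HasFDerivAt (ψ ∘ chartSymm n x) (fderiv ℝ (ψ ∘ chartSymm n x) (e x)) (e x) := by
      have := (mdifferentiableAt_iff_source_of_mem_source (I := 𝓡 n) (I' := 𝓘(ℝ, ℝ)) hx).1 hψ
      have h2 : MDifferentiableAt 𝓘(ℝ, Euc n) 𝓘(ℝ, ℝ) (ψ ∘ chartSymm n x) (e x) := by
        change MDifferentiableAt 𝓘(ℝ, Euc n) 𝓘(ℝ, ℝ) (ψ ∘ (extChartAt (𝓡 n) x).symm)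
          (extChartAt (𝓡 n) x x)
        simpa [mdifferentiableWithinAt_univ] using this
      exact h2.differentiableAt.hasFDerivAt
    have hder : HasDerivAt (fun t : ℝ ↦ ψ (chartSymm n x (e x + t • u)))
        (mvfderiv (𝓡 n) ψ x w) 0 := by
      rw [mvfderiv_eq_fderiv_chart hx hψ w]
      refine HasFDerivAt.comp_hasDerivAt (0 : ℝ) (l := ψ ∘ chartSymm n x) ?_ hline
      rw [zero_smul, add_zero]
      exact hfd
    refine hder.le_of_lip' (by positivity) ?_
    filter_upwards [hsymm.eventually (h c hc), hline0.eventually (Metric.ball_mem_nhds _ hr)]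
      with t ht htb
    have hd : edist (chartSymm n x (e x)) (chartSymm n x (e x + t • u)) ≤
        ENNReal.ofReal (C * |t|) := by
      refine edist_chartSymm_le (convex_ball (e x) r) (fun p hp ↦ (hball hp).1)
        (Metric.mem_ball_self hr) htb (by positivity) fun p hp ↦ ?_
      rw [add_sub_cancel_left, gramSq_smul, mul_pow, sq_abs, mul_comm]
      exact mul_le_mul_of_nonneg_right (hball hp).2.le (sq_nonneg t)
    rw [hex, edist_comm] at hd
    have h3 := ht.trans (mul_le_mul_right hd (ENNReal.ofReal c))
    rw [← ENNReal.ofReal_mul hc0.le, edist_dist,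
      ENNReal.ofReal_le_ofReal_iff (by positivity), Real.dist_eq] at h3
    simp only [zero_smul, add_zero, sub_zero, Real.norm_eq_abs, hex]
    linarith
  have hlim : Filter.Tendsto (fun c : ℝ ↦ c * (‖w‖ + (c - G))) (nhdsWithin G (Ioi G))
      (nhds (G * ‖w‖)) := by
    have : Continuous fun c : ℝ ↦ c * (‖w‖ + (c - G)) := by fun_prop
    have h2 := (this.tendsto G).mono_left (nhdsWithin_le_nhds (s := Ioi G))
    simpa using h2
  exact ge_of_tendsto hlim (by filter_upwards [self_mem_nhdsWithin] with c hc using hbound c hc)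

/-- Near a point the Gram entries are bounded, so the Riemannian distance is at most a constant
times the coordinate distance. -/
theorem lipschitzInCharts_of_lipschitzWith {ψ : M → ℝ} {K : NNReal} (hψ : LipschitzWith K ψ) :
    LipschitzInCharts n ψ := by
  intro x
  have hT : chartTarget n x ∈ nhds (extChartAt (𝓡 n) x x) := extChartAt_target_mem_nhds x
  obtain ⟨B, hB0, hB⟩ : ∃ B : ℝ, 0 ≤ B ∧ ∀ᶠ z in nhds (extChartAt (𝓡 n) x x),
      ∀ i j : Fin n, |gram x (chartSymm n x z) i j| ≤ B := by
    -- The added 1 makes the bound strict at `x`, so that it persists nearby by continuity.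
    refine ⟨∑ i : Fin n, ∑ j : Fin n, |gram x x i j| + 1, by positivity, ?_⟩
    refine Filter.eventually_all.2 fun i ↦ Filter.eventually_all.2 fun j ↦ ?_
    have hc := ((continuousOn_gram_chartSymm x i j).continuousAt hT).abs
    refine (hc.eventually_lt_const (lt_of_le_of_lt ?_ (lt_add_one _))).mono fun z hz ↦ hz.le
    have hex : chartSymm n x (extChartAt (𝓡 n) x x) = x :=
      (extChartAt (𝓡 n) x).left_inv (mem_extChartAt_source x)
    change |gram x (chartSymm n x (extChartAt (𝓡 n) x x)) i j| ≤ _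
    rw [hex]
    exact (Finset.single_le_sum (f := fun j ↦ |gram x x i j|) (fun _ _ ↦ abs_nonneg _)
      (Finset.mem_univ j)).trans (Finset.single_le_sum (f := fun i ↦ ∑ j, |gram x x i j|)
      (fun _ _ ↦ Finset.sum_nonneg fun _ _ ↦ abs_nonneg _) (Finset.mem_univ i))
  obtain ⟨r, hr, hball⟩ := Metric.mem_nhds_iff.1 (Filter.inter_mem hT hB)
  refine ⟨Metric.ball (extChartAt (𝓡 n) x x) r, Metric.isOpen_ball, Metric.mem_ball_self hr,
    K * (√(n * n * B)).toNNReal, fun z hz z' hz' ↦ ?_⟩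
  have hd : edist (chartSymm n x z) (chartSymm n x z') ≤
      ENNReal.ofReal (√(n * n * B) * ‖z' - z‖) := by
    refine edist_chartSymm_le (convex_ball _ r) (fun p hp ↦ (hball hp).1) hz hz' (by positivity)
      fun p hp ↦ ?_
    rw [mul_pow, Real.sq_sqrt (by positivity)]
    set v := z' - z
    have hv : ∀ i, |v i| ≤ ‖v‖ := fun i ↦ PiLp.norm_apply_le v i
    calc gramSq x (chartSymm n x p) v ≤ ∑ i : Fin n, ∑ j : Fin n, ‖v‖ * ‖v‖ * B := by
          refine Finset.sum_le_sum fun i _ ↦ Finset.sum_le_sum fun j _ ↦ (le_abs_self _).trans ?_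
          rw [abs_mul, abs_mul]
          exact mul_le_mul (mul_le_mul (hv i) (hv j) (abs_nonneg _) (norm_nonneg _))
            ((hball hp).2 i j) (abs_nonneg _) (by positivity)
      _ = n * n * B * ‖v‖ ^ 2 := by
          simp only [Finset.sum_const, Finset.card_univ, Fintype.card_fin, nsmul_eq_mul]
          ring
  refine (hψ _ _).trans ?_
  rw [ENNReal.coe_mul, mul_assoc]
  refine mul_le_mul_right (hd.trans ?_) _
  rw [ENNReal.ofReal_mul (Real.sqrt_nonneg _), edist_dist, dist_eq_norm, norm_sub_rev]
  rfl

end LipschitzFunctions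

/-! ### Truncated distance functions as cutoffs. -/

section Cutoff

variable {X : Type*} [EMetricSpace X]

/-- The cutoff function that decreases from `1` on `F` to `0` at distance `k` from `F`, with
slope `1 / k`. -/
def cutoff (F : Set X) (k : NNReal) (y : X) : ℝ :=
  1 - (min (Metric.infEDist y F) k).toReal / k

theorem min_infEDist_ne_top (F : Set X) (k : NNReal) (y : X) :
    min (Metric.infEDist y F) k ≠ ⊤ :=
  ne_top_of_le_ne_top ENNReal.coe_ne_top (min_le_right _ _)

theorem toReal_min_infEDist_le (F : Set X) (k : NNReal) (y : X) :
    (min (Metric.infEDist y F) k).toReal ≤ k :=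
  ENNReal.toReal_mono ENNReal.coe_ne_top (min_le_right _ _)

theorem cutoff_le_one (F : Set X) (k : NNReal) (y : X) : cutoff F k y ≤ 1 := by
  rw [cutoff, sub_le_self_iff]
  positivity

theorem cutoff_nonneg (F : Set X) (k : NNReal) (y : X) : 0 ≤ cutoff F k y := by
  rw [cutoff, sub_nonneg]
  exact div_le_one_of_le₀ (toReal_min_infEDist_le F k y) k.2

/-- Truncation at `k` precedes the passage to real numbers, so an infinite distance to `F` is
harmless; the truncated distance is 1-Lipschitz, and it is divided by `k`. -/
theorem lipschitzWith_cutoff (F : Set X) (k : NNReal) : LipschitzWith k⁻¹ (cutoff F k) := by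
  intro y z
  rcases eq_or_ne (edist y z) ⊤ with h | h
  -- For `k = 0` the Lipschitz constant is 0, and division by zero makes the cutoff constant.
  · rcases eq_or_ne k 0 with rfl | hk
    · simp [cutoff]
    · have : ((k⁻¹ : NNReal) : ℝ≥0∞) ≠ 0 := by simpa using hk
      rw [h, ENNReal.mul_top this]
      exact le_top
  lift edist y z to NNReal using h with d hd
  have key : ∀ y z : X, edist y z = d →
      (min (Metric.infEDist y F) k).toReal ≤ (min (Metric.infEDist z F) k).toReal + d := by
    intro y z hd
    have h1 : min (Metric.infEDist y F) k ≤ min (Metric.infEDist z F) k + d := by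
      rw [min_add]
      refine le_min (min_le_of_left_le ?_) (min_le_of_right_le le_self_add)
      exact hd ▸ Metric.infEDist_le_infEDist_add_edist
    have h2 := ENNReal.toReal_mono
      (ENNReal.add_ne_top.2 ⟨min_infEDist_ne_top F k z, ENNReal.coe_ne_top⟩) h1
    rwa [ENNReal.toReal_add (min_infEDist_ne_top F k z) ENNReal.coe_ne_top] at h2
  have h1 := key y z hd.symm
  have h2 := key z y (by rw [edist_comm, hd])
  rw [← ENNReal.coe_mul, edist_dist, ENNReal.ofReal_le_coe, Real.dist_eq]
  have h3 : cutoff F k y - cutoff F k z = (k : ℝ)⁻¹ *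
      ((min (Metric.infEDist z F) k).toReal - (min (Metric.infEDist y F) k).toReal) := by
    simp only [cutoff]
    ring
  rw [h3, abs_mul, abs_of_nonneg (inv_nonneg.2 k.coe_nonneg), NNReal.coe_mul, NNReal.coe_inv]
  exact mul_le_mul_of_nonneg_left (abs_le.2 ⟨by linarith, by linarith⟩) (inv_nonneg.2 k.coe_nonneg)

theorem cutoff_eq_zero {F : Set X} {k : NNReal} (hk : k ≠ 0) {y : X}
    (hy : (k : ℝ≥0∞) ≤ Metric.infEDist y F) : cutoff F k y = 0 := by
  rw [cutoff, min_eq_right hy, ENNReal.coe_toReal, div_self (NNReal.coe_ne_zero.2 hk), sub_self]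

theorem one_sub_cutoff_le {F : Set X} {k : NNReal} {y p : X} (hp : p ∈ F) (hyp : edist y p ≠ ⊤) :
    1 - cutoff F k y ≤ (edist y p).toReal / k := by
  rw [cutoff, sub_sub_cancel]
  refine div_le_div_of_nonneg_right (ENNReal.toReal_mono hyp ?_) k.2
  exact (min_le_left _ _).trans (Metric.infEDist_le_edist_of_mem hp)

theorem hasCompactSupport_cutoff {F : Set X} (hF : F.Finite) {k : NNReal} (hk : k ≠ 0)
    (hX : ∀ x : X, IsCompact (Metric.closedEBall x (k : ℝ≥0∞))) :
    HasCompactSupport (cutoff F k) := by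
  refine HasCompactSupport.intro (hF.isCompact_biUnion fun x _ ↦ hX x) fun y hy ↦ ?_
  refine cutoff_eq_zero hk (Metric.le_infEDist.2 fun x hx ↦ ?_)
  simp only [mem_iUnion, not_exists] at hy
  exact (not_le.1 (hy x hx)).le

end Cutoff

/-! ### The divergence of the field dual to `u ↦ dα(u, v)`. -/

section PointwiseIdentities

variable {n : ℕ} {M : Type*} [TopologicalSpace M] [ChartedSpace (Euc n) M]
  [IsManifold (𝓡 n) ∞ M] [RiemannianBundle (fun x : M ↦ TangentSpace (𝓡 n) x)]
  [IsContMDiffRiemannianBundle (𝓡 n) ∞ (Euc n) (fun x : M ↦ TangentSpace (𝓡 n) x)]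

theorem dvg_add {u w : (x : M) → TangentSpace (𝓡 n) x} (hu : IsSmoothField u)
    (hw : IsSmoothField w) (x : M) : dvg (fun y ↦ u y + w y) x = dvg u x + dvg w x := by
  have hx := mem_chart_source (Euc n) x
  simp only [dvg, map_add, mul_add]
  rw [← mul_add, ← Finset.sum_add_distrib]
  congr 1
  exact Finset.sum_congr rfl fun i _ ↦ pd_add ((smoothAt_dens hx).mul (hu.smoothAt_coframe hx i))
    ((smoothAt_dens hx).mul (hw.smoothAt_coframe hx i)) i

theorem isSmoothField_add {u w : (x : M) → TangentSpace (𝓡 n) x} (hu : IsSmoothField u)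
    (hw : IsSmoothField w) : IsSmoothField fun y ↦ u y + w y := by
  refine isSmoothField_of_coframe fun x₀ y hy i ↦ ?_
  simp only [map_add]
  exact ContMDiffAt.add (hu.smoothAt_coframe hy i) (hw.smoothAt_coframe hy i)

theorem codiff₂_apply_sharp (α : OneForm n M)
    (η : (x : M) → TangentSpace (𝓡 n) x → TangentSpace (𝓡 n) x → ℝ) (x : M) :
    codiff₂ η x (sharp α x) = - ∑ j, α x (frame x j x) * ((dens n x x)⁻¹ *
      ∑ i, pd x i (fun y ↦ dens n x y * raised η x i j y) x) := by
  have hx := mem_chart_source (Euc n) x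
  have h : codiff₂ η x (sharp α x) = ∑ k, (- ∑ j, gram x x k j * ((dens n x x)⁻¹ *
      ∑ i, pd x i (fun y ↦ dens n x y * raised η x i j y) x)) * coframe x k x (sharp α x) := by
    rw [codiff₂, sum_apply]
    rfl
  rw [h]
  simp only [form_frame_eq_sum_gram α hx, neg_mul, Finset.sum_mul, Finset.sum_neg_distrib]
  rw [Finset.sum_comm]
  congr 1
  refine Finset.sum_congr rfl fun j _ ↦ Finset.sum_congr rfl fun k _ ↦ ?_
  rw [gram_comm x x j k]
  ring

theorem raised_extD_antisymm (α : OneForm n M) (x₀ : M) (i j : Fin n) (y : M) :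
    raised (extD α) x₀ j i y = - raised (extD α) x₀ i j y := by
  rw [raised, raised, Finset.sum_comm, ← Finset.sum_neg_distrib]
  refine Finset.sum_congr rfl fun a _ ↦ ?_
  rw [← Finset.sum_neg_distrib]
  refine Finset.sum_congr rfl fun b _ ↦ ?_
  rw [extD_antisymm α y (frame x₀ b y)]
  ring

/-- Contraction with the antisymmetric `η^ij` sees only the antisymmetric part of `∂ᵢ αⱼ`, which is
half of `dα`. -/
theorem sum_raised_mul_pd {α : OneForm n M} (hα : IsSmoothForm α) (x : M) :
    ∑ i, ∑ j, raised (extD α) x i j x * pd x i (fun y ↦ α y (frame x j y)) x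
      = extDSq α x / 2 := by
  have hx := mem_chart_source (Euc n) x
  have h : extDSq α x = ∑ i, ∑ j, raised (extD α) x i j x * pd x i (fun y ↦ α y (frame x j y)) x
      + ∑ i, ∑ j, raised (extD α) x i j x * pd x i (fun y ↦ α y (frame x j y)) x := by
    nth_rewrite 2 [Finset.sum_comm]
    rw [extDSq, ← Finset.sum_add_distrib]
    refine Finset.sum_congr rfl fun i _ ↦ ?_
    rw [← Finset.sum_add_distrib]
    refine Finset.sum_congr rfl fun j _ ↦ ?_
    rw [extD_frame hα hx, raised_extD_antisymm α x i j]
    ring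
  rw [h]
  ring

/-- Product rule for `∂ᵢ (√det g η^ij αⱼ)`: a derivative on `αⱼ` gives the norm of `dα`, a
derivative on the rest gives `-(δdα)(v)`. -/
theorem dvg_extDField {α : OneForm n M} (hα : IsSmoothForm α) (x : M) :
    dvg (extDField α (sharp α)) x
      = extDSq α x / 2 - codiff₂ (extD α) x (sharp α x) := by
  have hx := mem_chart_source (Euc n) x
  have hd := (dens_pos (n := n) hx).ne'
  have h1 : ∀ i, pd x i (fun y ↦ dens n x y * coframe x i y (extDField α (sharp α) y)) x =
      ∑ j, (dens n x x * (raised (extD α) x i j x * pd x i (fun y ↦ α y (frame x j y)) x)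
        + α x (frame x j x) * pd x i (fun y ↦ dens n x y * raised (extD α) x i j y) x) := by
    intro i
    have hs : ∀ j, SmoothAt n (fun y ↦ dens n x y * raised (extD α) x i j y) x := fun j ↦
      (smoothAt_dens hx).mul (smoothAt_raised hα hx i j)
    have h2 : pd x i (fun y ↦ dens n x y * coframe x i y (extDField α (sharp α) y)) x =
        pd x i (fun y ↦ ∑ j, (dens n x y * raised (extD α) x i j y) * α y (frame x j y)) x := by
      refine pd_congr ?_ i
      filter_upwards [(chartAt (Euc n) x).open_source.mem_nhds hx] with z hz
      rw [coframe_extDField_sharp α hz, Finset.mul_sum]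
      exact Finset.sum_congr rfl fun j _ ↦ by ring
    rw [h2, pd_sum _ fun j _ ↦ (hs j).mul (hα.smoothAt_frame hx j)]
    refine Finset.sum_congr rfl fun j _ ↦ ?_
    rw [pd_mul (hs j) (hα.smoothAt_frame hx j)]
    ring
  rw [dvg, codiff₂_apply_sharp, ← sum_raised_mul_pd hα x]
  simp only [h1, Finset.sum_add_distrib, mul_add, sub_neg_eq_add, ← Finset.mul_sum]
  rw [← mul_assoc, inv_mul_cancel₀ hd, one_mul]
  congr 1
  rw [Finset.sum_comm, Finset.mul_sum]
  refine Finset.sum_congr rfl fun j _ ↦ ?_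
  rw [← Finset.mul_sum]
  ring

end PointwiseIdentities

/-! ### Closed forms: the Lie derivative and the covariant derivative as gradients. -/

section Steady

variable {n : ℕ} {M : Type*} [TopologicalSpace M] [ChartedSpace (Euc n) M]
  [IsManifold (𝓡 n) ∞ M] [RiemannianBundle (fun x : M ↦ TangentSpace (𝓡 n) x)]
  [IsContMDiffRiemannianBundle (𝓡 n) ∞ (Euc n) (fun x : M ↦ TangentSpace (𝓡 n) x)]

theorem pd_comm_of_extD_eq_zero {α : OneForm n M} (hα : IsSmoothForm α)
    {x : M} (h : ∀ u w, extD α x u w = 0) (i j : Fin n) :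
    pd x i (fun y ↦ α y (frame x j y)) x = pd x j (fun y ↦ α y (frame x i y)) x := by
  have := extD_frame hα (mem_chart_source (Euc n) x) i j
  rw [h] at this
  linarith

theorem pd_contract_sharp {α : OneForm n M} (hα : IsSmoothForm α) (x : M) (l : Fin n) :
    pd x l (contract (sharp α) α) x =
      ∑ i, (coframe x i x (sharp α x) * pd x l (fun y ↦ α y (frame x i y)) x
        + α x (frame x i x) * pd x l (fun y ↦ coframe x i y (sharp α y)) x) := by
  have hx := mem_chart_source (Euc n) x
  have h : pd x l (contract (sharp α) α) x =
      pd x l (fun y ↦ ∑ i, coframe x i y (sharp α y) * α y (frame x i y)) x := by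
    refine pd_congr ?_ l
    filter_upwards [(chartAt (Euc n) x).open_source.mem_nhds hx] with z hz
    exact clm_apply_eq_sum hz (α z) (sharp α z)
  rw [h, pd_sum _ fun i _ ↦ (hα.sharp.smoothAt_coframe hx i).mul (hα.smoothAt_frame hx i)]
  exact Finset.sum_congr rfl fun i _ ↦
    pd_mul (hα.sharp.smoothAt_coframe hx i) (hα.smoothAt_frame hx i) l

/-- Cartan's formula with `ι_v dα = 0`: in components, closedness exchanges `∂ᵢ αₗ` with `∂ₗ αᵢ`,
and the product rule for `vⁱ αᵢ` appears. -/
theorem lieD_sharp_eq_mvfderiv {α : OneForm n M} (hα : IsSmoothForm α)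
    {x : M} (h : ∀ u w, extD α x u w = 0) :
    lieD (sharp α) α x = mvfderiv (𝓡 n) (contract (sharp α) α) x := by
  have hx := mem_chart_source (Euc n) x
  refine clm_ext_frame hx fun l ↦ ?_
  refine Eq.trans ?_ (pd_contract_sharp hα x l).symm
  have h1 : lieD (sharp α) α x (frame x l x) = ∑ j, (∑ i, (coframe x i x (sharp α x) *
      pd x i (fun y ↦ α y (frame x j y)) x
      + α x (frame x i x) * pd x j (fun y ↦ coframe x i y (sharp α y)) x)) *
      coframe x j x (frame x l x) := by
    rw [lieD, sum_apply]
    rfl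
  rw [h1]
  simp only [coframe_frame hx, mul_ite, mul_one, mul_zero, Finset.sum_ite_eq', Finset.mem_univ,
    if_true]
  exact Finset.sum_congr rfl fun i _ ↦ by rw [pd_comm_of_extD_eq_zero hα h i l]

/-- The index computation behind `g(∇_v v, ∂ₗ) = ½ ∂ₗ (vⁱ αᵢ)`, with `dv i k`, `da i l`, `dg l i j`
in the roles of `∂ᵢ v^k`, `∂ᵢ αₗ`, `∂ₗ g_ij`. Lowering the index gives `vⁱ ∂ᵢ αₗ - ½ vⁱ vʲ ∂ₗ g_ij`;
closedness turns the first term into `vⁱ ∂ₗ αᵢ`, and the product rule for `αᵢ = g_ik v^k` eliminates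
the derivatives of the metric. -/
theorem sum_christoffel_identity {m : ℕ} {v : Fin m → ℝ} {g gi dv da : Fin m → Fin m → ℝ}
    {dg : Fin m → Fin m → Fin m → ℝ} (hg : ∀ i j, g i j = g j i)
    (hdg : ∀ l i j, dg l i j = dg l j i)
    (hgi : ∀ l p, ∑ k, g l k * gi k p = if l = p then 1 else 0)
    (hda : ∀ i l, da i l = ∑ k, (g l k * dv i k + v k * dg i l k))
    (hclosed : ∀ i l, da i l = da l i) (l : Fin m) :
    ∑ k, (∑ i, v i * dv i k + ∑ i, ∑ j, (1 / 2 * ∑ p, gi k p *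
        (dg i j p + dg j i p - dg p i j)) * v i * v j) * g k l =
      1 / 2 * ∑ i, (v i * da l i + (∑ k, g i k * v k) * dv l i) := by
  have h1 : ∑ k, (∑ i, ∑ j, (1 / 2 * ∑ p, gi k p *
      (dg i j p + dg j i p - dg p i j)) * v i * v j) * g k l =
      ∑ i, ∑ j, 1 / 2 * (dg i j l + dg j i l - dg l i j) * v i * v j := by
    have h2 : ∀ i j, ∑ k, (1 / 2 * ∑ p, gi k p * (dg i j p + dg j i p - dg p i j)) * v i * v j *
        g k l = 1 / 2 * (dg i j l + dg j i l - dg l i j) * v i * v j := by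
      intro i j
      calc _ = ∑ p, (∑ k, g l k * gi k p) *
            (1 / 2 * (dg i j p + dg j i p - dg p i j) * v i * v j) := by
            simp only [Finset.mul_sum, Finset.sum_mul]
            rw [Finset.sum_comm]
            refine Finset.sum_congr rfl fun p _ ↦ Finset.sum_congr rfl fun k _ ↦ ?_
            rw [hg l k]
            ring
        _ = _ := by simp [hgi]
    simp only [← h2, Finset.sum_mul]
    rw [Finset.sum_comm]
    exact Finset.sum_congr rfl fun i _ ↦ Finset.sum_comm
  have h3 : ∑ i, ∑ j, 1 / 2 * (dg i j l + dg j i l - dg l i j) * v i * v j =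
      ∑ i, ∑ j, v i * v j * dg i l j - 1 / 2 * ∑ i, ∑ j, v i * v j * dg l i j := by
    have h4 : ∑ i, ∑ j, v i * v j * dg j l i = ∑ i, ∑ j, v i * v j * dg i l j := by
      rw [Finset.sum_comm]
      exact Finset.sum_congr rfl fun i _ ↦ Finset.sum_congr rfl fun j _ ↦ by ring
    have h5 : ∑ i, ∑ j, 1 / 2 * (dg i j l + dg j i l - dg l i j) * v i * v j =
        1 / 2 * ∑ i, ∑ j, v i * v j * dg i l j + 1 / 2 * ∑ i, ∑ j, v i * v j * dg j l i
          - 1 / 2 * ∑ i, ∑ j, v i * v j * dg l i j := by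
      simp only [Finset.mul_sum, ← Finset.sum_add_distrib, ← Finset.sum_sub_distrib]
      refine Finset.sum_congr rfl fun i _ ↦ Finset.sum_congr rfl fun j _ ↦ ?_
      rw [hdg i j l, hdg j i l]
      ring
    rw [h5, h4]
    ring
  -- The same sum is expanded twice: here by the product rule alone, in `h7` after closedness has
  -- exchanged the indices. Comparing the two removes `da`.
  have h6 : ∑ i, v i * da l i = ∑ i, ∑ k, v i * g i k * dv l k + ∑ i, ∑ k, v i * v k * dg l i k := by
    simp only [hda l, Finset.mul_sum, ← Finset.sum_add_distrib]
    exact Finset.sum_congr rfl fun i _ ↦ Finset.sum_congr rfl fun k _ ↦ by ring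
  have h7 : ∑ i, v i * da l i = ∑ k, (∑ i, v i * dv i k) * g k l + ∑ i, ∑ k, v i * v k * dg i l k := by
    simp only [← hclosed _ l, hda _ l, Finset.mul_sum, Finset.sum_mul]
    rw [Finset.sum_comm (f := fun k i ↦ v i * dv i k * g k l)]
    simp only [← Finset.sum_add_distrib]
    refine Finset.sum_congr rfl fun i _ ↦ Finset.sum_congr rfl fun k _ ↦ ?_
    rw [hg k l]
    ring
  have h8 : ∑ i, (∑ k, g i k * v k) * dv l i = ∑ i, ∑ k, v i * g i k * dv l k := by
    simp only [Finset.sum_mul]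
    rw [Finset.sum_comm]
    refine Finset.sum_congr rfl fun i _ ↦ Finset.sum_congr rfl fun k _ ↦ ?_
    rw [hg k i]
    ring
  simp only [add_mul, Finset.sum_add_distrib]
  rw [h1, h3, h8]
  linarith

theorem eq_of_inner_frame_eq {x₀ y : M} (hy : y ∈ (chartAt (Euc n) x₀).source)
    {u w : TangentSpace (𝓡 n) y}
    (h : ∀ l, inner ℝ u (frame x₀ l y) = inner ℝ w (frame x₀ l y)) : u = w := by
  refine ext_inner_right ℝ fun z ↦ ?_
  rw [← sum_coframe_smul_frame hy z, inner_sum, inner_sum]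
  refine Finset.sum_congr rfl fun l _ ↦ ?_
  rw [real_inner_smul_right, real_inner_smul_right, h]

theorem inner_grad (p : M → ℝ) (x : M) (w : TangentSpace (𝓡 n) x) :
    inner ℝ (grad p x) w = mvfderiv (𝓡 n) p x w :=
  inner_sharp (show OneForm n M from mvfderiv (𝓡 n) p) x w

/-- Compare inner products with the frame: this exhibits `-½ |α|²` as the pressure. -/
theorem covD_sharp_eq_grad {α : OneForm n M} (hα : IsSmoothForm α)
    {x : M} (h : ∀ u w, extD α x u w = 0) :
    covD (sharp α) (sharp α) x = - grad (fun y ↦ -(1 / 2) * contract (sharp α) α y) x := by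
  have hx := mem_chart_source (Euc n) x
  have hsc : SmoothAt n (contract (sharp α) α) x := smoothAt_form_field hα hα.sharp x
  refine eq_of_inner_frame_eq hx fun l ↦ ?_
  rw [inner_neg_left, inner_grad]
  have h1 : mvfderiv (𝓡 n) (fun y ↦ -(1 / 2) * contract (sharp α) α y) x (frame x l x) =
      -(1 / 2) * pd x l (contract (sharp α) α) x := by
    have := pd_mul (x₀ := x) (f := fun _ ↦ -(1 / 2 : ℝ)) contMDiffAt_const hsc l
    rw [pd_const, mul_zero, add_zero] at this
    exact this
  rw [h1, pd_contract_sharp hα, covD, sum_inner]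
  simp only [real_inner_smul_left, form_frame_eq_sum_gram α hx]
  rw [neg_mul, neg_neg]
  have key := sum_christoffel_identity (v := fun i ↦ coframe x i x (sharp α x))
    (g := fun i j ↦ gram x x i j) (gi := fun i j ↦ (gram x x)⁻¹ i j)
    (dv := fun i k ↦ pd x i (fun y ↦ coframe x k y (sharp α y)) x)
    (da := fun i l ↦ pd x i (fun y ↦ α y (frame x l y)) x)
    (dg := fun l i j ↦ pd x l (fun y ↦ gram x y i j) x)
    (gram_comm x x) (fun l i j ↦ by simp only [fun y : M ↦ gram_comm x y i j])
    (sum_gram_mul_inv hx) (fun i l ↦ ?_) (pd_comm_of_extD_eq_zero hα h) l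
  · refine Eq.trans ?_ (key.trans ?_)
    · rfl
    · rfl
  · have h2 : pd x i (fun y ↦ α y (frame x l y)) x =
        pd x i (fun y ↦ ∑ k, gram x y l k * coframe x k y (sharp α y)) x := by
      refine pd_congr ?_ i
      filter_upwards [(chartAt (Euc n) x).open_source.mem_nhds hx] with z hz
      exact form_frame_eq_sum_gram α hz l
    rw [h2, pd_sum _ fun k _ ↦ (smoothAt_gram hx l k).mul (hα.sharp.smoothAt_coframe hx k)]
    exact Finset.sum_congr rfl fun k _ ↦
      pd_mul (smoothAt_gram hx l k) (hα.sharp.smoothAt_coframe hx k) i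

end Steady

/-! ### The field whose divergence is the energy density. -/

section WeightedField

variable {n : ℕ} {M : Type*} [TopologicalSpace M] [ChartedSpace (Euc n) M]
  [IsManifold (𝓡 n) ∞ M] [RiemannianBundle (fun x : M ↦ TangentSpace (𝓡 n) x)]
  [IsContMDiffRiemannianBundle (𝓡 n) ∞ (Euc n) (fun x : M ↦ TangentSpace (𝓡 n) x)]
  [MeasurableSpace M] [BorelSpace M] [T2Space M] [SigmaCompactSpace M]

/-- The energy density `|δα|² + |dα|²` of a 1-form. -/
def hodgeEnergy (α : OneForm n M) (x : M) : ℝ := dvg (sharp α) x ^ 2 + extDSq α x / 2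

/-- The vector field `ι_v dα + (div v) v`, up to sign conventions, where `v = α^♯`. Its divergence
is the energy density if `α` is harmonic. -/
def hodgeField (α : OneForm n M) (x : M) : TangentSpace (𝓡 n) x :=
  extDField α (sharp α) x + dvg (sharp α) x • sharp α x

theorem hodgeEnergy_nonneg (α : OneForm n M) (x : M) : 0 ≤ hodgeEnergy α x :=
  add_nonneg (sq_nonneg _) (div_nonneg (extDSq_nonneg α x) zero_le_two)

theorem isSmoothField_hodgeField {α : OneForm n M} (hα : IsSmoothForm α) :
    IsSmoothField (hodgeField α) :=
  isSmoothField_add (isSmoothField_extDField hα hα.sharp)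
    (hα.sharp.smul (smoothAt_dvg hα.sharp))

/-- The two divergences leave the remainders `-(δdα)(v)` and `d(div v)(v) = -(dδα)(v)`. Their sum is
`-(Δα)(v) = 0`. -/
theorem dvg_hodgeField {α : OneForm n M} (hα : IsHarmonicForm α) (x : M) :
    dvg (hodgeField α) x = hodgeEnergy α x := by
  have hs := hα.1
  have h1 : dvg (hodgeField α) x = _ := dvg_add (isSmoothField_extDField hs hs.sharp)
    (hs.sharp.smul (smoothAt_dvg hs.sharp)) x
  have h2 : dvg (fun y ↦ dvg (sharp α) y • sharp α y) x = _ :=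
    dvg_smul hs.sharp (smoothAt_dvg hs.sharp x)
  rw [h1, dvg_extDField hs, h2]
  have h3 : mvfderiv (𝓡 n) (codiff₁ α) x (sharp α x) + codiff₂ (extD α) x (sharp α x) = 0 :=
    congrArg (fun L : TangentSpace (𝓡 n) x →L[ℝ] ℝ ↦ L (sharp α x)) (hα.2 x)
  have h4 : mvfderiv (𝓡 n) (codiff₁ α) x (sharp α x)
      = - mvfderiv (𝓡 n) (dvg (sharp α)) x (sharp α x) := by
    have hx := mem_chart_source (Euc n) x
    rw [mvfderiv_eq_sum_pd hx, mvfderiv_eq_sum_pd hx, ← Finset.sum_neg_distrib]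
    refine Finset.sum_congr rfl fun i _ ↦ ?_
    have h5 := pd_mul (x₀ := x) (f := fun _ ↦ (-1 : ℝ)) contMDiffAt_const
      (smoothAt_dvg hs.sharp x) i
    rw [pd_const, mul_zero, add_zero] at h5
    have h6 : codiff₁ α = fun y ↦ -1 * dvg (sharp α) y := by
      funext y
      rw [codiff₁, neg_one_mul]
    rw [h6, h5]
    ring
  rw [hodgeEnergy]
  linarith

/-- From `(a + b)² ≤ 2(a² + b²)`; another factor 2 compensates the halved `extDSq` in the energy. -/
theorem norm_hodgeField_sq_le (α : OneForm n M) (x : M) :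
    ‖hodgeField α x‖ ^ 2 ≤ 4 * (‖α x‖ ^ 2 * hodgeEnergy α x) := by
  have h1 : ‖extDField α (sharp α) x‖ ^ 2 ≤ extDSq α x * ‖α x‖ ^ 2 := by
    have := norm_sharp_extDLeft_sq_le α (sharp α) x
    rwa [norm_sharp α] at this
  have h2 : ‖dvg (sharp α) x • sharp α x‖ ^ 2 = dvg (sharp α) x ^ 2 * ‖α x‖ ^ 2 := by
    rw [norm_smul, mul_pow, norm_sharp, Real.norm_eq_abs, sq_abs]
  have h3 : ‖hodgeField α x‖ ≤ ‖extDField α (sharp α) x‖ + ‖dvg (sharp α) x • sharp α x‖ :=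
    norm_add_le _ _
  have h4 : ‖hodgeField α x‖ ^ 2 ≤
      (‖extDField α (sharp α) x‖ + ‖dvg (sharp α) x • sharp α x‖) ^ 2 :=
    pow_le_pow_left₀ (norm_nonneg _) h3 2
  have h5 := add_sq_le (a := ‖extDField α (sharp α) x‖) (b := ‖dvg (sharp α) x • sharp α x‖)
  have h6 : 0 ≤ dvg (sharp α) x ^ 2 * ‖α x‖ ^ 2 := by positivity
  rw [hodgeEnergy]
  linarith

/-- For harmonic `α` the energy is the divergence of a smooth field, which gives continuity at once.
-/
theorem continuous_hodgeEnergy {α : OneForm n M} (hα : IsHarmonicForm α) :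
    Continuous (hodgeEnergy α) := by
  refine continuous_iff_continuousAt.2 fun x ↦ ?_
  have := (smoothAt_dvg (isSmoothField_hodgeField hα.1) x).continuousAt
  rwa [show dvg (hodgeField α) = hodgeEnergy α from funext (dvg_hodgeField hα)] at this

end WeightedField

/-! ### Global arguments on a complete manifold. -/

section Complete

variable {n : ℕ} {M : Type*} [EMetricSpace M] [SecondCountableTopology M]
  [ChartedSpace (Euc n) M] [IsManifold (𝓡 n) ∞ M]
  [RiemannianBundle (fun x : M ↦ TangentSpace (𝓡 n) x)]
  [IsContMDiffRiemannianBundle (𝓡 n) ∞ (Euc n) (fun x : M ↦ TangentSpace (𝓡 n) x)]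
  [IsRiemannianManifold (𝓡 n) M] [CompleteSpace M]

/-- A sequence of compactly supported cutoff functions that converges to `1`, with slopes
tending to zero. -/
structure IsExhaustingCutoff {X : Type*} [EMetricSpace X] (φ : ℕ → X → ℝ) : Prop where
  lipschitz : ∀ k : ℕ, LipschitzWith ((k : NNReal) + 1)⁻¹ (φ k)
  nonneg : ∀ k x, 0 ≤ φ k x
  le_one : ∀ k x, φ k x ≤ 1
  hasCompactSupport : ∀ k, HasCompactSupport (φ k)
  tendsto : ∀ x, Filter.Tendsto (fun k ↦ φ k x) Filter.atTop (nhds 1)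

theorem exists_isExhaustingCutoff (n : ℕ) (M : Type*) [EMetricSpace M] [SecondCountableTopology M]
    [ChartedSpace (Euc n) M] [IsManifold (𝓡 n) ∞ M]
    [RiemannianBundle (fun x : M ↦ TangentSpace (𝓡 n) x)]
    [IsRiemannianManifold (𝓡 n) M] [CompleteSpace M] :
    ∃ φ : ℕ → M → ℝ, IsExhaustingCutoff φ := by
  rcases isEmpty_or_nonempty M with hM | hM
  · exact ⟨fun _ _ ↦ 0, fun _ x ↦ hM.elim x, fun _ x ↦ hM.elim x, fun _ x ↦ hM.elim x,
      fun _ ↦ HasCompactSupport.zero, fun x ↦ hM.elim x⟩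
  -- `M` may be disconnected, with infinite distances, so balls about a single point need not
  -- exhaust it. Finite pieces of a dense sequence eventually contain a point at finite distance
  -- from any given `x`.
  let F : ℕ → Set M := fun k ↦ TopologicalSpace.denseSeq M '' Iic k
  have hk : ∀ k : ℕ, (k : NNReal) + 1 ≠ 0 := fun k ↦ (by positivity : (0 : NNReal) < k + 1).ne'
  refine ⟨fun k ↦ cutoff (F k) (k + 1), fun k ↦ lipschitzWith_cutoff _ _,
    fun k ↦ cutoff_nonneg _ _, fun k ↦ cutoff_le_one _ _,
    fun k ↦ hasCompactSupport_cutoff ((finite_Iic k).image _) (hk k)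
      fun x ↦ isCompact_closedEBall n x _, fun x ↦ ?_⟩
  obtain ⟨j, hj⟩ := (TopologicalSpace.denseRange_denseSeq M).exists_mem_open
    Metric.isOpen_eball ⟨x, Metric.mem_eball_self (zero_lt_one' ℝ≥0∞)⟩
  have hj' : edist x (TopologicalSpace.denseSeq M j) ≠ ⊤ := by
    rw [edist_comm]
    exact (lt_trans hj ENNReal.one_lt_top).ne
  have hlim : Filter.Tendsto (fun k : ℕ ↦ 1 -
      (edist x (TopologicalSpace.denseSeq M j)).toReal / ((k : ℝ) + 1)) Filter.atTop (nhds 1) := by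
    have := (tendsto_one_div_add_atTop_nhds_zero_nat (𝕜 := ℝ)).const_mul
      (edist x (TopologicalSpace.denseSeq M j)).toReal
    simpa [div_eq_mul_inv] using this.const_sub 1
  refine tendsto_of_tendsto_of_tendsto_of_le_of_le' hlim tendsto_const_nhds ?_
    (Filter.Eventually.of_forall fun k ↦ cutoff_le_one _ _ x)
  filter_upwards [Filter.eventually_ge_atTop j] with k hk
  have := one_sub_cutoff_le (k := k + 1) (mem_image_of_mem _ hk : _ ∈ F k) hj'
  push_cast at this
  linarith

theorem abs_mvfderiv_le_of_lipschitzWith {ψ : M → ℝ} {K : NNReal} (hψ : LipschitzWith K ψ)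
    (x : M) (w : TangentSpace (𝓡 n) x) : |mvfderiv (𝓡 n) ψ x w| ≤ K * ‖w‖ := by
  refine abs_mvfderiv_le K.coe_nonneg (fun c hc ↦ Filter.Eventually.of_forall fun y ↦ ?_) w
  refine (hψ y x).trans (mul_le_mul_left ?_ _)
  rw [← ENNReal.ofReal_coe_nnreal]
  exact ENNReal.ofReal_le_ofReal hc.le

theorem lipschitzWith_sq {X : Type*} [EMetricSpace X] {φ : X → ℝ} {K : NNReal}
    (hφ : LipschitzWith K φ) (h0 : ∀ x, 0 ≤ φ x) (h1 : ∀ x, φ x ≤ 1) :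
    LipschitzWith (2 * K) fun x ↦ φ x ^ 2 := by
  intro y x
  have h2 : edist (φ y ^ 2) (φ x ^ 2) ≤ 2 * edist (φ y) (φ x) := by
    rw [edist_dist, edist_dist, Real.dist_eq, Real.dist_eq, ← ENNReal.ofReal_ofNat,
      ← ENNReal.ofReal_mul zero_le_two, sq_sub_sq, abs_mul]
    refine ENNReal.ofReal_le_ofReal (mul_le_mul_of_nonneg_right ?_ (abs_nonneg _))
    rw [abs_of_nonneg (add_nonneg (h0 y) (h0 x))]
    linarith [h1 y, h1 x]
  refine h2.trans ?_
  rw [ENNReal.coe_mul, mul_assoc]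
  exact mul_le_mul_right (hφ y x) _

/-- From `φ(y)² - φ(x)² = (φ(y) + φ(x))(φ(y) - φ(x))`, without differentiating `φ` itself, which may
fail at `x`. The factor `φ x` is kept since it allows the absorption in the energy estimate. -/
theorem abs_mvfderiv_sq_le {φ : M → ℝ} {K : NNReal} (hφ : LipschitzWith K φ)
    (h0 : ∀ x, 0 ≤ φ x) (x : M) (w : TangentSpace (𝓡 n) x) :
    |mvfderiv (𝓡 n) (fun y ↦ φ y ^ 2) x w| ≤ 2 * φ x * K * ‖w‖ := by
  refine abs_mvfderiv_le (mul_nonneg (mul_nonneg zero_le_two (h0 x)) K.coe_nonneg)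
    (fun c hc ↦ ?_) w
  have hc' : ContinuousAt (fun y ↦ (φ y + φ x) * K) x := by
    have := hφ.continuous
    fun_prop
  filter_upwards [hc'.eventually_lt_const (u := c) (by linarith)] with y hy
  have h2 : edist (φ y ^ 2) (φ x ^ 2) = ENNReal.ofReal (φ y + φ x) * edist (φ y) (φ x) := by
    rw [edist_dist, edist_dist, Real.dist_eq, Real.dist_eq,
      ← ENNReal.ofReal_mul (add_nonneg (h0 y) (h0 x)), sq_sub_sq, abs_mul,
      abs_of_nonneg (add_nonneg (h0 y) (h0 x))]
  rw [h2]
  refine (mul_le_mul_right (hφ y x) _).trans ?_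
  rw [← mul_assoc]
  refine mul_le_mul_left ?_ _
  rw [← ENNReal.ofReal_coe_nnreal, ← ENNReal.ofReal_mul (add_nonneg (h0 y) (h0 x))]
  exact ENNReal.ofReal_le_ofReal hy.le

variable [MeasurableSpace M] [BorelSpace M]

theorem sigmaCompactSpace (n : ℕ) (M : Type*) [TopologicalSpace M] [SecondCountableTopology M]
    [ChartedSpace (Euc n) M] : SigmaCompactSpace M :=
  haveI : LocallyCompactSpace M := Manifold.locallyCompact_of_finiteDimensional (𝓡 n)
  inferInstance

/-- A Caccioppoli inequality: `∫ φ² E = -∫ d(φ²)(X)` is bounded by half of itself plus `8 K² ∫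
|α|²`. -/
theorem integral_cutoff_sq_mul_hodgeEnergy_le {α : OneForm n M} (hα : IsHarmonicForm α)
    (h2 : MemLp (fun x ↦ ‖α x‖) 2 (vol n M)) {φ : M → ℝ} {K : NNReal} (hφ : LipschitzWith K φ)
    (h0 : ∀ x, 0 ≤ φ x) (h1 : ∀ x, φ x ≤ 1) (hc : HasCompactSupport φ) :
    Integrable (fun x ↦ φ x ^ 2 * hodgeEnergy α x) (vol n M) ∧
    ∫ x, φ x ^ 2 * hodgeEnergy α x ∂(vol n M) ≤ 16 * K ^ 2 * ∫ x, ‖α x‖ ^ 2 ∂(vol n M) := by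
  have := sigmaCompactSpace n M
  have hc2 : HasCompactSupport fun x ↦ φ x ^ 2 := by
    have : (fun x ↦ φ x ^ 2) = fun x ↦ φ x * φ x := funext fun x ↦ sq (φ x)
    rw [this]
    exact hc.mul_left
  have hcont : Continuous fun x ↦ φ x ^ 2 := hφ.continuous.pow 2
  have hint : Integrable (fun x ↦ φ x ^ 2 * hodgeEnergy α x) (vol n M) :=
    (hcont.mul (continuous_hodgeEnergy hα)).integrable_of_hasCompactSupport hc2.mul_right
  have hint2 : Integrable (fun x ↦ ‖α x‖ ^ 2) (vol n M) := h2.integrable_sq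
  obtain ⟨hi, he⟩ := integral_mul_dvg (isSmoothField_hodgeField hα.1) hc2
    (lipschitzInCharts_of_lipschitzWith (lipschitzWith_sq hφ h0 h1)) hcont
  refine ⟨hint, ?_⟩
  simp only [dvg_hodgeField hα] at he
  have hpt : ∀ x, - mvfderiv (𝓡 n) (fun y ↦ φ y ^ 2) x (hodgeField α x) ≤
      1 / 2 * (φ x ^ 2 * hodgeEnergy α x) + 8 * K ^ 2 * ‖α x‖ ^ 2 := by
    intro x
    refine (neg_le_abs _).trans ((abs_mvfderiv_sq_le hφ h0 x _).trans ?_)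
    have hE := hodgeEnergy_nonneg α x
    have h3 : ‖hodgeField α x‖ ≤ 2 * (‖α x‖ * √(hodgeEnergy α x)) := by
      refine le_of_sq_le_sq ((norm_hodgeField_sq_le α x).trans (le_of_eq ?_)) (by positivity)
      rw [mul_pow, mul_pow, Real.sq_sqrt hE]
      ring
    have h4 : 0 ≤ 2 * φ x * K := mul_nonneg (mul_nonneg zero_le_two (h0 x)) K.coe_nonneg
    refine (mul_le_mul_of_nonneg_left h3 h4).trans ?_
    have h5 : φ x ^ 2 * hodgeEnergy α x = (φ x * √(hodgeEnergy α x)) ^ 2 := by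
      rw [mul_pow, Real.sq_sqrt hE]
    rw [h5]
    -- Young's inequality; the weight 4 leaves the coefficient `1/2` before `φ² E`, to be absorbed.
    have h6 := two_mul_le_add_sq (φ x * √(hodgeEnergy α x)) (4 * (K * ‖α x‖))
    nlinarith [h6]
  have hle := integral_mono hi.neg ((hint.const_mul (1 / 2)).add (hint2.const_mul (8 * K ^ 2))) hpt
  simp only [Pi.neg_apply, Pi.add_apply] at hle
  rw [integral_neg, ← he, integral_add (hint.const_mul (1 / 2)) (hint2.const_mul (8 * K ^ 2)),
    integral_const_mul, integral_const_mul] at hle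
  linarith

/-- Fatou's lemma along the exhausting cutoffs, with slopes `1/(k+1)`, gives zero total energy; the
energy is nonnegative and continuous, so it vanishes everywhere. -/
theorem hodgeEnergy_eq_zero {α : OneForm n M} (hα : IsHarmonicForm α)
    (h2 : MemLp (fun x ↦ ‖α x‖) 2 (vol n M)) (x : M) : hodgeEnergy α x = 0 := by
  have := sigmaCompactSpace n M
  obtain ⟨φ, hφ⟩ := exists_isExhaustingCutoff n M
  have hE := hodgeEnergy_nonneg α
  have hEc := continuous_hodgeEnergy hα
  have hlim : ∀ y, Filter.Tendsto (fun k ↦ ENNReal.ofReal (φ k y ^ 2 * hodgeEnergy α y))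
      Filter.atTop (nhds (ENNReal.ofReal (hodgeEnergy α y))) := by
    intro y
    have := ((hφ.tendsto y).pow 2).mul_const (hodgeEnergy α y)
    rw [one_pow, one_mul] at this
    exact ENNReal.tendsto_ofReal this
  have hbound : ∀ k : ℕ, ∫⁻ y, ENNReal.ofReal (φ k y ^ 2 * hodgeEnergy α y) ∂(vol n M) ≤
      ENNReal.ofReal (16 * (((k : ℝ) + 1)⁻¹) ^ 2 * ∫ y, ‖α y‖ ^ 2 ∂(vol n M)) := by
    intro k
    obtain ⟨hi, hle⟩ := integral_cutoff_sq_mul_hodgeEnergy_le hα h2 (hφ.lipschitz k)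
      (hφ.nonneg k) (hφ.le_one k) (hφ.hasCompactSupport k)
    rw [← ofReal_integral_eq_lintegral_ofReal hi
      (Filter.Eventually.of_forall fun y ↦ mul_nonneg (sq_nonneg _) (hE y))]
    refine ENNReal.ofReal_le_ofReal (hle.trans (le_of_eq ?_))
    push_cast
    rfl
  have hb0 : Filter.Tendsto (fun k : ℕ ↦
      ENNReal.ofReal (16 * (((k : ℝ) + 1)⁻¹) ^ 2 * ∫ y, ‖α y‖ ^ 2 ∂(vol n M)))
      Filter.atTop (nhds 0) := by
    have h3 := (((tendsto_one_div_add_atTop_nhds_zero_nat (𝕜 := ℝ)).pow 2).const_mul 16).mul_const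
      (∫ y, ‖α y‖ ^ 2 ∂(vol n M))
    simp only [one_div] at h3
    have := ENNReal.tendsto_ofReal h3
    simpa using this
  have hzero : ∫⁻ y, ENNReal.ofReal (hodgeEnergy α y) ∂(vol n M) = 0 := by
    refine le_antisymm ?_ zero_le
    calc ∫⁻ y, ENNReal.ofReal (hodgeEnergy α y) ∂(vol n M)
        = ∫⁻ y, Filter.liminf (fun k ↦ ENNReal.ofReal (φ k y ^ 2 * hodgeEnergy α y))
          Filter.atTop ∂(vol n M) := lintegral_congr fun y ↦ (hlim y).liminf_eq.symm
      _ ≤ Filter.liminf (fun k ↦ ∫⁻ y, ENNReal.ofReal (φ k y ^ 2 * hodgeEnergy α y) ∂(vol n M))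
          Filter.atTop := lintegral_liminf_le fun k ↦
            ((((hφ.lipschitz k).continuous.pow 2).mul hEc).measurable).ennreal_ofReal
      _ ≤ Filter.liminf (fun k : ℕ ↦ ENNReal.ofReal (16 * (((k : ℝ) + 1)⁻¹) ^ 2 *
          ∫ y, ‖α y‖ ^ 2 ∂(vol n M))) Filter.atTop :=
            Filter.liminf_le_liminf (Filter.Eventually.of_forall hbound)
      _ = 0 := hb0.liminf_eq
  rw [lintegral_eq_zero_iff hEc.measurable.ennreal_ofReal] at hzero
  have hae : hodgeEnergy α =ᵐ[vol n M] fun _ ↦ 0 := by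
    filter_upwards [hzero] with y hy
    exact le_antisymm (ENNReal.ofReal_eq_zero.1 hy) (hE y)
  exact congrFun (Continuous.ae_eq_iff_eq (vol n M) hEc continuous_const |>.1 hae) x

/-- Here `df(w) = div(f w)`. Against the cutoff `φ k` its integral is at most `1/(k+1)` times `∫ |f|
|w|`, finite by Cauchy-Schwarz; integrability of `df(w)` permits the limit by dominated convergence.
-/
theorem integral_mvfderiv_eq_zero {f : M → ℝ} (hf : ∀ x, SmoothAt n f x)
    (hf2 : MemLp f 2 (vol n M)) {w : (x : M) → TangentSpace (𝓡 n) x} (hw : IsSmoothField w)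
    (hdiv : ∀ x, dvg w x = 0) (hw2 : MemLp (fun x ↦ ‖w x‖) 2 (vol n M))
    (hint : Integrable (fun x ↦ mvfderiv (𝓡 n) f x (w x)) (vol n M)) :
    ∫ x, mvfderiv (𝓡 n) f x (w x) ∂(vol n M) = 0 := by
  have := sigmaCompactSpace n M
  obtain ⟨φ, hφ⟩ := exists_isExhaustingCutoff n M
  have hfw : Integrable (fun x ↦ |f x| * ‖w x‖) (vol n M) := hf2.abs.integrable_mul hw2
  have hX := hw.smul hf
  have hdX : ∀ x, dvg (fun y ↦ f y • w y) x = mvfderiv (𝓡 n) f x (w x) := fun x ↦ by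
    rw [dvg_smul hw (hf x), hdiv, mul_zero, zero_add]
  have hlim : Filter.Tendsto (fun k ↦ ∫ x, φ k x * mvfderiv (𝓡 n) f x (w x) ∂(vol n M))
      Filter.atTop (nhds (∫ x, mvfderiv (𝓡 n) f x (w x) ∂(vol n M))) := by
    refine tendsto_integral_of_dominated_convergence
      (fun x ↦ |mvfderiv (𝓡 n) f x (w x)|) (fun k ↦ ?_) hint.abs (fun k ↦ ?_) ?_
    · exact (hφ.lipschitz k).continuous.aestronglyMeasurable.mul hint.aestronglyMeasurable
    · refine Filter.Eventually.of_forall fun x ↦ ?_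
      rw [norm_mul, Real.norm_eq_abs, Real.norm_eq_abs, abs_of_nonneg (hφ.nonneg k x)]
      exact mul_le_of_le_one_left (abs_nonneg _) (hφ.le_one k x)
    · refine Filter.Eventually.of_forall fun x ↦ ?_
      simpa using (hφ.tendsto x).mul_const (mvfderiv (𝓡 n) f x (w x))
  have hbound : ∀ k : ℕ, ‖∫ x, φ k x * mvfderiv (𝓡 n) f x (w x) ∂(vol n M)‖ ≤
      1 / ((k : ℝ) + 1) * ∫ x, |f x| * ‖w x‖ ∂(vol n M) := by
    intro k
    obtain ⟨-, he⟩ := integral_mul_dvg hX (hφ.hasCompactSupport k)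
      (lipschitzInCharts_of_lipschitzWith (hφ.lipschitz k)) (hφ.lipschitz k).continuous
    simp only [hdX] at he
    rw [he, norm_neg, ← integral_const_mul]
    refine norm_integral_le_of_norm_le (hfw.const_mul _) (Filter.Eventually.of_forall fun x ↦ ?_)
    rw [Real.norm_eq_abs]
    refine (abs_mvfderiv_le_of_lipschitzWith (hφ.lipschitz k) x _).trans (le_of_eq ?_)
    rw [norm_smul, Real.norm_eq_abs]
    push_cast
    rw [one_div]
  have hb0 := (tendsto_one_div_add_atTop_nhds_zero_nat (𝕜 := ℝ)).mul_const
    (∫ x, |f x| * ‖w x‖ ∂(vol n M))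
  rw [zero_mul] at hb0
  exact tendsto_nhds_unique hlim (squeeze_zero_norm hbound hb0)

theorem mem_l2Form {α : OneForm n M} (hα : IsSmoothForm α)
    (h2 : MemLp (fun x ↦ ‖α x‖) 2 (vol n M)) : α ∈ L2Form n M := by
  refine ⟨fun x₀ i ↦ ?_, (eLpNorm (fun x ↦ ‖α x‖) 2 (vol n M)).toReal, ENNReal.toReal_nonneg,
    fun x ↦ ‖α x‖, h2, ?_, Filter.Eventually.of_forall fun x ↦ le_rfl⟩
  · exact ContinuousOn.aemeasurable (fun y hy ↦
      (hα.smoothAt_frame hy i).continuousAt.continuousWithinAt) (measurableSet_source x₀)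
  · rw [ENNReal.ofReal_toReal h2.2.ne]

theorem mk_eq_zero_of_isL2Exact {β : OneForm n M} (hβ : IsL2Exact β) (h : β ∈ L2Form n M) :
    (Submodule.Quotient.mk ⟨β, h⟩ : EulerDual n M) = 0 := by
  refine (Submodule.Quotient.mk_eq_zero _).2 fun ε _ ↦ ⟨⟨β, h⟩, hβ, ?_⟩
  rw [sub_self]
  exact L2Bound.zero

end Complete

end Riem

end

theorem proposition1 {n : ℕ} {M : Type*} [EMetricSpace M] [SecondCountableTopology M]
    [ChartedSpace (Riem.Euc n) M] [IsManifold (𝓡 n) ∞ M]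
    [RiemannianBundle (fun x : M ↦ TangentSpace (𝓡 n) x)]
    [IsContMDiffRiemannianBundle (𝓡 n) ∞ (Riem.Euc n) (fun x : M ↦ TangentSpace (𝓡 n) x)]
    [IsRiemannianManifold (𝓡 n) M] [CompleteSpace M]
    [MeasurableSpace M] [BorelSpace M]
    (α : Riem.OneForm n M)
    (hα : Riem.IsHarmonicForm α)
    (h2 : MemLp (fun x ↦ ‖α x‖) 2 (Riem.vol n M))
    (h4 : MemLp (fun x ↦ ‖α x‖) 4 (Riem.vol n M)) :
    -- `v = α^♯` is a steady solution of the Euler equations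
    Riem.IsSteadyEulerSolution (Riem.sharp α) ∧
    -- `L_v α = d (ι_v α)`, where `ι_v α` is a smooth function in `L²`
    (∀ x, Riem.lieD (Riem.sharp α) α x
      = mvfderiv (𝓡 n) (Riem.contract (Riem.sharp α) α) x) ∧
    ContMDiff (𝓡 n) 𝓘(ℝ, ℝ) ∞ (Riem.contract (Riem.sharp α) α) ∧
    MemLp (Riem.contract (Riem.sharp α) α) 2 (Riem.vol n M) ∧
    Riem.IsL2Exact (Riem.lieD (Riem.sharp α) α) ∧
    -- `α ∈ Ω¹_{L²}`, and the coset of `L_v α` vanishes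
    α ∈ Riem.L2Form n M ∧
    (∀ h : Riem.lieD (Riem.sharp α) α ∈ Riem.L2Form n M,
      (Submodule.Quotient.mk ⟨Riem.lieD (Riem.sharp α) α, h⟩ : Riem.EulerDual n M) = 0) ∧
    -- the pairing of `L_v α` with divergence-free `L²` vector fields vanishes
    (∀ w : (x : M) → TangentSpace (𝓡 n) x, Riem.IsSmoothField w →
      (∀ x, Riem.dvg w x = 0) → MemLp (fun x ↦ ‖w x‖) 2 (Riem.vol n M) →
      Integrable (fun x ↦ Riem.lieD (Riem.sharp α) α x (w x)) (Riem.vol n M) →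
      ∫ x, Riem.lieD (Riem.sharp α) α x (w x) ∂(Riem.vol n M) = 0) := by
  have hs := hα.1
  have hE := Riem.hodgeEnergy_eq_zero hα h2
  have hsq : ∀ x, Riem.dvg (Riem.sharp α) x ^ 2 + Riem.extDSq α x / 2 = 0 := hE
  have hdiv : ∀ x, Riem.dvg (Riem.sharp α) x = 0 := fun x ↦ by
    have h3 := Riem.extDSq_nonneg α x
    have h5 := hsq x
    have h6 : Riem.dvg (Riem.sharp α) x ^ 2 = 0 := by
      linarith [sq_nonneg (Riem.dvg (Riem.sharp α) x)]
    exact pow_eq_zero_iff two_ne_zero |>.1 h6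
  have hclosed : ∀ x, ∀ u w, Riem.extD α x u w = 0 := fun x ↦ by
    refine Riem.extD_eq_zero_of_extDSq ?_
    have h5 := hsq x
    rw [hdiv x] at h5
    linarith
  have hcs : ContMDiff (𝓡 n) 𝓘(ℝ, ℝ) ∞ (Riem.contract (Riem.sharp α) α) :=
    Riem.smoothAt_form_field hs hs.sharp
  have hlie : ∀ x, Riem.lieD (Riem.sharp α) α x
      = mvfderiv (𝓡 n) (Riem.contract (Riem.sharp α) α) x :=
    fun x ↦ Riem.lieD_sharp_eq_mvfderiv hs (hclosed x)
  have hc2 : MemLp (Riem.contract (Riem.sharp α) α) 2 (Riem.vol n M) := by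
    have h5 : Riem.contract (Riem.sharp α) α = fun x ↦ ‖α x‖ ^ 2 :=
      funext (Riem.contract_sharp α)
    have h6 : (4 : ENNReal) / 2 = 2 := by
      refine (ENNReal.eq_div_iff two_ne_zero ENNReal.ofNat_ne_top).2 ?_ |>.symm
      norm_num
    -- The square of an L⁴ function is in `L^(4/2)`; this is the use of the L⁴ hypothesis.
    have h7 := h4.norm_rpow_div 2
    rw [h6] at h7
    simpa [h5] using h7
  have hexact : Riem.IsL2Exact (Riem.lieD (Riem.sharp α) α) := ⟨_, hcs, hc2, hlie⟩
  refine ⟨⟨hs.sharp, fun y ↦ -(1 / 2) * Riem.contract (Riem.sharp α) α y,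
    contMDiff_const.mul hcs, fun t x ↦ ⟨differentiableAt_const _, ?_, hdiv x⟩⟩, hlie, hcs, hc2,
    hexact, Riem.mem_l2Form hs h2, Riem.mk_eq_zero_of_isL2Exact hexact, ?_⟩
  · rw [deriv_const, zero_add]
    exact Riem.covD_sharp_eq_grad hs (hclosed x)
  · intro w hw hwd hw2 hint
    simp only [hlie] at hint ⊢
    exact Riem.integral_mvfderiv_eq_zero hcs hc2 hw hwd hw2 hint
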